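/- A dynamic path $P$ consists of vertices $x_0<x_1<\dots<x_n$ on the real line (so $|P|=n+1$), a number $w_i\in\mathbb Z_{\ge 0}$ of people at each vertex $x_i$, edges $e_i=(x_{i-1},x_i)$ ($1\le i\le n$) with arbitrary positive integral capacities $c_i$, and a time $\tau>0$ needed to travel one unit of distance, such that all travel times $|x_i-x_j|\tau$ are integers. $P_{i,j}$ denotes the subpath with vertices $x_i,\dots,x_j$. Given a sink $y\in[x_i,x_j]$, all people of $P_{i,j}$ move along the path towards $y$: at every integer time $0,1,2,\dots$, from every vertex other than $y$, as many as possible of the people present there, but at most the capacity of the edge leading towards $y$, enter that edge together, and they arrive after its travel time; on the edge that contains $y$ (if $y$ is not a vertex), they stop at $y$ after the travel time to $y$. Let $\Theta_L(P_{i,j},y)$ and $\Theta_R(P_{i,j},y)$ be the times by which everybody starting to the left, respectively to the right, of $y$ has reached $y$ ($0$ if nobody starts there), and let $\Theta(P_{i,j},y)=\max\{\Theta_L(P_{i,j},y),\Theta_R(P_{i,j},y)\}$. For $1\le k\le |P|$, a $k$-sink evacuation protocol consists of indices $0=i_0<i_1<\dots<i_k=n+1$, which partition $P$ into the subpaths $P_j=P_{i_{j-1},\,i_j-1}$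 ($1\le j\le k$), and of sinks $y_j\in[x_{i_{j-1}},x_{i_j-1}]$, which need not be vertices. Its evacuation time is $\max_{1\le j\le k}\Theta(P_j,y_j)$, and $\Theta^k(P)$ is the minimum evacuation time over all $k$-sink evacuation protocols. Theorem. There is one algorithm that, for every dynamic path $P$ and every $1\le k\le |P|$, computes $\Theta^k(P)$ and also outputs a $k$-sink evacuation protocol $(i_0,\dots,i_k;\,y_1,\dots,y_k)$ with $$\max_{1\le j\le k}\Theta(P_j,y_j)=\Theta^k(P),$$ in time $O(k\,|P|\log^2|P|)$ if $|P|\ge 2$, and $O(1)$ if $|P|=1$, with absolute implied constants. Here an algorithm is a program for a random access machine with unit cost for arithmetic and comparison of real numbers and of nonnegative integer words (with integer division), for conversion of words to reals, and for access to memory, where words have $O(\log(2+n+k+\sum_i w_i+\sum_i c_i))$ bits. -/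

import Mathlib

namespace Evac

/-! ### Flow of people along a line of vertices, in integer time steps -/

/-- Number of people standing at a vertex at time `t`, just before the wave of time `t` leaves.
`a s` people arrive (or start) there at time `s`, and `c` is the capacity of the edge by which
they leave: at every time step as many people as possible, at most `c`, enter that edge. -/
def waiting (c : ℕ) (a : ℕ → ℕ) : ℕ → ℕ
  | 0 => a 0
  | t + 1 => (waiting c a t - min c (waiting c a t)) + a (t + 1)

/-- Size of the wave that enters the edge at time `t`. -/
def wave (c : ℕ) (a : ℕ → ℕ) (t : ℕ) : ℕ := min c (waiting c a t)

/-- Everybody moves along the line `0, 1, 2, …` in increasing direction; `w m` people start at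
vertex `m`, and the edge from `m` to `m + 1` has capacity `c m` and travel time `T m`.
`arrivals w c T m t` is the number of people who arrive at vertex `m` at time `t`
(the people starting at `m` count as arriving at time `0`). -/
def arrivals (w c T : ℕ → ℕ) : ℕ → ℕ → ℕ
  | 0 => fun t => if t = 0 then w 0 else 0
  | m + 1 => fun t => (if t = 0 then w (m + 1) else 0) +
      (if T m ≤ t then wave (c m) (arrivals w c T m) (t - T m) else 0)

/-- `f t` people depart at time `t` towards a point which is `d` time units away; this is the
least time `S ≥ 0` by which `N` people have reached that point. -/
noncomputable def completion (f : ℕ → ℕ) (N : ℕ) (d : ℝ) : ℝ :=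
  sInf {S : ℝ | 0 ≤ S ∧
    (∑ t ∈ Finset.range (⌊S⌋₊ + 1), if (t : ℝ) + d ≤ S then f t else 0) = N}

/-- Time at which all the people of the first `m` vertices of a line have reached a sink that lies
on the edge leaving the last of these vertices, `d` time units away from it
(`0` if there is no such vertex). -/
noncomputable def lineTime (w c T : ℕ → ℕ) : ℕ → ℝ → ℝ
  | 0, _ => 0
  | m + 1, d => completion (wave (c m) (arrivals w c T m)) (∑ v ∈ Finset.range (m + 1), w v) d

/-! ### Dynamic paths -/

/-- A dynamic path with vertices `x 0 < x 1 < ⋯ < x n`, with `w i` people at vertex `i`, and with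
edges `e_i = (x (i - 1), x i)` of capacity `c i`, for `1 ≤ i ≤ n`; `τ` is the time needed to travel
one unit of distance. Values at other indices play no role. -/
structure DynamicPath where
  n : ℕ
  x : ℕ → ℝ
  w : ℕ → ℕ
  c : ℕ → ℕ
  τ : ℝ
  x_lt : ∀ i, i < n → x i < x (i + 1)
  τ_pos : 0 < τ
  c_pos : ∀ i, 1 ≤ i → i ≤ n → 0 < c i
  integral : ∀ i j, i ≤ n → j ≤ n → ∃ z : ℤ, |x i - x j| * τ = z

namespace DynamicPath

variable (P : DynamicPath)

/-- Number of vertices. -/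
def size : ℕ := P.n + 1

/-- Travel time of the edge `e_i` (the number below is an integer). -/
noncomputable def travel (i : ℕ) : ℕ := ⌊(P.x i - P.x (i - 1)) * P.τ⌋₊

/-- Time for the people left of the sink `y` to reach `y`, in the subpath with vertices
`x i, …, x j`. -/
noncomputable def thetaL (i j : ℕ) (y : ℝ) : ℝ :=
  let m := ((Finset.Icc i j).filter fun v => P.x v < y).card
  lineTime (fun v => P.w (i + v)) (fun v => P.c (i + v + 1)) (fun v => P.travel (i + v + 1))
    m ((y - P.x (i + (m - 1))) * P.τ)

/-- Time for the people right of the sink `y` to reach `y`, in the subpath with vertices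
`x i, …, x j`. -/
noncomputable def thetaR (i j : ℕ) (y : ℝ) : ℝ :=
  let m := ((Finset.Icc i j).filter fun v => y < P.x v).card
  lineTime (fun v => P.w (j - v)) (fun v => P.c (j - v)) (fun v => P.travel (j - v))
    m ((P.x (j - (m - 1)) - y) * P.τ)

/-- Evacuation time of the subpath with vertices `x i, …, x j` to the sink `y`. -/
noncomputable def theta (i j : ℕ) (y : ℝ) : ℝ := max (P.thetaL i j y) (P.thetaR i j y)

/-- `I` and `Y` form a `k`-sink evacuation protocol: `0 = I 0 < I 1 < ⋯ < I k = n + 1`, the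
`j`-th subpath (`j < k`) has the vertices `x (I j), …, x (I (j + 1) - 1)`, and its sink `Y j` is any
point of that subpath. -/
structure IsProtocol (k : ℕ) (I : Fin (k + 1) → ℕ) (Y : Fin k → ℝ) : Prop where
  first : I 0 = 0
  last : I (Fin.last k) = P.n + 1
  mono : StrictMono I
  left_le : ∀ j : Fin k, P.x (I j.castSucc) ≤ Y j
  le_right : ∀ j : Fin k, Y j ≤ P.x (I j.succ - 1)

/-- Evacuation time of a protocol: the maximum over its subpaths. -/
noncomputable def protocolTime (k : ℕ) (I : Fin (k + 1) → ℕ) (Y : Fin k → ℝ) : ℝ :=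
  ⨆ j : Fin k, P.theta (I j.castSucc) (I j.succ - 1) (Y j)

/-- The optimal `k`-sink evacuation time. -/
noncomputable def optTime (k : ℕ) : ℝ :=
  sInf {S : ℝ | ∃ I Y, P.IsProtocol k I Y ∧ S = P.protocolTime k I Y}

end DynamicPath

/-! ### The machine: a random access machine with cells for words (natural numbers up to a bound
`B`) and cells for real numbers, and unit cost for every elementary operation -/

/-- Memory: registers and finitely many arrays (one for each array name used by the program). -/
structure Store where
  natReg : ℕ → ℕ
  realReg : ℕ → ℝ
  natArr : ℕ → ℕ → ℕ
  realArr : ℕ → ℕ → ℝ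

/-- Word expressions (`sub` is truncated at `0`, `div` rounds down). -/
inductive NExp where
  | lit (v : ℕ)
  | reg (r : ℕ)
  | get (a : ℕ) (i : NExp)
  | add (e f : NExp)
  | sub (e f : NExp)
  | mul (e f : NExp)
  | div (e f : NExp)

/-- Real expressions. There is no rounding of reals to words. -/
inductive RExp where
  | ofNat (e : NExp)
  | reg (r : ℕ)
  | get (a : ℕ) (i : NExp)
  | add (e f : RExp)
  | sub (e f : RExp)
  | mul (e f : RExp)
  | div (e f : RExp)

/-- Tests. -/
inductive Test where
  | natLe (e f : NExp)
  | realLe (e f : RExp)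
  | not (b : Test)
  | and (b d : Test)

namespace NExp

def eval (s : Store) : NExp → ℕ
  | lit v => v
  | reg r => s.natReg r
  | get a i => s.natArr a (i.eval s)
  | add e f => e.eval s + f.eval s
  | sub e f => e.eval s - f.eval s
  | mul e f => e.eval s * f.eval s
  | div e f => e.eval s / f.eval s

/-- All intermediate results are words, i.e. at most `B`. -/
def Fits (B : ℕ) (s : Store) : NExp → Prop
  | lit v => v ≤ B
  | reg r => s.natReg r ≤ B
  | get a i => i.Fits B s ∧ s.natArr a (i.eval s) ≤ B
  | add e f => e.Fits B s ∧ f.Fits B s ∧ e.eval s + f.eval s ≤ B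
  | sub e f => e.Fits B s ∧ f.Fits B s
  | mul e f => e.Fits B s ∧ f.Fits B s ∧ e.eval s * f.eval s ≤ B
  | div e f => e.Fits B s ∧ f.Fits B s

/-- Number of elementary operations. -/
def cost : NExp → ℕ
  | lit _ => 1
  | reg _ => 1
  | get _ i => i.cost + 1
  | add e f => e.cost + f.cost + 1
  | sub e f => e.cost + f.cost + 1
  | mul e f => e.cost + f.cost + 1
  | div e f => e.cost + f.cost + 1

end NExp

namespace RExp

noncomputable def eval (s : Store) : RExp → ℝ
  | ofNat e => (e.eval s : ℝ)
  | reg r => s.realReg r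
  | get a i => s.realArr a (i.eval s)
  | add e f => e.eval s + f.eval s
  | sub e f => e.eval s - f.eval s
  | mul e f => e.eval s * f.eval s
  | div e f => e.eval s / f.eval s

def Fits (B : ℕ) (s : Store) : RExp → Prop
  | ofNat e => e.Fits B s
  | reg _ => True
  | get _ i => i.Fits B s
  | add e f => e.Fits B s ∧ f.Fits B s
  | sub e f => e.Fits B s ∧ f.Fits B s
  | mul e f => e.Fits B s ∧ f.Fits B s
  | div e f => e.Fits B s ∧ f.Fits B s

def cost : RExp → ℕ
  | ofNat e => e.cost + 1
  | reg _ => 1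
  | get _ i => i.cost + 1
  | add e f => e.cost + f.cost + 1
  | sub e f => e.cost + f.cost + 1
  | mul e f => e.cost + f.cost + 1
  | div e f => e.cost + f.cost + 1

end RExp

namespace Test

def Holds (s : Store) : Test → Prop
  | natLe e f => e.eval s ≤ f.eval s
  | realLe e f => e.eval s ≤ f.eval s
  | not b => ¬ b.Holds s
  | and b d => b.Holds s ∧ d.Holds s

def Fits (B : ℕ) (s : Store) : Test → Prop
  | natLe e f => e.Fits B s ∧ f.Fits B s
  | realLe e f => e.Fits B s ∧ f.Fits B s
  | not b => b.Fits B s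
  | and b d => b.Fits B s ∧ d.Fits B s

def cost : Test → ℕ
  | natLe e f => e.cost + f.cost + 1
  | realLe e f => e.cost + f.cost + 1
  | not b => b.cost + 1
  | and b d => b.cost + d.cost + 1

end Test

/-- Programs. -/
inductive Prog where
  | skip
  | setNat (r : ℕ) (e : NExp)
  | setReal (r : ℕ) (e : RExp)
  | putNat (a : ℕ) (i e : NExp)
  | putReal (a : ℕ) (i : NExp) (e : RExp)
  | seq (p q : Prog)
  | ite (b : Test) (p q : Prog)
  | loop (b : Test) (p : Prog)

namespace Store

def setNat (s : Store) (r v : ℕ) : Store :=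
  { s with natReg := Function.update s.natReg r v }

def setReal (s : Store) (r : ℕ) (v : ℝ) : Store :=
  { s with realReg := Function.update s.realReg r v }

def putNat (s : Store) (a i v : ℕ) : Store :=
  { s with natArr := Function.update s.natArr a (Function.update (s.natArr a) i v) }

def putReal (s : Store) (a i : ℕ) (v : ℝ) : Store :=
  { s with realArr := Function.update s.realArr a (Function.update (s.realArr a) i v) }

end Store

/-- `Exec B p s t s'`: started in memory `s`, the program `p` halts after `t` steps in memory `s'`,
and all words occurring on the way are at most `B`. -/
inductive Exec (B : ℕ) : Prog → Store → ℕ → Store → Prop where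
  | skip (s : Store) : Exec B Prog.skip s 1 s
  | setNat (s : Store) (r : ℕ) (e : NExp) (h : e.Fits B s) :
      Exec B (Prog.setNat r e) s (e.cost + 1) (s.setNat r (e.eval s))
  | setReal (s : Store) (r : ℕ) (e : RExp) (h : e.Fits B s) :
      Exec B (Prog.setReal r e) s (e.cost + 1) (s.setReal r (e.eval s))
  | putNat (s : Store) (a : ℕ) (i e : NExp) (hi : i.Fits B s) (h : e.Fits B s) :
      Exec B (Prog.putNat a i e) s (i.cost + e.cost + 1) (s.putNat a (i.eval s) (e.eval s))
  | putReal (s : Store) (a : ℕ) (i : NExp) (e : RExp) (hi : i.Fits B s) (h : e.Fits B s) :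
      Exec B (Prog.putReal a i e) s (i.cost + e.cost + 1) (s.putReal a (i.eval s) (e.eval s))
  | seq {p q : Prog} {s s' s'' : Store} {t t' : ℕ} (hp : Exec B p s t s')
      (hq : Exec B q s' t' s'') : Exec B (Prog.seq p q) s (t + t') s''
  | ite_true {b : Test} {p q : Prog} {s s' : Store} {t : ℕ} (hf : b.Fits B s) (hb : b.Holds s)
      (hp : Exec B p s t s') : Exec B (Prog.ite b p q) s (b.cost + 1 + t) s'
  | ite_false {b : Test} {p q : Prog} {s s' : Store} {t : ℕ} (hf : b.Fits B s) (hb : ¬ b.Holds s)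
      (hq : Exec B q s t s') : Exec B (Prog.ite b p q) s (b.cost + 1 + t) s'
  | loop_true {b : Test} {p : Prog} {s s' s'' : Store} {t t' : ℕ} (hf : b.Fits B s)
      (hb : b.Holds s) (hp : Exec B p s t s') (hl : Exec B (Prog.loop b p) s' t' s'') :
      Exec B (Prog.loop b p) s (b.cost + 1 + t + t') s''
  | loop_false {b : Test} {p : Prog} {s : Store} (hf : b.Fits B s) (hb : ¬ b.Holds s) :
      Exec B (Prog.loop b p) s (b.cost + 1) s

/-! ### Input -/

/-- Initial memory for the dynamic path `P` and the number `k`: word registers `0` and `1` hold `n`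
and `k`, word arrays `0` and `1` hold the weights `w 0, …, w n` and the capacities `c 1, …, c n`,
real register `0` holds `τ`, real array `0` holds the positions `x 0, …, x n`, and everything else
is `0`. -/
noncomputable def DynamicPath.input (P : DynamicPath) (k : ℕ) : Store where
  natReg r := if r = 0 then P.n else if r = 1 then k else 0
  realReg r := if r = 0 then P.τ else 0
  natArr a i :=
    if a = 0 ∧ i ≤ P.n then P.w i else if a = 1 ∧ 1 ≤ i ∧ i ≤ P.n then P.c i else 0
  realArr a i := if a = 0 ∧ i ≤ P.n then P.x i else 0

/-- Magnitude of the words in the input. Words of `O(log (P.magnitude k))` bits are words that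
are bounded by a fixed power of it. -/
def DynamicPath.magnitude (P : DynamicPath) (k : ℕ) : ℕ :=
  P.n + k + (∑ i ∈ Finset.Icc 0 P.n, P.w i) + (∑ i ∈ Finset.Icc 1 P.n, P.c i) + 2

end Evac

/-!
The optimal deadline is found by parametric search over a greedy test, and the greedy protocol for
it is the output.

*Evacuation times.* The people leaving a vertex by a given time are as many as the bottlenecks on
their way allow (`le_departed_iff`). Hence everybody left of a sink `y` has reached it by time `S`
if and only if, for every group of people starting at the vertices `x i, …, x v` and every edge `e`
between `x v` and `y`, the last of the waves of size `c e` formed by this group arrives in time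
(`thetaL_le_iff`, and `thetaR_le_iff` for the other side). These conditions are monotone in the sink
and in the ends of the subpath, and along one edge the two evacuation times are linear in the sink.

*One sink.* Going to the right, the time for the people from the left grows and the time for the
people from the right decreases. With the edge on which the two cross, the optimal time of a subpath
(`sinkTime`) is the minimum of three explicit numbers (`served_iff_of_cross`).

*Greedy test.* For a deadline `T`, it is best to put the first sink as far to the right as the people
on its left permit, and then to let it serve as many vertices on its right as possible
(`greedy_step`, `feasible_succ_iff`). The last possible vertices are found by a galloping search,
whose tests evaluate evacuation times to a vertex in linear time, by a scan with a running minimum of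
the capacities. A search costs `O(log n)` scans over an interval of at most about twice the length of
its result, so that the searches of all the sinks together take time `O(n log n)` (`greedyProg_spec`).

*Parametric search.* Let `q` be the start of the second subpath. If `q` is moved to the right, the
time of the first subpath grows and the time of the rest decreases. A galloping search
with the greedy test, for the deadline given by the first subpath, finds the place `a` where this
changes: then either the first subpath ends at `x a` and determines the optimal time, or the optimal
time is that of the vertices from `x a` on with one sink less (`feasible_succ_iff_of_split`). This
is done `k` times, with `O(log n)` greedy tests of cost `O(n log n)` each.

Programs are verified with weakest preconditions that count steps (`WP`); in the rule for loops,
`WP.loop`, the remaining number of steps is part of the invariant and gives termination.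
-/

namespace Evac

/-! ### Cumulative flow along a line -/

/-- Number of people who have left a vertex by time `t` (inclusive). -/
def departed (c : ℕ) (a : ℕ → ℕ) (t : ℕ) : ℕ := ∑ s ∈ Finset.range (t + 1), wave c a s

/-- People who have come to a vertex have left it or are still waiting there. -/
theorem departed_add_waiting (c : ℕ) (a : ℕ → ℕ) (t : ℕ) :
    departed c a t + (waiting c a t - wave c a t) = ∑ s ∈ Finset.range (t + 1), a s := by
  induction t with
  | zero =>
    simp only [departed, zero_add, Finset.sum_range_one, wave, waiting]
    omega
  | succ t ih =>
    rw [Finset.sum_range_succ, ← ih]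
    have h1 : departed c a (t + 1) = departed c a t + wave c a (t + 1) := by
      simp only [departed]
      rw [Finset.sum_range_succ]
    have h2 : waiting c a (t + 1) = (waiting c a t - wave c a t) + a (t + 1) := rfl
    have h3 : wave c a (t + 1) ≤ waiting c a (t + 1) := min_le_right _ _
    omega

theorem le_departed_zero (c : ℕ) (a : ℕ → ℕ) (p : ℕ) :
    p ≤ departed c a 0 ↔ p ≤ a 0 ∧ p ≤ c := by
  simp only [departed, zero_add, Finset.sum_range_one, wave, waiting]
  omega

theorem le_departed_succ (c : ℕ) (a : ℕ → ℕ) (t p : ℕ) :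
    p ≤ departed c a (t + 1) ↔
      p ≤ ∑ s ∈ Finset.range (t + 1 + 1), a s ∧ p ≤ departed c a t + c := by
  have h1 : departed c a (t + 1) = departed c a t + wave c a (t + 1) := by
    simp only [departed]
    rw [Finset.sum_range_succ]
  have h := departed_add_waiting c a (t + 1)
  have h3 : wave c a (t + 1) = min c (waiting c a (t + 1)) := rfl
  omega

theorem sum_arrivals_zero (w c T : ℕ → ℕ) (t : ℕ) :
    ∑ s ∈ Finset.range (t + 1), arrivals w c T 0 s = w 0 := by
  simp [arrivals]

theorem sum_arrivals_succ (w c T : ℕ → ℕ) (m t : ℕ) :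
    ∑ s ∈ Finset.range (t + 1), arrivals w c T (m + 1) s =
      w (m + 1) + if T m ≤ t then departed (c m) (arrivals w c T m) (t - T m) else 0 := by
  simp only [arrivals, Finset.sum_add_distrib]
  congr 1
  · simp
  · split_ifs with h
    · obtain ⟨r, rfl⟩ := Nat.exists_eq_add_of_le h
      rw [show T m + r + 1 = T m + (r + 1) by ring, Finset.sum_range_add]
      rw [Finset.sum_eq_zero]
      · simp [departed]
      · intro s hs
        rw [Finset.mem_range] at hs
        rw [if_neg (by omega)]
    · apply Finset.sum_eq_zero
      intro s hs
      rw [Finset.mem_range] at hs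
      rw [if_neg (by omega)]

/-- The flow formula: the people who have left vertex `m` by time `t` are as many as the bottlenecks
allow. For `v ≤ e ≤ m`, the people starting at `0, …, v` pass the edge `e`, at most `c e` of them per
time step, and reach the end of the line no earlier than the travel time from `v` permits. -/
theorem le_departed_iff (w c T : ℕ → ℕ) (m t p : ℕ) :
    p ≤ departed (c m) (arrivals w c T m) t ↔
      p ≤ ∑ l ∈ Finset.range (m + 1), w l ∧ ∀ v e, v ≤ e → e ≤ m →
        p ≤ (∑ l ∈ Finset.Ioc v m, w l) + c e * (t + 1 - ∑ l ∈ Finset.Ico v m, T l) := by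
  induction m generalizing t p with
  | zero =>
    have key : ∀ t p, p ≤ departed (c 0) (arrivals w c T 0) t ↔ p ≤ w 0 ∧ p ≤ c 0 * (t + 1) := by
      intro t
      induction t with
      | zero => intro p; rw [le_departed_zero]; simp [arrivals]
      | succ t ih =>
        intro p
        rw [le_departed_succ, sum_arrivals_zero, ← tsub_le_iff_right, ih, mul_add (c 0) (t + 1) 1]
        omega
    rw [key]
    constructor
    · rintro ⟨h1, h2⟩
      refine ⟨by simpa using h1, fun v e hv he => ?_⟩
      obtain rfl : e = 0 := by omega
      obtain rfl : v = 0 := by omega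
      simpa using h2
    · rintro ⟨h1, h2⟩
      have := h2 0 0 le_rfl le_rfl
      exact ⟨by simpa using h1, by simpa using this⟩
  | succ m ihm =>
    have hI : ∀ v, v ≤ m → ∑ l ∈ Finset.Ioc v (m + 1), w l = (∑ l ∈ Finset.Ioc v m, w l) + w (m + 1) :=
      fun v hv => Finset.sum_Ioc_succ_top hv _
    have hT : ∀ v, v ≤ m → ∑ l ∈ Finset.Ico v (m + 1), T l = (∑ l ∈ Finset.Ico v m, T l) + T m :=
      fun v hv => Finset.sum_Ico_succ_top hv _
    have hA : ∀ t p, p ≤ ∑ s ∈ Finset.range (t + 1), arrivals w c T (m + 1) s ↔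
        p ≤ ∑ l ∈ Finset.range (m + 2), w l ∧ ∀ v e, v ≤ e → e ≤ m →
        p ≤ (∑ l ∈ Finset.Ioc v (m + 1), w l) +
          c e * (t + 1 - ∑ l ∈ Finset.Ico v (m + 1), T l) := by
      intro t p
      rw [sum_arrivals_succ, Finset.sum_range_succ _ (m + 1)]
      have h : ∀ v e, v ≤ e → e ≤ m → ((p ≤ (∑ l ∈ Finset.Ioc v (m + 1), w l) +
          c e * (t + 1 - ∑ l ∈ Finset.Ico v (m + 1), T l)) ↔
          p - w (m + 1) ≤ (∑ l ∈ Finset.Ioc v m, w l) +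
          c e * (t + 1 - T m - ∑ l ∈ Finset.Ico v m, T l)) := by
        intro v e hv he
        rw [hI v (by omega), hT v (by omega), add_comm (∑ l ∈ Finset.Ico v m, T l), ← Nat.sub_sub]
        omega
      split_ifs with ht
      · rw [← tsub_le_iff_left, ihm, tsub_le_iff_right]
        refine and_congr Iff.rfl ?_
        refine forall_congr' fun v => forall_congr' fun e => forall_congr' fun hv =>
          forall_congr' fun he => ?_
        rw [h v e hv he, show t - T m + 1 = t + 1 - T m by omega]
      · constructor
        · intro hp
          refine ⟨by omega, fun v e hv he => ?_⟩
          rw [h v e hv he]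
          omega
        · rintro ⟨-, h2⟩
          have := (h m m le_rfl le_rfl).1 (h2 m m le_rfl le_rfl)
          rw [show t + 1 - T m = 0 by omega] at this
          simp only [Finset.Ioc_self, Finset.sum_empty, zero_tsub, mul_zero, add_zero] at this
          omega
    induction t generalizing p with
    | zero =>
      have hA0 := hA 0 p
      rw [zero_add, Finset.sum_range_one] at hA0
      rw [le_departed_zero, hA0]
      constructor
      · rintro ⟨⟨h1, h2⟩, h3⟩
        refine ⟨h1, fun v e hv he => ?_⟩
        rcases Nat.lt_or_ge m e with hme | hme
        · obtain rfl : e = m + 1 := by omega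
          rcases Nat.lt_or_ge m v with hmv | hmv
          · obtain rfl : v = m + 1 := by omega
            simpa using h3
          · have := h2 v m hmv le_rfl
            rcases Nat.eq_zero_or_pos (∑ l ∈ Finset.Ico v (m + 1), T l) with h0 | h0
            · rw [h0]
              omega
            · rw [show 0 + 1 - ∑ l ∈ Finset.Ico v (m + 1), T l = 0 by omega] at this ⊢
              omega
        · exact h2 v e hv hme
      · rintro ⟨h1, h2⟩
        refine ⟨⟨h1, fun v e hv he => h2 v e hv (by omega)⟩, ?_⟩
        simpa using h2 (m + 1) (m + 1) le_rfl le_rfl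
    | succ t iht =>
      rw [le_departed_succ, hA (t + 1) p, ← tsub_le_iff_right, propext (iht (p - c (m + 1)))]
      constructor
      · rintro ⟨⟨h1, h2⟩, h3, h4⟩
        refine ⟨h1, fun v e hv he => ?_⟩
        rcases Nat.lt_or_ge m e with hme | hme
        · obtain rfl : e = m + 1 := by omega
          have h5 := h4 v (m + 1) hv le_rfl
          rcases Nat.lt_or_ge (t + 1) (∑ l ∈ Finset.Ico v (m + 1), T l) with h0 | h0
          · rcases Nat.lt_or_ge m v with hmv | hmv
            · obtain rfl : v = m + 1 := by omega
              simp at h0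
            · have := h2 v m hmv le_rfl
              rw [show t + 1 + 1 - ∑ l ∈ Finset.Ico v (m + 1), T l = 0 by omega] at this ⊢
              omega
          · rw [show t + 1 + 1 - ∑ l ∈ Finset.Ico v (m + 1), T l =
              (t + 1 - ∑ l ∈ Finset.Ico v (m + 1), T l) + 1 by omega, mul_add]
            omega
        · exact h2 v e hv hme
      · rintro ⟨h1, h2⟩
        refine ⟨⟨h1, fun v e hv he => h2 v e hv (by omega)⟩, by omega, fun v e hv he => ?_⟩
        rcases Nat.lt_or_ge (t + 1) (∑ l ∈ Finset.Ico v (m + 1), T l) with h0 | h0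
        · have := h2 v e hv he
          rw [show t + 1 + 1 - ∑ l ∈ Finset.Ico v (m + 1), T l = 0 by omega] at this
          omega
        · have h5 := h2 v e hv he
          have h6 := h2 v (m + 1) (by omega) le_rfl
          rw [show t + 1 + 1 - ∑ l ∈ Finset.Ico v (m + 1), T l =
              (t + 1 - ∑ l ∈ Finset.Ico v (m + 1), T l) + 1 by omega, mul_add] at h5 h6
          rcases le_total (c e) (c (m + 1)) with hc | hc
          · omega
          · have := Nat.mul_le_mul_right (t + 1 - ∑ l ∈ Finset.Ico v (m + 1), T l) hc
            omega

/-- By time `t`, everybody has left the line through the edge `m` if and only if, for `v ≤ e ≤ m`,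
the `N` people starting at `0, …, v` can pass the edge `e` in waves of size `c e`;
the last of these waves is number `(N - 1) / c e`, counted from `0`. -/
theorem departed_eq_iff (w c T : ℕ → ℕ) (m t : ℕ) (hc : ∀ e, e ≤ m → 0 < c e) :
    departed (c m) (arrivals w c T m) t = ∑ l ∈ Finset.range (m + 1), w l ↔
      ∀ v e, v ≤ e → e ≤ m → 0 < ∑ l ∈ Finset.range (v + 1), w l →
        (∑ l ∈ Finset.Ico v m, T l) + ((∑ l ∈ Finset.range (v + 1), w l) - 1) / c e ≤ t := by
  have hle := ((le_departed_iff w c T m t _).1 le_rfl).1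
  rw [← (hle.ge_iff_eq), le_departed_iff]
  simp only [le_refl, true_and]
  refine forall_congr' fun v => forall_congr' fun e => forall_congr' fun hv =>
          forall_congr' fun he => ?_
  have hs : ∑ l ∈ Finset.range (m + 1), w l =
      (∑ l ∈ Finset.range (v + 1), w l) + ∑ l ∈ Finset.Ioc v m, w l := by
    rw [← Finset.sum_range_add_sum_Ico w (show v + 1 ≤ m + 1 by omega)]
    congr 1
    refine Finset.sum_congr ?_ fun _ _ => rfl
    ext l
    simp only [Finset.mem_Ico, Finset.mem_Ioc]
    omega
  rw [hs]
  have hd := Nat.div_lt_iff_lt_mul (hc e he) (x := (∑ l ∈ Finset.range (v + 1), w l) - 1)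
    (y := t + 1 - ∑ l ∈ Finset.Ico v m, T l)
  rw [mul_comm] at hd
  set N := ∑ l ∈ Finset.range (v + 1), w l
  generalize (N - 1) / c e = q at hd ⊢
  constructor
  · intro h hN
    have := hd.2 (by omega)
    omega
  · intro h
    rcases Nat.eq_zero_or_pos N with hN | hN
    · omega
    · have := hd.1 (by have := h hN; omega)
      omega

/-- The time at which the last person of the line reaches a point at distance `d`. -/
theorem lineTime_succ_le_iff (w c T : ℕ → ℕ) (m : ℕ) (hc : ∀ e, e ≤ m → 0 < c e) {d : ℝ}
    (hd : 0 ≤ d) (S : ℝ) :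
    lineTime w c T (m + 1) d ≤ S ↔
      0 ≤ S ∧ ∀ v e, v ≤ e → e ≤ m → 0 < ∑ l ∈ Finset.range (v + 1), w l →
        d + (∑ l ∈ Finset.Ico v m, T l : ℕ) +
          (((∑ l ∈ Finset.range (v + 1), w l) - 1) / c e : ℕ) ≤ S := by
  have hset : {S : ℝ | 0 ≤ S ∧ (∑ t ∈ Finset.range (⌊S⌋₊ + 1),
      if (t : ℝ) + d ≤ S then wave (c m) (arrivals w c T m) t else 0) =
        ∑ v ∈ Finset.range (m + 1), w v} =
      {S : ℝ | 0 ≤ S ∧ ∀ v e, v ≤ e → e ≤ m → 0 < ∑ l ∈ Finset.range (v + 1), w l →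
        d + (∑ l ∈ Finset.Ico v m, T l : ℕ) +
          (((∑ l ∈ Finset.range (v + 1), w l) - 1) / c e : ℕ) ≤ S} := by
    ext S
    simp only [Set.mem_ofPred_eq]
    refine and_congr_right fun hS => ?_
    rcases lt_or_ge S d with hlt | hge
    · rw [Finset.sum_eq_zero]
      · constructor
        · intro h v e hv he hN
          have : ∑ l ∈ Finset.range (v + 1), w l ≤ ∑ l ∈ Finset.range (m + 1), w l :=
            Finset.sum_le_sum_of_subset (Finset.range_mono (by omega))
          omega
        · intro h
          by_contra hne
          have := h m m le_rfl le_rfl (by omega)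
          have h1 : (0 : ℝ) ≤ (∑ l ∈ Finset.Ico m m, T l : ℕ) := Nat.cast_nonneg _
          have h2 : (0 : ℝ) ≤ (((∑ l ∈ Finset.range (m + 1), w l) - 1) / c m : ℕ) :=
            Nat.cast_nonneg _
          linarith
      · intro t _
        rw [if_neg]
        have : (0 : ℝ) ≤ t := Nat.cast_nonneg _
        linarith
    · have hsum : (∑ t ∈ Finset.range (⌊S⌋₊ + 1),
          if (t : ℝ) + d ≤ S then wave (c m) (arrivals w c T m) t else 0) =
          departed (c m) (arrivals w c T m) ⌊S - d⌋₊ := by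
        rw [departed, ← Finset.sum_filter]
        apply Finset.sum_congr _ fun _ _ => rfl
        ext t
        simp only [Finset.mem_filter, Finset.mem_range, Nat.lt_succ_iff]
        rw [Nat.le_floor_iff hS, Nat.le_floor_iff (by linarith)]
        constructor
        · rintro ⟨_, h⟩
          linarith
        · intro h
          constructor <;> linarith
      rw [hsum, departed_eq_iff w c T m _ hc]
      refine forall_congr' fun v => forall_congr' fun e => forall_congr' fun hv =>
          forall_congr' fun he => forall_congr' fun hN => ?_
      rw [Nat.le_floor_iff (by linarith)]
      push_cast
      constructor <;> intro h <;> linarith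
  rw [lineTime, completion, hset]
  set A := {S : ℝ | 0 ≤ S ∧ ∀ v e, v ≤ e → e ≤ m → 0 < ∑ l ∈ Finset.range (v + 1), w l →
        d + (∑ l ∈ Finset.Ico v m, T l : ℕ) +
          (((∑ l ∈ Finset.range (v + 1), w l) - 1) / c e : ℕ) ≤ S} with hA
  have hne : A.Nonempty := by
    refine ⟨d + (∑ l ∈ Finset.range m, T l : ℕ) + (∑ l ∈ Finset.range (m + 1), w l : ℕ),
      by positivity, fun v e hv he hN => ?_⟩
    have h1 : ∑ l ∈ Finset.Ico v m, T l ≤ ∑ l ∈ Finset.range m, T l := by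
      apply Finset.sum_le_sum_of_subset
      intro l hl
      simp only [Finset.mem_Ico] at hl
      simp [hl.2]
    have h2 : ((∑ l ∈ Finset.range (v + 1), w l) - 1) / c e ≤ ∑ l ∈ Finset.range (m + 1), w l := by
      refine (Nat.div_le_self _ _).trans ((Nat.sub_le _ _).trans ?_)
      exact Finset.sum_le_sum_of_subset (Finset.range_mono (by omega))
    have h1' : ((∑ l ∈ Finset.Ico v m, T l : ℕ) : ℝ) ≤ (∑ l ∈ Finset.range m, T l : ℕ) := by
      exact_mod_cast h1
    have h2' : ((((∑ l ∈ Finset.range (v + 1), w l) - 1) / c e : ℕ) : ℝ) ≤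
        (∑ l ∈ Finset.range (m + 1), w l : ℕ) := by
      exact_mod_cast h2
    linarith
  constructor
  · intro h
    refine ⟨(le_csInf hne fun a ha => ha.1).trans h, fun v e hv he hN => ?_⟩
    exact (le_csInf hne fun a ha => ha.2 v e hv he hN).trans h
  · intro h
    exact csInf_le ⟨0, fun a ha => ha.1⟩ h

namespace DynamicPath

/-! ### Evacuation times of subpaths -/

variable (P : DynamicPath)

theorem x_lt_x {a b : ℕ} (hab : a < b) (hb : b ≤ P.n) : P.x a < P.x b := by
  induction b, hab using Nat.le_induction with
  | base => exact P.x_lt a (by omega)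
  | succ b hab ih => exact (ih (by omega)).trans (P.x_lt b (by omega))

theorem x_le_x {a b : ℕ} (hab : a ≤ b) (hb : b ≤ P.n) : P.x a ≤ P.x b := by
  rcases hab.eq_or_lt with rfl | h
  · exact le_rfl
  · exact (P.x_lt_x h hb).le

theorem x_lt_x_iff {a b : ℕ} (ha : a ≤ P.n) (hb : b ≤ P.n) : P.x a < P.x b ↔ a < b := by
  constructor
  · intro h
    by_contra hab
    exact absurd (P.x_le_x (by omega : b ≤ a) ha) (not_le.2 h)
  · exact fun h => P.x_lt_x h hb

theorem travel_cast {l : ℕ} (hl : l < P.n) :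
    (P.travel (l + 1) : ℝ) = (P.x (l + 1) - P.x l) * P.τ := by
  obtain ⟨z, hz⟩ := P.integral (l + 1) l (by omega) (by omega)
  have hx := P.x_lt l hl
  rw [abs_of_pos (by linarith)] at hz
  have h0 : 0 ≤ (P.x (l + 1) - P.x l) * P.τ := mul_nonneg (by linarith) P.τ_pos.le
  rw [travel, Nat.add_sub_cancel, hz]
  rw [hz] at h0
  lift z to ℕ using by exact_mod_cast h0
  simp

theorem sum_travel {i v m : ℕ} (hv : v ≤ m) (hm : i + m ≤ P.n) :
    ((∑ l ∈ Finset.Ico v m, P.travel (i + l + 1) : ℕ) : ℝ) =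
      (P.x (i + m) - P.x (i + v)) * P.τ := by
  induction m, hv using Nat.le_induction with
  | base => simp
  | succ m hv ih =>
    rw [Finset.sum_Ico_succ_top hv, Nat.cast_add, ih (by omega), P.travel_cast (by omega)]
    rw [show i + (m + 1) = i + m + 1 by ring]
    ring

theorem sum_travel_rev {j v m : ℕ} (hv : v ≤ m) (hm : m ≤ j) (hj : j ≤ P.n) :
    ((∑ l ∈ Finset.Ico v m, P.travel (j - l) : ℕ) : ℝ) =
      (P.x (j - v) - P.x (j - m)) * P.τ := by
  induction m, hv using Nat.le_induction with
  | base => simp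
  | succ m hv ih =>
    have h := P.travel_cast (l := j - (m + 1)) (by omega)
    rw [show j - (m + 1) + 1 = j - m by omega] at h
    rw [Finset.sum_Ico_succ_top hv, Nat.cast_add, ih (by omega), h]
    ring

/-- Number of people starting at the vertices `x a, …, x b`. -/
def people (a b : ℕ) : ℕ := ∑ l ∈ Finset.Icc a b, P.w l

theorem people_le_people {a b a' b' : ℕ} (ha : a' ≤ a) (hb : b ≤ b') :
    P.people a b ≤ P.people a' b' :=
  Finset.sum_le_sum_of_subset (Finset.Icc_subset_Icc ha hb)

/-- The people of the vertices `x i, x (i + 1), …` to the left of `y` can reach `y` by time `S`: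
every group of vertices `x i, …, x v` passes every edge `e` between `x v` and `y` in time. -/
def LeftOK (i : ℕ) (y S : ℝ) : Prop :=
  ∀ v e, i ≤ v → v < e → e ≤ P.n → P.x (e - 1) < y → 0 < P.people i v →
    (y - P.x v) * P.τ + ((P.people i v - 1) / P.c e : ℕ) ≤ S

/-- The people of the vertices `…, x (j - 1), x j` to the right of `y` can reach `y` by time `S`:
every group of vertices `x v, …, x j` passes every edge `e` between `y` and `x v` in time. -/
def RightOK (j : ℕ) (y S : ℝ) : Prop :=
  ∀ v e, 1 ≤ e → e ≤ v → v ≤ j → y < P.x e → 0 < P.people v j →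
    (P.x v - y) * P.τ + ((P.people v j - 1) / P.c e : ℕ) ≤ S

variable {P}

theorem LeftOK.mono {i i' : ℕ} {y y' S S' : ℝ} (h : P.LeftOK i y S) (hi : i ≤ i') (hy : y' ≤ y)
    (hS : S ≤ S') : P.LeftOK i' y' S' := by
  intro v e hv hve he hx hW
  have hWW := P.people_le_people hi (le_refl v)
  have h1 := h v e (by omega) hve he (hx.trans_le hy) (by omega)
  have h2 : ((P.people i' v - 1) / P.c e : ℕ) ≤ (P.people i v - 1) / P.c e :=
    Nat.div_le_div_right (by omega)
  have h3 : (((P.people i' v - 1) / P.c e : ℕ) : ℝ) ≤ ((P.people i v - 1) / P.c e : ℕ) := by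
    exact_mod_cast h2
  have h4 := mul_le_mul_of_nonneg_right (sub_le_sub_right hy (P.x v)) P.τ_pos.le
  linarith

theorem RightOK.mono {j j' : ℕ} {y y' S S' : ℝ} (h : P.RightOK j y S) (hj : j' ≤ j) (hy : y ≤ y')
    (hS : S ≤ S') : P.RightOK j' y' S' := by
  intro v e hv hve he hx hW
  have hWW := P.people_le_people (le_refl v) hj
  have h1 := h v e (by omega) hve (by omega) (hy.trans_lt hx) (by omega)
  have h2 : ((P.people v j' - 1) / P.c e : ℕ) ≤ (P.people v j - 1) / P.c e :=
    Nat.div_le_div_right (by omega)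
  have h3 : (((P.people v j' - 1) / P.c e : ℕ) : ℝ) ≤ ((P.people v j - 1) / P.c e : ℕ) := by
    exact_mod_cast h2
  have h4 := mul_le_mul_of_nonneg_right (sub_le_sub_left hy (P.x v)) P.τ_pos.le
  linarith

theorem leftOK_of_le {i : ℕ} {y S : ℝ} (hy : y ≤ P.x i) : P.LeftOK i y S := by
  intro v e hv hve he hx _
  have := P.x_le_x (a := i) (b := e - 1) (by omega) (by omega)
  linarith

theorem rightOK_of_le {j : ℕ} {y S : ℝ} (hj : j ≤ P.n) (hy : P.x j ≤ y) : P.RightOK j y S := by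
  intro v e hv hve he hx _
  have := P.x_le_x (a := e) (b := j) (by omega) hj
  linarith

/-- Along one edge, the time for the people from the left grows linearly with the sink. -/
theorem leftOK_iff_of_mem {i u : ℕ} {y S : ℝ} (hu : u < P.n) (h1 : P.x u < y)
    (h2 : y ≤ P.x (u + 1)) :
    P.LeftOK i y S ↔ P.LeftOK i (P.x (u + 1)) (S + (P.x (u + 1) - y) * P.τ) := by
  have hx : ∀ e, 1 ≤ e → e ≤ P.n → (P.x (e - 1) < y ↔ P.x (e - 1) < P.x (u + 1)) := by
    intro e he1 he
    refine ⟨fun h => h.trans_le h2, fun h => ?_⟩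
    rw [P.x_lt_x_iff (by omega) (by omega)] at h
    exact (P.x_le_x (by omega : e - 1 ≤ u) (by omega)).trans_lt h1
  constructor
  · intro h v e hv hve he hxe hW
    have := h v e hv hve he ((hx e (by omega) he).2 hxe) hW
    linarith
  · intro h v e hv hve he hxe hW
    have := h v e hv hve he ((hx e (by omega) he).1 hxe) hW
    linarith

/-- Along one edge, the time for the people from the right decreases linearly with the sink. -/
theorem rightOK_iff_of_mem {j u : ℕ} {y S : ℝ} (hj : j ≤ P.n) (hu : u < P.n) (h1 : P.x u ≤ y)
    (h2 : y < P.x (u + 1)) :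
    P.RightOK j y S ↔ P.RightOK j (P.x u) (S + (y - P.x u) * P.τ) := by
  have hx : ∀ e, e ≤ P.n → (y < P.x e ↔ P.x u < P.x e) := by
    intro e he
    refine ⟨fun h => h1.trans_lt h, fun h => ?_⟩
    rw [P.x_lt_x_iff (by omega) (by omega)] at h
    exact h2.trans_le (P.x_le_x (by omega : u + 1 ≤ e) (by omega))
  constructor
  · intro h v e hv hve he hxe hW
    have := h v e hv hve he ((hx e (by omega)).2 hxe) hW
    linarith
  · intro h v e hv hve he hxe hW
    have := h v e hv hve he ((hx e (by omega)).1 hxe) hW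
    linarith

variable (P)

/-- A point right of `x i` and not right of `x j` lies on an edge. -/
theorem exists_edge_left {i j : ℕ} {y : ℝ} (h1 : P.x i < y) (h2 : y ≤ P.x j) (hij : i ≤ j) :
    ∃ u, i ≤ u ∧ u < j ∧ P.x u < y ∧ y ≤ P.x (u + 1) := by
  induction j, hij using Nat.le_induction with
  | base => linarith
  | succ j hij ih =>
    rcases lt_or_ge (P.x j) y with h | h
    · exact ⟨j, hij, by omega, h, h2⟩
    · obtain ⟨u, hu⟩ := ih h
      exact ⟨u, hu.1, by omega, hu.2.2⟩

theorem exists_edge_right {i j : ℕ} {y : ℝ} (h1 : P.x i ≤ y) (h2 : y < P.x j) (hij : i ≤ j) :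
    ∃ u, i ≤ u ∧ u < j ∧ P.x u ≤ y ∧ y < P.x (u + 1) := by
  induction j, hij using Nat.le_induction with
  | base => linarith
  | succ j hij ih =>
    rcases le_or_gt (P.x j) y with h | h
    · exact ⟨j, hij, by omega, h, h2⟩
    · obtain ⟨u, hu⟩ := ih h
      exact ⟨u, hu.1, by omega, hu.2.2⟩

theorem people_eq_sum (i v : ℕ) :
    P.people i (i + v) = ∑ l ∈ Finset.range (v + 1), P.w (i + l) := by
  rw [people, ← Finset.Ico_add_one_right_eq_Icc, Finset.sum_Ico_eq_sum_range]
  congr 2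
  omega

theorem people_eq_sum_rev {j v : ℕ} (hv : v ≤ j) :
    P.people (j - v) j = ∑ l ∈ Finset.range (v + 1), P.w (j - l) := by
  rw [people, ← Finset.Ico_add_one_right_eq_Icc, Finset.range_eq_Ico,
    Finset.sum_Ico_reflect _ _ (by omega)]
  congr 2
  omega

theorem thetaL_le_iff {i j : ℕ} {y S : ℝ} (hij : i ≤ j) (hj : j ≤ P.n) (hy : y ≤ P.x j) :
    P.thetaL i j y ≤ S ↔ 0 ≤ S ∧ P.LeftOK i y S := by
  rcases le_or_gt y (P.x i) with hi | hi
  · have hm : ((Finset.Icc i j).filter fun v => P.x v < y).card = 0 := by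
      rw [Finset.card_eq_zero, Finset.filter_eq_empty_iff]
      intro v hv
      rw [Finset.mem_Icc] at hv
      have := P.x_le_x hv.1 (hv.2.trans hj)
      linarith
    rw [thetaL, hm]
    simp only [lineTime]
    exact ⟨fun h => ⟨h, leftOK_of_le hi⟩, fun h => h.1⟩
  · obtain ⟨u, hu1, hu2, hu3, hu4⟩ := P.exists_edge_left hi hy hij
    obtain ⟨m, rfl⟩ := Nat.exists_eq_add_of_le hu1
    have hxv : ∀ v, v ≤ P.n → (P.x v < y ↔ v ≤ i + m) := by
      intro v hv
      constructor
      · intro h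
        have := (P.x_lt_x_iff (by omega) (by omega)).1 (h.trans_le hu4)
        omega
      · exact fun h => (P.x_le_x h (by omega)).trans_lt hu3
    have hm : ((Finset.Icc i j).filter fun v => P.x v < y).card = m + 1 := by
      have : ((Finset.Icc i j).filter fun v => P.x v < y) = Finset.Icc i (i + m) := by
        ext v
        simp only [Finset.mem_filter, Finset.mem_Icc]
        constructor
        · rintro ⟨h1, h2⟩
          exact ⟨h1.1, (hxv v (by omega)).1 h2⟩
        · rintro ⟨h1, h2⟩
          exact ⟨⟨h1, by omega⟩, (hxv v (by omega)).2 h2⟩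
      rw [this, Nat.card_Icc]
      omega
    rw [thetaL, hm]
    simp only [Nat.add_sub_cancel]
    rw [lineTime_succ_le_iff]
    · refine and_congr_right fun hS => ?_
      constructor
      · intro h v e hv hve he hx hW
        obtain ⟨v, rfl⟩ := Nat.exists_eq_add_of_le hv
        obtain ⟨e, rfl⟩ := Nat.exists_eq_add_of_le (show i + 1 ≤ e by omega)
        have hem := (hxv _ (by omega)).1 hx
        rw [P.people_eq_sum] at hW ⊢
        have := h v e (by omega) (by omega) hW
        rw [P.sum_travel (by omega) (by omega)] at this
        rw [show i + 1 + e = i + e + 1 by ring]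
        linarith
      · intro h v e hv he hW
        have := h (i + v) (i + e + 1) (by omega) (by omega) (by omega)
          ((hxv _ (by omega)).2 (by omega)) (by rw [P.people_eq_sum]; exact hW)
        rw [P.people_eq_sum] at this
        rw [P.sum_travel (by omega) (by omega)]
        linarith
    · intro e he
      exact P.c_pos _ (by omega) (by omega)
    · exact mul_nonneg (by linarith) P.τ_pos.le

theorem thetaR_le_iff {i j : ℕ} {y S : ℝ} (hij : i ≤ j) (hj : j ≤ P.n) (hy : P.x i ≤ y) :
    P.thetaR i j y ≤ S ↔ 0 ≤ S ∧ P.RightOK j y S := by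
  rcases le_or_gt (P.x j) y with hi | hi
  · have hm : ((Finset.Icc i j).filter fun v => y < P.x v).card = 0 := by
      rw [Finset.card_eq_zero, Finset.filter_eq_empty_iff]
      intro v hv
      rw [Finset.mem_Icc] at hv
      have := P.x_le_x hv.2 hj
      linarith
    rw [thetaR, hm]
    simp only [lineTime]
    exact ⟨fun h => ⟨h, rightOK_of_le hj hi⟩, fun h => h.1⟩
  · obtain ⟨u, hu1, hu2, hu3, hu4⟩ := P.exists_edge_right hy hi hij
    obtain ⟨m, rfl⟩ := Nat.exists_eq_add_of_le (show u + 1 ≤ j by omega)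
    have hxv : ∀ v, v ≤ P.n → (y < P.x v ↔ u + 1 ≤ v) := by
      intro v hv
      constructor
      · intro h
        have := (P.x_lt_x_iff (by omega) (by omega)).1 (hu3.trans_lt h)
        omega
      · exact fun h => hu4.trans_le (P.x_le_x h (by omega))
    have hm : ((Finset.Icc i (u + 1 + m)).filter fun v => y < P.x v).card = m + 1 := by
      have : ((Finset.Icc i (u + 1 + m)).filter fun v => y < P.x v) =
          Finset.Icc (u + 1) (u + 1 + m) := by
        ext v
        simp only [Finset.mem_filter, Finset.mem_Icc]
        constructor
        · rintro ⟨h1, h2⟩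
          exact ⟨(hxv v (by omega)).1 h2, h1.2⟩
        · rintro ⟨h1, h2⟩
          exact ⟨⟨by omega, h2⟩, (hxv v (by omega)).2 h1⟩
      rw [this, Nat.card_Icc]
      omega
    rw [thetaR, hm]
    simp only [Nat.add_sub_cancel]
    rw [lineTime_succ_le_iff]
    · refine and_congr_right fun hS => ?_
      constructor
      · intro h v e he hve hv hx hW
        have hem := (hxv _ (by omega)).1 hx
        obtain ⟨v', rfl⟩ : ∃ v', v = u + 1 + m - v' := ⟨u + 1 + m - v, by omega⟩
        obtain ⟨e', rfl⟩ : ∃ e', e = u + 1 + m - e' := ⟨u + 1 + m - e, by omega⟩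
        rcases Nat.lt_or_ge (u + 1 + m) v' with hlt | hge
        · omega
        rw [P.people_eq_sum_rev hge] at hW ⊢
        rcases Nat.lt_or_ge m v' with hlt | hge
        · omega
        have := h v' e' (by omega) (by omega) hW
        rw [P.sum_travel_rev (by omega) (by omega) hj,
          show u + 1 + m - m = u + 1 by omega] at this
        linarith
      · intro h v e hv he hW
        have := h (u + 1 + m - v) (u + 1 + m - e) (by omega) (by omega) (by omega)
          ((hxv _ (by omega)).2 (by omega)) (by rw [P.people_eq_sum_rev (by omega)]; exact hW)
        rw [P.people_eq_sum_rev (by omega)] at this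
        rw [P.sum_travel_rev (by omega) (by omega) hj, show u + 1 + m - m = u + 1 by omega]
        linarith
    · intro e he
      exact P.c_pos _ (by omega) (by omega)
    · exact mul_nonneg (by linarith) P.τ_pos.le

theorem theta_le_iff {i j : ℕ} {y S : ℝ} (hij : i ≤ j) (hj : j ≤ P.n) (h1 : P.x i ≤ y)
    (h2 : y ≤ P.x j) :
    P.theta i j y ≤ S ↔ 0 ≤ S ∧ P.LeftOK i y S ∧ P.RightOK j y S := by
  rw [theta, max_le_iff, P.thetaL_le_iff hij hj h2, P.thetaR_le_iff hij hj h1]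
  tauto

end DynamicPath

/-- A property that gets lost at most once along an interval holds exactly up to some point. -/
theorem exists_threshold (p : ℕ → Prop) {lo mx : ℕ} (h : lo ≤ mx) (h0 : p lo)
    (hp : ∀ q q', lo ≤ q → q ≤ q' → q' ≤ mx → p q' → p q) :
    ∃ a, lo ≤ a ∧ a ≤ mx ∧ ∀ q, lo ≤ q → q ≤ mx → (p q ↔ q ≤ a) := by
  induction mx, h using Nat.le_induction with
  | base =>
    refine ⟨lo, le_rfl, le_rfl, fun q h1 h2 => ?_⟩
    obtain rfl : q = lo := by omega
    simp [h0]
  | succ mx h ih =>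
    by_cases hmx : p (mx + 1)
    · refine ⟨mx + 1, by omega, le_rfl, fun q h1 h2 => ?_⟩
      simp only [h2, iff_true]
      exact hp q (mx + 1) h1 h2 le_rfl hmx
    · obtain ⟨a, ha1, ha2, ha3⟩ := ih fun q q' h1 h2 h3 => hp q q' h1 h2 (by omega)
      refine ⟨a, ha1, by omega, fun q h1 h2 => ?_⟩
      rcases Nat.lt_or_ge mx q with hq | hq
      · obtain rfl : q = mx + 1 := by omega
        simp only [hmx, false_iff]
        omega
      · exact ha3 q h1 hq

namespace DynamicPath

variable (P : DynamicPath)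

/-! ### The optimal sink of one subpath -/

/-- Time for the people of `x i, …, x (u - 1)` to reach the vertex `x u`. -/
noncomputable def leftTime (i u : ℕ) : ℝ := P.thetaL i u (P.x u)

/-- Time for the people of `x (u + 1), …, x j` to reach the vertex `x u`. -/
noncomputable def rightTime (u j : ℕ) : ℝ := P.thetaR u j (P.x u)

/-- Travel time of the edge from `x u` to `x (u + 1)`, as a real number. -/
noncomputable def edgeTime (u : ℕ) : ℝ := (P.x (u + 1) - P.x u) * P.τ

/-- Some sink in the subpath `x i, …, x j` is reached by everybody of this subpath by time `T`
(for `T ≥ 0`). -/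
def Served (i j : ℕ) (T : ℝ) : Prop :=
  ∃ y, P.x i ≤ y ∧ y ≤ P.x j ∧ P.LeftOK i y T ∧ P.RightOK j y T

/-- Optimal evacuation time of the subpath `x i, …, x j` with one sink. -/
noncomputable def sinkTime (i j : ℕ) : ℝ := sInf {T | 0 ≤ T ∧ P.Served i j T}

theorem edgeTime_pos {u : ℕ} (hu : u < P.n) : 0 < P.edgeTime u :=
  mul_pos (sub_pos.2 (P.x_lt u hu)) P.τ_pos

variable {P}

theorem leftTime_le_iff {i u : ℕ} {S : ℝ} (hi : i ≤ u) (hu : u ≤ P.n) :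
    P.leftTime i u ≤ S ↔ 0 ≤ S ∧ P.LeftOK i (P.x u) S :=
  P.thetaL_le_iff hi hu le_rfl

theorem rightTime_le_iff {u j : ℕ} {S : ℝ} (hu : u ≤ j) (hj : j ≤ P.n) :
    P.rightTime u j ≤ S ↔ 0 ≤ S ∧ P.RightOK j (P.x u) S :=
  P.thetaR_le_iff hu hj le_rfl

theorem leftTime_nonneg {i u : ℕ} (hi : i ≤ u) (hu : u ≤ P.n) : 0 ≤ P.leftTime i u :=
  ((leftTime_le_iff hi hu).1 le_rfl).1

theorem rightTime_nonneg {u j : ℕ} (hu : u ≤ j) (hj : j ≤ P.n) : 0 ≤ P.rightTime u j :=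
  ((rightTime_le_iff hu hj).1 le_rfl).1

theorem leftTime_self {i : ℕ} (hi : i ≤ P.n) : P.leftTime i i = 0 :=
  le_antisymm ((leftTime_le_iff le_rfl hi).2 ⟨le_rfl, leftOK_of_le le_rfl⟩)
    (leftTime_nonneg le_rfl hi)

theorem rightTime_self {j : ℕ} (hj : j ≤ P.n) : P.rightTime j j = 0 :=
  le_antisymm ((rightTime_le_iff le_rfl hj).2 ⟨le_rfl, rightOK_of_le hj le_rfl⟩)
    (rightTime_nonneg le_rfl hj)

theorem leftTime_mono {i u u' : ℕ} (hi : i ≤ u) (hu : u ≤ u') (hu' : u' ≤ P.n) :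
    P.leftTime i u ≤ P.leftTime i u' := by
  have h := (leftTime_le_iff (hi.trans hu) hu').1 le_rfl
  exact (leftTime_le_iff hi (hu.trans hu')).2 ⟨h.1, h.2.mono le_rfl (P.x_le_x hu hu') le_rfl⟩

theorem rightTime_mono {u u' j j' : ℕ} (hu : u ≤ u') (hu' : u' ≤ j) (hj : j ≤ j') (hj' : j' ≤ P.n) :
    P.rightTime u' j ≤ P.rightTime u j' := by
  have h := (rightTime_le_iff (by omega) hj').1 (le_refl (P.rightTime u j'))
  exact (rightTime_le_iff hu' (by omega)).2
    ⟨h.1, h.2.mono hj (P.x_le_x hu (by omega)) le_rfl⟩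

/-- If anybody at all comes from the left, somebody has to travel along the last edge. -/
theorem edgeTime_le_leftTime {i u : ℕ} (hi : i ≤ u) (hu : u < P.n)
    (h : 0 < P.leftTime i (u + 1)) : P.edgeTime u ≤ P.leftTime i (u + 1) := by
  have hn : ¬ P.LeftOK i (P.x (u + 1)) 0 := fun h' =>
    absurd ((leftTime_le_iff (by omega) (by omega)).2 ⟨le_rfl, h'⟩) (not_le.2 h)
  simp only [LeftOK, not_forall] at hn
  obtain ⟨v, e, hv, hve, he, hx, hW, -⟩ := hn
  have hev := (P.x_lt_x_iff (by omega) (by omega)).1 hx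
  have hW' := P.people_le_people (le_refl i) (show v ≤ u by omega)
  have := ((leftTime_le_iff (by omega) (by omega)).1 (le_refl (P.leftTime i (u + 1)))).2
    u (u + 1) hi (by omega) (by omega) (P.x_lt u hu) (by omega)
  have h0 : (0 : ℝ) ≤ ((P.people i u - 1) / P.c (u + 1) : ℕ) := Nat.cast_nonneg _
  rw [edgeTime]
  linarith

/-- If the last vertex is the best vertex from the left, nobody needs any time. -/
theorem served_iff_of_last {i j : ℕ} (hij : i ≤ j) (hj : j ≤ P.n)
    (h : P.leftTime i j ≤ P.rightTime j j) (T : ℝ) : 0 ≤ T ↔ 0 ≤ T ∧ P.Served i j T := by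
  rw [rightTime_self hj] at h
  refine ⟨fun hT => ⟨hT, P.x j, P.x_le_x hij hj, le_rfl, ?_, rightOK_of_le hj le_rfl⟩, And.left⟩
  exact ((leftTime_le_iff hij hj).1 (h.trans hT)).2

/-- When the two times cross between `x u` and `x (u + 1)`, the best sink is one of these two
vertices or the point of the edge between them at which the two times are equal. -/
theorem served_iff_of_cross {i j u : ℕ} (hiu : i ≤ u) (huj : u < j) (hj : j ≤ P.n)
    (h1 : P.leftTime i u ≤ P.rightTime u j)
    (h2 : P.rightTime (u + 1) j < P.leftTime i (u + 1)) (T : ℝ) :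
    min (P.leftTime i (u + 1)) (min (P.rightTime u j)
      ((P.leftTime i (u + 1) + P.rightTime u j - P.edgeTime u) / 2)) ≤ T ↔
      0 ≤ T ∧ P.Served i j T := by
  have hlen := P.edgeTime_pos (show u < P.n by omega)
  have hb := rightTime_nonneg (P := P) huj.le hj
  have ha := edgeTime_le_leftTime hiu (show u < P.n by omega)
    ((rightTime_nonneg (by omega) hj).trans_lt h2)
  have hτ := P.τ_pos
  constructor
  · intro h
    have hA : P.leftTime i (u + 1) ≤ T → 0 ≤ T ∧ P.Served i j T := fun h =>
      ⟨by linarith, P.x (u + 1), P.x_le_x (by omega) (by omega), P.x_le_x (by omega) hj,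
        ((leftTime_le_iff (by omega) (by omega)).1 h).2,
        ((rightTime_le_iff (by omega) (by omega)).1 (h2.le.trans h)).2⟩
    have hB : P.rightTime u j ≤ T → 0 ≤ T ∧ P.Served i j T := fun h =>
      ⟨by linarith, P.x u, P.x_le_x (by omega) (by omega), P.x_le_x (by omega) hj,
        ((leftTime_le_iff (by omega) (by omega)).1 (h1.trans h)).2,
        ((rightTime_le_iff (by omega) (by omega)).1 h).2⟩
    rcases le_or_gt (P.leftTime i (u + 1)) T with h3 | h3
    · exact hA h3
    rcases le_or_gt (P.rightTime u j) T with h4 | h4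
    · exact hB h4
    have h5 : (P.leftTime i (u + 1) + P.rightTime u j - P.edgeTime u) / 2 ≤ T := by
      rcases min_le_iff.1 h with h | h
      · linarith
      · rcases min_le_iff.1 h with h | h
        · linarith
        · exact h
    -- the sink at which people from both sides arrive at the same time
    set z := (P.rightTime u j - P.leftTime i (u + 1) + P.edgeTime u) / 2 with hz
    have hz0 : 0 < z := by linarith
    have hz1 : z < P.edgeTime u := by linarith
    have hzτ : z / P.τ * P.τ = z := div_mul_cancel₀ _ hτ.ne'
    have hy0 : P.x u < P.x u + z / P.τ := by
      have := div_pos hz0 hτ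
      linarith
    have hy1 : P.x u + z / P.τ < P.x (u + 1) := by
      have : z / P.τ < P.x (u + 1) - P.x u := by
        rw [div_lt_iff₀ hτ]
        exact hz1
      linarith
    refine ⟨by linarith, P.x u + z / P.τ, (P.x_le_x hiu (by omega)).trans hy0.le,
      hy1.le.trans (P.x_le_x (by omega) hj), ?_, ?_⟩
    · rw [leftOK_iff_of_mem (by omega) hy0 hy1.le]
      have : T + (P.x (u + 1) - (P.x u + z / P.τ)) * P.τ = T + P.edgeTime u - z := by
        rw [edgeTime]
        linear_combination - hzτ
      rw [this]
      exact ((leftTime_le_iff (by omega) (by omega)).1 (by linarith)).2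
    · rw [rightOK_iff_of_mem hj (by omega) hy0.le hy1]
      have : T + (P.x u + z / P.τ - P.x u) * P.τ = T + z := by
        linear_combination hzτ
      rw [this]
      exact ((rightTime_le_iff (by omega) (by omega)).1 (by linarith)).2
  · rintro ⟨hT, y, hy1, hy2, hL, hR⟩
    rcases le_or_gt y (P.x u) with h3 | h3
    · exact (min_le_right _ _).trans ((min_le_left _ _).trans
        ((rightTime_le_iff huj.le hj).2 ⟨hT, hR.mono le_rfl h3 le_rfl⟩))
    rcases le_or_gt (P.x (u + 1)) y with h4 | h4
    · exact (min_le_left _ _).trans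
        ((leftTime_le_iff (by omega) (by omega)).2 ⟨hT, hL.mono le_rfl h4 le_rfl⟩)
    rw [leftOK_iff_of_mem (by omega) h3 h4.le] at hL
    rw [rightOK_iff_of_mem hj (by omega) h3.le h4] at hR
    have h5 := mul_nonneg (sub_nonneg.2 h4.le) hτ.le
    have h6 := mul_nonneg (sub_nonneg.2 h3.le) hτ.le
    have h7 := (leftTime_le_iff (show i ≤ u + 1 by omega) (by omega)).2
      ⟨add_nonneg hT h5, hL⟩
    have h8 := (rightTime_le_iff huj.le hj).2 ⟨add_nonneg hT h6, hR⟩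
    refine (min_le_right _ _).trans ((min_le_right _ _).trans ?_)
    have : P.edgeTime u = (P.x (u + 1) - y) * P.τ + (y - P.x u) * P.τ := by
      rw [edgeTime]
      ring
    linarith

theorem sinkTime_eq {i j : ℕ} {V : ℝ} (h : ∀ T, V ≤ T ↔ 0 ≤ T ∧ P.Served i j T) :
    P.sinkTime i j = V := by
  have : {T | 0 ≤ T ∧ P.Served i j T} = Set.Ici V := by
    ext T
    exact (h T).symm
  rw [sinkTime, this, csInf_Ici]

/-- The sink vertices for which the people from the left are not slower than the people from the
right form an initial part of the subpath. -/
theorem exists_cross {i j : ℕ} (hij : i ≤ j) (hj : j ≤ P.n) :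
    ∃ u, i ≤ u ∧ u ≤ j ∧
      ∀ q, i ≤ q → q ≤ j → (P.leftTime i q ≤ P.rightTime q j ↔ q ≤ u) := by
  apply exists_threshold _ hij
  · rw [leftTime_self (hij.trans hj)]
    exact rightTime_nonneg hij hj
  · intro q q' h1 h2 h3 h
    exact (leftTime_mono h1 h2 (h3.trans hj)).trans (h.trans (rightTime_mono h2 h3 le_rfl hj))

theorem sinkTime_le_iff {i j : ℕ} (hij : i ≤ j) (hj : j ≤ P.n) (T : ℝ) :
    P.sinkTime i j ≤ T ↔ 0 ≤ T ∧ P.Served i j T := by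
  obtain ⟨u, hu1, hu2, hu3⟩ := P.exists_cross hij hj
  rcases hu2.eq_or_lt with rfl | hlt
  · have h := P.served_iff_of_last hu1 hj ((hu3 _ hu1 le_rfl).2 le_rfl)
    rw [sinkTime_eq h]
    exact h T
  · have h := P.served_iff_of_cross hu1 hlt hj ((hu3 _ hu1 hu2).2 le_rfl)
      (not_le.1 fun h => absurd ((hu3 (u + 1) (by omega) (by omega)).1 h) (by omega))
    rw [sinkTime_eq h]
    exact h T

theorem sinkTime_nonneg {i j : ℕ} (hij : i ≤ j) (hj : j ≤ P.n) : 0 ≤ P.sinkTime i j :=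
  ((sinkTime_le_iff hij hj _).1 le_rfl).1

theorem Served.mono_time {i j : ℕ} {T T' : ℝ} (h : P.Served i j T) (hT : T ≤ T') :
    P.Served i j T' := by
  obtain ⟨y, h1, h2, h3, h4⟩ := h
  exact ⟨y, h1, h2, h3.mono le_rfl le_rfl hT, h4.mono le_rfl le_rfl hT⟩

theorem Served.mono_left {i i' j : ℕ} {T : ℝ} (h : P.Served i j T) (hi : i ≤ i') (hij : i' ≤ j)
    (hj : j ≤ P.n) : P.Served i' j T := by
  obtain ⟨y, h1, h2, h3, h4⟩ := h
  rcases le_total y (P.x i') with hy | hy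
  · exact ⟨P.x i', le_rfl, P.x_le_x hij hj, leftOK_of_le le_rfl, h4.mono le_rfl hy le_rfl⟩
  · exact ⟨y, hy, h2, h3.mono hi le_rfl le_rfl, h4⟩

theorem Served.mono_right {i j j' : ℕ} {T : ℝ} (h : P.Served i j T) (hij : i ≤ j') (hjj : j' ≤ j)
    (hj : j ≤ P.n) : P.Served i j' T := by
  obtain ⟨y, h1, h2, h3, h4⟩ := h
  rcases le_total y (P.x j') with hy | hy
  · exact ⟨y, h1, hy, h3, h4.mono hjj le_rfl le_rfl⟩
  · exact ⟨P.x j', P.x_le_x hij (by omega), le_rfl, h3.mono le_rfl hy le_rfl,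
      rightOK_of_le (by omega) le_rfl⟩

theorem served_self {i : ℕ} (hi : i ≤ P.n) (T : ℝ) : P.Served i i T :=
  ⟨P.x i, le_rfl, le_rfl, leftOK_of_le le_rfl, rightOK_of_le hi le_rfl⟩

theorem sinkTime_mono {i j j' : ℕ} (hij : i ≤ j) (hjj : j ≤ j') (hj : j' ≤ P.n) :
    P.sinkTime i j ≤ P.sinkTime i j' := by
  have h := (sinkTime_le_iff (hij.trans hjj) hj _).1 le_rfl
  exact (sinkTime_le_iff hij (hjj.trans hj) _).2 ⟨h.1, h.2.mono_right hij hjj hj⟩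

/-! ### The greedy choice of a sink -/

/-- The greedy step for the deadline `T`: the sink is put as far to the right as the people of
`x i, x (i + 1), …` permit, and then serves as many vertices on its right as possible. Here `U` is
the last vertex up to `jm` at which the sink can be, `z` is the time by which it can be moved beyond
this vertex, and `g` is the last vertex up to `jm` that can then be served; if this is `U` itself,
the sink has to stay at `x U`. -/
theorem greedy_step {i U g jm : ℕ} {T z Y : ℝ} (hiU : i ≤ U) (hUj : U ≤ jm) (hj : jm ≤ P.n)
    (hT : 0 ≤ T)
    (hU : ∀ u, i ≤ u → u ≤ jm → (P.leftTime i u ≤ T ↔ u ≤ U))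
    (hz : z = if U < jm then max 0 (P.edgeTime U - (P.leftTime i (U + 1) - T)) else 0)
    (hUg : U ≤ g) (hgj : g ≤ jm)
    (hg : ∀ j, U ≤ j → j ≤ jm → (P.rightTime U j ≤ T + z ↔ j ≤ g))
    (hY : Y = if g ≤ U then P.x U else P.x U + z / P.τ) :
    (P.x i ≤ Y ∧ Y ≤ P.x g ∧ P.LeftOK i Y T ∧ P.RightOK g Y T) ∧
      ∀ j, i ≤ j → j ≤ jm → P.Served i j T → j ≤ g := by
  have hτ := P.τ_pos
  have hLU := ((leftTime_le_iff hiU (hUj.trans hj)).1 ((hU U hiU hUj).2 le_rfl)).2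
  have hzτ : z / P.τ * P.τ = z := div_mul_cancel₀ _ hτ.ne'
  have hstay : g ≤ U → P.x i ≤ P.x U ∧ P.x U ≤ P.x g ∧ P.LeftOK i (P.x U) T ∧
      P.RightOK g (P.x U) T := by
    intro hgU
    obtain rfl : g = U := by omega
    exact ⟨P.x_le_x hiU (by omega), le_rfl, hLU, rightOK_of_le (by omega) le_rfl⟩
  rcases hUj.lt_or_eq with hlt | rfl
  · rw [if_pos hlt] at hz
    have ha : T < P.leftTime i (U + 1) := by
      by_contra h
      have := (hU (U + 1) (by omega) (by omega)).1 (not_lt.1 h)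
      omega
    have hz0 : 0 ≤ z := hz ▸ le_max_left _ _
    have hz1 : z < P.edgeTime U := by
      rw [hz, max_lt_iff]
      exact ⟨P.edgeTime_pos (by omega), by linarith⟩
    have hy0 : P.x U ≤ P.x U + z / P.τ := by
      have := div_nonneg hz0 hτ.le
      linarith
    have hy1 : P.x U + z / P.τ < P.x (U + 1) := by
      have : z / P.τ < P.x (U + 1) - P.x U := by
        rw [div_lt_iff₀ hτ]
        exact hz1
      linarith
    have hR : ∀ j, j ≤ P.n → U ≤ j →
        (P.RightOK j (P.x U + z / P.τ) T ↔ P.rightTime U j ≤ T + z) := by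
      intro j hj hUj
      rw [rightOK_iff_of_mem hj (by omega) hy0 hy1, rightTime_le_iff hUj hj]
      have : T + (P.x U + z / P.τ - P.x U) * P.τ = T + z := by
        linear_combination hzτ
      rw [this]
      exact ⟨fun h => ⟨by linarith, h⟩, And.right⟩
    constructor
    · rcases Nat.lt_or_ge U g with hUg' | hgU
      · rw [if_neg (by omega)] at hY
        rw [hY]
        refine ⟨(P.x_le_x hiU (by omega)).trans hy0, hy1.le.trans (P.x_le_x hUg' (by omega)), ?_,
          (hR g (by omega) hUg).2 ((hg g hUg hgj).2 le_rfl)⟩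
        rcases hz0.eq_or_lt with h0 | h0
        · rw [← h0, zero_div, add_zero]
          exact hLU
        · have hy0' : P.x U < P.x U + z / P.τ := by
            have := div_pos h0 hτ
            linarith
          rw [leftOK_iff_of_mem (by omega) hy0' hy1.le]
          refine ((leftTime_le_iff (by omega) (by omega)).1 ?_).2
          have h3 : z = P.edgeTime U - (P.leftTime i (U + 1) - T) := by
            rcases max_choice 0 (P.edgeTime U - (P.leftTime i (U + 1) - T)) with h | h
            · rw [h] at hz
              linarith
            · rw [hz, h]
          rw [edgeTime] at h3
          nlinarith
      · rw [if_pos hgU] at hY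
        rw [hY]
        exact hstay hgU
    · rintro j hij hjm ⟨y, hy2, hy3, hL, hRj⟩
      rcases Nat.lt_or_ge U j with hUj' | hjU
      · refine (hg j (by omega) hjm).1 ((hR j (by omega) (by omega)).1 ?_)
        refine hRj.mono le_rfl ?_ le_rfl
        by_contra hlt'
        rw [not_le] at hlt'
        have hm1 : P.x U + z / P.τ < min y (P.x (U + 1)) := lt_min hlt' hy1
        have hL' := hL.mono le_rfl (min_le_left y (P.x (U + 1))) le_rfl
        rw [leftOK_iff_of_mem (by omega) (hy0.trans_lt hm1) (min_le_right _ _)] at hL'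
        have h4 := (leftTime_le_iff (show i ≤ U + 1 by omega) (by omega)).2
          ⟨add_nonneg hT (mul_nonneg (sub_nonneg.2 (min_le_right _ _)) hτ.le), hL'⟩
        have h5 := mul_lt_mul_of_pos_right hm1 hτ
        have h6 : P.edgeTime U - (P.leftTime i (U + 1) - T) ≤ z := hz ▸ le_max_right _ _
        rw [edgeTime] at h6
        nlinarith
      · omega
  · obtain rfl : g = U := by omega
    rw [if_pos le_rfl] at hY
    rw [hY]
    exact ⟨hstay le_rfl, fun j _ h _ => h⟩

variable (P)

/-! ### Feasible deadlines -/

/-- The vertices `x i, x (i + 1), …, x n` can be split into `r` subpaths, each of which can be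
served by time `T` (for `T ≥ 0`). -/
def Feasible : ℕ → ℕ → ℝ → Prop
  | 0, i, _ => i = P.n + 1
  | r + 1, i, T => ∃ j, i ≤ j ∧ j + r ≤ P.n ∧ P.Served i j T ∧ Feasible r (j + 1) T

variable {P}

theorem Feasible.mono_time {r i : ℕ} {T T' : ℝ} (h : P.Feasible r i T) (hT : T ≤ T') :
    P.Feasible r i T' := by
  induction r generalizing i with
  | zero => exact h
  | succ r ih =>
    obtain ⟨j, h1, h2, h3, h4⟩ := h
    exact ⟨j, h1, h2, h3.mono_time hT, ih h4⟩

theorem Feasible.mono_start {r i i' : ℕ} {T : ℝ} (h : P.Feasible r i T) (hi : i ≤ i')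
    (hi' : i' + r ≤ P.n + 1) : P.Feasible r i' T := by
  induction r generalizing i i' with
  | zero =>
    have : i = P.n + 1 := h
    change i' = P.n + 1
    omega
  | succ r ih =>
    obtain ⟨j, h1, h2, h3, h4⟩ := h
    rcases Nat.lt_or_ge j i' with hj | hj
    · exact ⟨i', le_rfl, by omega, served_self (by omega) T, ih h4 (by omega) (by omega)⟩
    · exact ⟨j, hj, h2, h3.mono_left hi hj (by omega), h4⟩

/-- With as many sinks as vertices, every vertex is served by its own sink. -/
theorem feasible_of_add_eq {r i : ℕ} (h : i + r = P.n + 1) (T : ℝ) : P.Feasible r i T := by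
  induction r generalizing i with
  | zero => exact h
  | succ r ih => exact ⟨i, le_rfl, by omega, served_self (by omega) T, ih (by omega)⟩

/-- The first subpath may be chosen as long as possible. -/
theorem feasible_succ_iff {r i g : ℕ} {T : ℝ} (hig : i ≤ g) (hg : g + r ≤ P.n)
    (hs : P.Served i g T)
    (hmax : ∀ j, i ≤ j → j + r ≤ P.n → P.Served i j T → j ≤ g) :
    P.Feasible (r + 1) i T ↔ P.Feasible r (g + 1) T := by
  constructor
  · rintro ⟨j, h1, h2, h3, h4⟩
    exact h4.mono_start (by have := hmax j h1 h2 h3; omega) (by omega)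
  · exact fun h => ⟨g, hig, hg, hs, h⟩

/-- The search for the first subpath: `q` stands for the start of the second subpath, and it
is too early if the first subpath could be served faster than the rest. -/
theorem exists_split {r i : ℕ} (hi : i + r ≤ P.n) :
    ∃ a, i ≤ a ∧ a ≤ P.n - r ∧ ∀ q, i < q → q ≤ P.n - r →
      (¬ P.Feasible r q (P.sinkTime i (q - 1)) ↔ q ≤ a) := by
  obtain ⟨a, h1, h2, h3⟩ := exists_threshold
    (fun q => i < q → ¬ P.Feasible r q (P.sinkTime i (q - 1)))
    (show i ≤ P.n - r by omega) (fun h => absurd h (lt_irrefl _)) (by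
      intro q q' hq hqq hq' h hiq hF
      refine h (by omega) ?_
      exact (hF.mono_time (sinkTime_mono (show i ≤ q - 1 by omega) (show q - 1 ≤ q' - 1 by omega)
        (by omega))).mono_start hqq (by omega))
  refine ⟨a, h1, h2, fun q hq hq' => ?_⟩
  rw [← h3 q hq.le hq']
  simp [hq]

/-- Parametric search, one step: either the optimal first subpath ends at `x a` and is the
slowest one, or the deadline only depends on the subpaths from `x a` on. -/
theorem feasible_succ_iff_of_split {r i a : ℕ} (hi : i + r ≤ P.n) (ha1 : i ≤ a) (ha2 : a ≤ P.n - r)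
    (ha : ∀ q, i < q → q ≤ P.n - r →
      (¬ P.Feasible r q (P.sinkTime i (q - 1)) ↔ q ≤ a)) {T : ℝ} (hT : 0 ≤ T) :
    P.Feasible (r + 1) i T ↔ P.sinkTime i a ≤ T ∨ P.Feasible r a T := by
  have hFa : P.Feasible r (a + 1) (P.sinkTime i a) := by
    rcases ha2.eq_or_lt with h | h
    · exact feasible_of_add_eq (by omega) _
    · have := (ha (a + 1) (by omega) (by omega)).not.2 (by omega)
      simpa using this
  constructor
  · rintro ⟨j, h1, h2, h3, h4⟩
    rcases Nat.lt_or_ge j a with hj | hj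
    · exact Or.inr (h4.mono_start (by omega) (by omega))
    · left
      exact (sinkTime_mono ha1 hj (by omega)).trans
        ((sinkTime_le_iff h1 (by omega) T).2 ⟨hT, h3⟩)
  · rintro (h | h)
    · exact ⟨a, ha1, by omega, ((sinkTime_le_iff ha1 (by omega) T).1 h).2, hFa.mono_time h⟩
    · rcases ha1.eq_or_lt with rfl | hlt
      · have hs := served_self (P := P) (show i ≤ P.n by omega) T
        exact ⟨i, le_rfl, by omega, hs,
          hFa.mono_time ((sinkTime_le_iff le_rfl (by omega) T).2 ⟨hT, hs⟩)⟩
      · have hnot := (ha a hlt ha2).2 le_rfl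
        have hle : P.sinkTime i (a - 1) ≤ T := by
          by_contra hgt
          exact hnot (h.mono_time (not_le.1 hgt).le)
        refine ⟨a - 1, by omega, by omega,
          ((sinkTime_le_iff (by omega) (by omega) T).1 hle).2, ?_⟩
        rwa [show a - 1 + 1 = a by omega]

theorem feasible_of_sinkTime_le {r i : ℕ} {T : ℝ} (hi : i + r ≤ P.n)
    (h : P.sinkTime i (P.n - r) ≤ T) : P.Feasible (r + 1) i T :=
  ⟨P.n - r, by omega, by omega, ((sinkTime_le_iff (by omega) (by omega) T).1 h).2,
    feasible_of_add_eq (by omega) T⟩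

/-! ### Protocols -/

theorem protocolTime_le_iff {k : ℕ} (hk : 1 ≤ k) {I : Fin (k + 1) → ℕ} {Y : Fin k → ℝ} {T : ℝ} :
    P.protocolTime k I Y ≤ T ↔
      ∀ j : Fin k, P.theta (I j.castSucc) (I j.succ - 1) (Y j) ≤ T := by
  have : Nonempty (Fin k) := ⟨⟨0, hk⟩⟩
  exact ciSup_le_iff (Set.finite_range _).bddAbove

theorem IsProtocol.bounds {k : ℕ} {I : Fin (k + 1) → ℕ} {Y : Fin k → ℝ}
    (h : P.IsProtocol k I Y) (j : Fin k) :
    I j.castSucc < I j.succ ∧ I j.succ ≤ P.n + 1 :=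
  ⟨h.mono (Fin.castSucc_lt_succ), h.last ▸ h.mono.monotone (Fin.le_last _)⟩

theorem IsProtocol.add_le {k : ℕ} {I : Fin (k + 1) → ℕ} {Y : Fin k → ℝ}
    (h : P.IsProtocol k I Y) (m : ℕ) (hm : m ≤ k) :
    I ⟨k - m, by omega⟩ + m ≤ P.n + 1 := by
  induction m with
  | zero => exact h.last.le
  | succ m ih =>
    have h1 := ih (by omega)
    have h2 : I ⟨k - (m + 1), by omega⟩ < I ⟨k - m, by omega⟩ :=
      h.mono (by rw [Fin.mk_lt_mk]; omega)
    omega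

theorem IsProtocol.feasible {k : ℕ} (hk : 1 ≤ k) {I : Fin (k + 1) → ℕ} {Y : Fin k → ℝ} {T : ℝ}
    (h : P.IsProtocol k I Y) (hT : P.protocolTime k I Y ≤ T) : 0 ≤ T ∧ P.Feasible k 0 T := by
  rw [protocolTime_le_iff hk] at hT
  have hs : ∀ j : Fin k, 0 ≤ T ∧ P.Served (I j.castSucc) (I j.succ - 1) T := by
    intro j
    have h1 := h.bounds j
    have := (P.theta_le_iff (by omega) (by omega) (h.left_le j) (h.le_right j)).1 (hT j)
    exact ⟨this.1, Y j, h.left_le j, h.le_right j, this.2⟩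
  refine ⟨(hs ⟨0, hk⟩).1, ?_⟩
  have key : ∀ m (hm : m ≤ k), P.Feasible m (I ⟨k - m, by omega⟩) T := by
    intro m
    induction m with
    | zero => intro hm; exact h.last
    | succ m ih =>
      intro hm
      have h1 := h.bounds ⟨k - (m + 1), by omega⟩
      have h2 := (hs ⟨k - (m + 1), by omega⟩).2
      have h3 := h.add_le m (by omega)
      have h4 : Fin.succ ⟨k - (m + 1), by omega⟩ = (⟨k - m, by omega⟩ : Fin (k + 1)) := by
        ext
        simp only [Fin.val_succ]
        omega
      rw [h4] at h1 h2
      refine ⟨I ⟨k - m, by omega⟩ - 1, ?_, by omega, h2, ?_⟩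
      · have := h1.1
        simp only [Fin.castSucc_mk] at this
        omega
      · rw [Nat.sub_add_cancel (by omega)]
        exact ih (by omega)
  have := key k le_rfl
  have h0 : (⟨k - k, by omega⟩ : Fin (k + 1)) = 0 := by
    ext
    simp
  rwa [h0, h.first] at this

variable (P) in
/-- `A` and `Y` describe `m` consecutive subpaths, beginning at the vertex `x (A 0)`, with sinks that
are reached by everybody by time `T`. -/
def IsChain (m : ℕ) (A : ℕ → ℕ) (Y : ℕ → ℝ) (T : ℝ) : Prop :=
  ∀ l, l < m → A l < A (l + 1) ∧ P.x (A l) ≤ Y l ∧ Y l ≤ P.x (A (l + 1) - 1) ∧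
    P.LeftOK (A l) (Y l) T ∧ P.RightOK (A (l + 1) - 1) (Y l) T

theorem IsChain.isProtocol {k : ℕ} (hk : 1 ≤ k) {A : ℕ → ℕ} {Y : ℕ → ℝ} {T : ℝ} (hT : 0 ≤ T)
    (h : P.IsChain k A Y T) (h0 : A 0 = 0) (hl : A k = P.n + 1) :
    P.IsProtocol k (fun j => A j) (fun j => Y j) ∧
      P.protocolTime k (fun j => A j) (fun j => Y j) ≤ T := by
  have hp : P.IsProtocol k (fun j => A j) (fun j => Y j) := by
    refine ⟨h0, by simpa using hl, ?_, fun j => (h j j.2).2.1, fun j => ?_⟩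
    · rw [Fin.strictMono_iff_lt_succ]
      intro j
      simpa using (h j j.2).1
    · simpa using (h j j.2).2.2.1
  refine ⟨hp, ?_⟩
  rw [protocolTime_le_iff hk]
  intro j
  have h1 := hp.bounds j
  have h2 := h j j.2
  rw [P.theta_le_iff (by omega) (by omega) (hp.left_le j) (hp.le_right j)]
  exact ⟨hT, by simpa using h2.2.2.2⟩

/-- A protocol for the least feasible deadline is optimal. -/
theorem optTime_eq_of_isChain {k : ℕ} (hk : 1 ≤ k) {A : ℕ → ℕ} {Y : ℕ → ℝ} {T : ℝ} (hT : 0 ≤ T)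
    (hmin : ∀ S, 0 ≤ S → P.Feasible k 0 S → T ≤ S)
    (h : P.IsChain k A Y T) (h0 : A 0 = 0) (hl : A k = P.n + 1) :
    T = P.optTime k ∧ P.IsProtocol k (fun j => A j) (fun j => Y j) ∧
      P.protocolTime k (fun j => A j) (fun j => Y j) = P.optTime k := by
  obtain ⟨hp, hle⟩ := h.isProtocol hk hT h0 hl
  have hopt : ∀ I Y, P.IsProtocol k I Y → T ≤ P.protocolTime k I Y := by
    intro I Y hI
    have := hI.feasible hk le_rfl
    exact hmin _ this.1 this.2
  have heq : P.protocolTime k (fun j => A j) (fun j => Y j) = T := le_antisymm hle (hopt _ _ hp)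
  have hTo : T = P.optTime k := by
    apply le_antisymm
    · exact le_csInf ⟨_, _, _, hp, rfl⟩ (by
        rintro S ⟨I, Y, hI, rfl⟩
        exact hopt I Y hI)
    · exact csInf_le ⟨T, by
        rintro S ⟨I, Y, hI, rfl⟩
        exact hopt I Y hI⟩ ⟨_, _, hp, heq.symm⟩
  exact ⟨hTo, hp, heq.trans hTo⟩

end DynamicPath

/-! ### Reasoning about programs -/

/-- Started in memory `s`, the program `p` halts, and its final memory and its number of steps
satisfy `Q`; all words are at most `B`. -/
def WP (B : ℕ) (p : Prog) (Q : Store → ℕ → Prop) (s : Store) : Prop :=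
  ∃ t s', Exec B p s t s' ∧ Q s' t

section

variable {B : ℕ} {p q : Prog} {Q Q' : Store → ℕ → Prop} {s : Store}

theorem WP.mono (h : WP B p Q s) (hQ : ∀ s' t, Q s' t → Q' s' t) : WP B p Q' s := by
  obtain ⟨t, s', h1, h2⟩ := h
  exact ⟨t, s', h1, hQ _ _ h2⟩

theorem WP.skip (h : Q s 1) : WP B Prog.skip Q s := ⟨1, s, Exec.skip s, h⟩

theorem WP.setNat {r : ℕ} {e : NExp} (hf : e.Fits B s)
    (h : Q (s.setNat r (e.eval s)) (e.cost + 1)) : WP B (Prog.setNat r e) Q s :=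
  ⟨_, _, Exec.setNat s r e hf, h⟩

theorem WP.setReal {r : ℕ} {e : RExp} (hf : e.Fits B s)
    (h : Q (s.setReal r (e.eval s)) (e.cost + 1)) : WP B (Prog.setReal r e) Q s :=
  ⟨_, _, Exec.setReal s r e hf, h⟩

theorem WP.putNat {a : ℕ} {i e : NExp} (hi : i.Fits B s) (hf : e.Fits B s)
    (h : Q (s.putNat a (i.eval s) (e.eval s)) (i.cost + e.cost + 1)) :
    WP B (Prog.putNat a i e) Q s :=
  ⟨_, _, Exec.putNat s a i e hi hf, h⟩

theorem WP.putReal {a : ℕ} {i : NExp} {e : RExp} (hi : i.Fits B s) (hf : e.Fits B s)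
    (h : Q (s.putReal a (i.eval s) (e.eval s)) (i.cost + e.cost + 1)) :
    WP B (Prog.putReal a i e) Q s :=
  ⟨_, _, Exec.putReal s a i e hi hf, h⟩

theorem WP.seq (h : WP B p (fun s' t => WP B q (fun s'' t' => Q s'' (t + t')) s') s) :
    WP B (Prog.seq p q) Q s := by
  obtain ⟨t, s', h1, t', s'', h2, h3⟩ := h
  exact ⟨_, _, Exec.seq h1 h2, h3⟩

theorem WP.ite {b : Test} (hf : b.Fits B s)
    (ht : b.Holds s → WP B p (fun s' t => Q s' (b.cost + 1 + t)) s)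
    (he : ¬ b.Holds s → WP B q (fun s' t => Q s' (b.cost + 1 + t)) s) :
    WP B (Prog.ite b p q) Q s := by
  by_cases hb : b.Holds s
  · obtain ⟨t, s', h1, h2⟩ := ht hb
    exact ⟨_, _, Exec.ite_true hf hb h1, h2⟩
  · obtain ⟨t, s', h1, h2⟩ := he hb
    exact ⟨_, _, Exec.ite_false hf hb h1, h2⟩

/-- The rule for loops. The invariant carries a number `m` of steps which is enough for the rest of
the loop; every round consumes a part of it, so the loop terminates. -/
theorem WP.loop {b : Test} (Inv : ℕ → Store → Prop) (R : Store → Prop)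
    (hf : ∀ m s, Inv m s → b.Fits B s)
    (hbody : ∀ m s, Inv m s → b.Holds s →
      WP B p (fun s' t => ∃ m', Inv m' s' ∧ b.cost + 1 + t + m' ≤ m) s)
    (hend : ∀ m s, Inv m s → ¬ b.Holds s → R s ∧ b.cost + 1 ≤ m)
    (m : ℕ) (s : Store) (hI : Inv m s) :
    WP B (Prog.loop b p) (fun s' t => R s' ∧ t ≤ m) s := by
  induction m using Nat.strong_induction_on generalizing s with
  | _ m ih =>
    by_cases hb : b.Holds s
    · obtain ⟨t, s', h1, m', h2, h3⟩ := hbody m s hI hb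
      obtain ⟨t', s'', h4, h5, h6⟩ := ih m' (by omega) s' h2
      exact ⟨_, _, Exec.loop_true (hf m s hI) hb h1 h4, h5, by omega⟩
    · have := hend m s hI hb
      exact ⟨_, _, Exec.loop_false (hf m s hI) hb, this⟩

end

namespace Store

/-- The two memories agree except for the registers with numbers from `b` on. Registers are used like
a stack: the evacuation times to a vertex are computed in registers from `40` on, the programs for
one subpath and for the greedy protocol use registers from `20` on, and the parametric search the
registers below. So every program keeps the registers of the programs that call it. -/
structure Agree (b : ℕ) (s s' : Store) : Prop where
  natReg : ∀ r, r < b → s'.natReg r = s.natReg r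
  realReg : ∀ r, r < b → s'.realReg r = s.realReg r
  natArr : s'.natArr = s.natArr
  realArr : s'.realArr = s.realArr

/-- The two memories agree except for the registers with numbers from `b` on and for the arrays that
hold the protocol. -/
structure WeakAgree (b : ℕ) (s s' : Store) : Prop where
  natReg : ∀ r, r < b → s'.natReg r = s.natReg r
  realReg : ∀ r, r < b → s'.realReg r = s.realReg r
  natArr : ∀ a, a ≠ 2 → s'.natArr a = s.natArr a
  realArr : ∀ a, a ≠ 1 → s'.realArr a = s.realArr a

variable {b b' : ℕ} {s s' s'' : Store}

theorem Agree.refl (b : ℕ) (s : Store) : Agree b s s :=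
  ⟨fun _ _ => rfl, fun _ _ => rfl, rfl, rfl⟩

theorem Agree.trans (h : Agree b s s') (h' : Agree b s' s'') : Agree b s s'' :=
  ⟨fun r hr => (h'.natReg r hr).trans (h.natReg r hr),
    fun r hr => (h'.realReg r hr).trans (h.realReg r hr),
    h'.natArr.trans h.natArr, h'.realArr.trans h.realArr⟩

theorem Agree.of_le (h : Agree b' s s') (hb : b ≤ b') : Agree b s s' :=
  ⟨fun r hr => h.natReg r (by omega), fun r hr => h.realReg r (by omega), h.natArr, h.realArr⟩

theorem Agree.setNat (h : Agree b s s') {r : ℕ} (v : ℕ) (hr : b ≤ r) :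
    Agree b s (s'.setNat r v) := by
  refine ⟨fun r' hr' => ?_, h.realReg, h.natArr, h.realArr⟩
  rw [← h.natReg r' hr']
  exact Function.update_of_ne (by omega) _ _

theorem Agree.setReal (h : Agree b s s') {r : ℕ} (v : ℝ) (hr : b ≤ r) :
    Agree b s (s'.setReal r v) := by
  refine ⟨h.natReg, fun r' hr' => ?_, h.natArr, h.realArr⟩
  rw [← h.realReg r' hr']
  exact Function.update_of_ne (by omega) _ _

theorem Agree.weak (h : Agree b s s') : WeakAgree b s s' :=
  ⟨h.natReg, h.realReg, fun a _ => by rw [h.natArr], fun a _ => by rw [h.realArr]⟩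

theorem WeakAgree.refl (b : ℕ) (s : Store) : WeakAgree b s s := (Agree.refl b s).weak

theorem WeakAgree.trans (h : WeakAgree b s s') (h' : WeakAgree b s' s'') : WeakAgree b s s'' :=
  ⟨fun r hr => (h'.natReg r hr).trans (h.natReg r hr),
    fun r hr => (h'.realReg r hr).trans (h.realReg r hr),
    fun a ha => (h'.natArr a ha).trans (h.natArr a ha),
    fun a ha => (h'.realArr a ha).trans (h.realArr a ha)⟩

theorem WeakAgree.of_le (h : WeakAgree b' s s') (hb : b ≤ b') : WeakAgree b s s' :=
  ⟨fun r hr => h.natReg r (by omega), fun r hr => h.realReg r (by omega), h.natArr, h.realArr⟩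

theorem WeakAgree.setNat (h : WeakAgree b s s') {r : ℕ} (v : ℕ) (hr : b ≤ r) :
    WeakAgree b s (s'.setNat r v) :=
  h.trans ((Agree.refl b s').setNat v hr).weak

theorem WeakAgree.setReal (h : WeakAgree b s s') {r : ℕ} (v : ℝ) (hr : b ≤ r) :
    WeakAgree b s (s'.setReal r v) :=
  h.trans ((Agree.refl b s').setReal v hr).weak

theorem WeakAgree.putNat (h : WeakAgree b s s') (i v : ℕ) : WeakAgree b s (s'.putNat 2 i v) := by
  refine ⟨h.natReg, h.realReg, fun a ha => ?_, h.realArr⟩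
  rw [← h.natArr a ha]
  exact Function.update_of_ne ha _ _

theorem WeakAgree.putReal (h : WeakAgree b s s') (i : ℕ) (v : ℝ) :
    WeakAgree b s (s'.putReal 1 i v) := by
  refine ⟨h.natReg, h.realReg, h.natArr, fun a ha => ?_⟩
  rw [← h.realArr a ha]
  exact Function.update_of_ne ha _ _

@[simp] theorem setNat_natReg (s : Store) (r v r' : ℕ) :
    (s.setNat r v).natReg r' = if r' = r then v else s.natReg r' := by
  simp [setNat, Function.update_apply]

@[simp] theorem setNat_realReg (s : Store) (r v : ℕ) : (s.setNat r v).realReg = s.realReg := rfl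

@[simp] theorem setNat_natArr (s : Store) (r v : ℕ) : (s.setNat r v).natArr = s.natArr := rfl

@[simp] theorem setNat_realArr (s : Store) (r v : ℕ) : (s.setNat r v).realArr = s.realArr := rfl

@[simp] theorem setReal_realReg (s : Store) (r : ℕ) (v : ℝ) (r' : ℕ) :
    (s.setReal r v).realReg r' = if r' = r then v else s.realReg r' := by
  simp [setReal, Function.update_apply]

@[simp] theorem setReal_natReg (s : Store) (r : ℕ) (v : ℝ) : (s.setReal r v).natReg = s.natReg :=
  rfl

@[simp] theorem setReal_natArr (s : Store) (r : ℕ) (v : ℝ) : (s.setReal r v).natArr = s.natArr :=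
  rfl

@[simp] theorem setReal_realArr (s : Store) (r : ℕ) (v : ℝ) :
    (s.setReal r v).realArr = s.realArr := rfl

@[simp] theorem putNat_natArr (s : Store) (a i v a' i' : ℕ) :
    (s.putNat a i v).natArr a' i' = if a' = a ∧ i' = i then v else s.natArr a' i' := by
  by_cases h : a' = a
  · subst h
    simp [putNat, Function.update_apply]
  · simp [putNat, h]

@[simp] theorem putNat_natReg (s : Store) (a i v : ℕ) : (s.putNat a i v).natReg = s.natReg := rfl

@[simp] theorem putNat_realReg (s : Store) (a i v : ℕ) : (s.putNat a i v).realReg = s.realReg := rfl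

@[simp] theorem putNat_realArr (s : Store) (a i v : ℕ) : (s.putNat a i v).realArr = s.realArr := rfl

@[simp] theorem putReal_realArr (s : Store) (a i : ℕ) (v : ℝ) (a' i' : ℕ) :
    (s.putReal a i v).realArr a' i' = if a' = a ∧ i' = i then v else s.realArr a' i' := by
  by_cases h : a' = a
  · subst h
    simp [putReal, Function.update_apply]
  · simp [putReal, h]

@[simp] theorem putReal_natReg (s : Store) (a i : ℕ) (v : ℝ) :
    (s.putReal a i v).natReg = s.natReg := rfl

@[simp] theorem putReal_realReg (s : Store) (a i : ℕ) (v : ℝ) :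
    (s.putReal a i v).realReg = s.realReg := rfl

@[simp] theorem putReal_natArr (s : Store) (a i : ℕ) (v : ℝ) :
    (s.putReal a i v).natArr = s.natArr := rfl

end Store

attribute [simp] NExp.eval NExp.Fits NExp.cost RExp.eval RExp.Fits RExp.cost
  Test.Holds Test.Fits Test.cost

/-! ### Galloping search -/

/-- Probe of the search in the registers `a, …, a + 4`: register `a + 3` becomes `1` if the
candidate `q` in register `a + 2`, the sum of the registers `a` and `a + 1`, is at most the bound in
register `a + 4` and passes the test `ev`, and `0` otherwise. -/
def probe (a : ℕ) (ev : Prog) : Prog :=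
  .seq (.setNat (a + 2) (.add (.reg a) (.reg (a + 1))))
    (.ite (.natLe (.reg (a + 2)) (.reg (a + 4))) ev (.setNat (a + 3) (.lit 0)))

/-- Search for the last number that passes the test `ev`, in an interval that starts in register `a`
and ends in register `a + 4`, and whose beginning passes the test: the distance of the candidate
is doubled until the test fails, then the remaining interval is halved. The result is put into
register `a`. -/
def gallop (a : ℕ) (ev : Prog) : Prog :=
  .seq (.setNat (a + 1) (.lit 1)) <| .seq (.setNat (a + 3) (.lit 1)) <|
  .seq (.loop (.natLe (.lit 1) (.reg (a + 3)))
    (.seq (probe a ev) (.ite (.natLe (.lit 1) (.reg (a + 3)))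
      (.setNat (a + 1) (.add (.reg (a + 1)) (.reg (a + 1)))) .skip)))
  (.loop (.natLe (.lit 2) (.reg (a + 1)))
    (.seq (.setNat (a + 1) (.div (.reg (a + 1)) (.lit 2))) <|
    .seq (probe a ev) (.ite (.natLe (.lit 1) (.reg (a + 3)))
      (.setNat a (.reg (a + 2))) .skip)))

/-- The test `ev` of a search decides, within `K` steps, whether the candidate is at most `ans`. Of
the memory it keeps the registers of the search and the property `Inv`. It is only used for
candidates that are at most twice as far from the start `lo` as `ans` (and for `lo + 1`), which is
why a search costs no more than testing an interval of the length of the result repeatedly. -/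
def IsProbe (B a : ℕ) (ev : Prog) (Inv : Store → Prop) (lo mx ans K : ℕ) : Prop :=
  ∀ s, Inv s → s.natReg (a + 4) = mx → lo < s.natReg (a + 2) → s.natReg (a + 2) ≤ mx →
    s.natReg (a + 2) + lo ≤ 2 * ans + 1 →
    WP B ev (fun s' t => Inv s' ∧ s'.natReg a = s.natReg a ∧ s'.natReg (a + 1) = s.natReg (a + 1) ∧
      s'.natReg (a + 2) = s.natReg (a + 2) ∧ s'.natReg (a + 4) = mx ∧
      s'.natReg (a + 3) = (if s.natReg (a + 2) ≤ ans then 1 else 0) ∧ t ≤ K) s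

theorem probe_spec {a : ℕ} {ev : Prog} {Inv : Store → Prop} {lo mx ans K : ℕ}
    (hInv : ∀ s r v, a ≤ r → Inv s → Inv (s.setNat r v))
    (hev : IsProbe B a ev Inv lo mx ans K) (ha : ans ≤ mx) {s : Store} (hs : Inv s)
    (hmx : s.natReg (a + 4) = mx)
    (hlo : lo < s.natReg a + s.natReg (a + 1))
    (hhi : s.natReg a + s.natReg (a + 1) + lo ≤ 2 * ans + 1)
    (hB : 2 * ans + 1 ≤ B) (hmB : mx ≤ B) :
    WP B (probe a ev) (fun s' t => Inv s' ∧ s'.natReg a = s.natReg a ∧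
      s'.natReg (a + 1) = s.natReg (a + 1) ∧ s'.natReg (a + 2) = s.natReg a + s.natReg (a + 1) ∧
      s'.natReg (a + 4) = mx ∧
      s'.natReg (a + 3) = (if s.natReg a + s.natReg (a + 1) ≤ ans then 1 else 0) ∧
      t ≤ K + 10) s := by
  apply WP.seq
  apply WP.setNat
  · simp only [NExp.Fits, NExp.eval]
    omega
  apply WP.ite
  · simp [hmx]
    omega
  · intro hb
    simp [hmx] at hb
    have := hev (s.setNat (a + 2) (s.natReg a + s.natReg (a + 1))) (hInv _ _ _ (by omega) hs)
      (by simp [hmx]) (by simpa using hlo) (by simpa using hb) (by simpa using hhi)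
    refine this.mono fun s' t h => ?_
    simp at h ⊢
    refine ⟨h.1, h.2.1, h.2.2.1, h.2.2.2.1, h.2.2.2.2.1, h.2.2.2.2.2.1, ?_⟩
    omega
  · intro hb
    simp [hmx] at hb
    apply WP.setNat
    · simp
    simp only [NExp.eval, Store.setNat_natReg]
    simp [hmx]
    refine ⟨hInv _ _ _ (by omega) (hInv _ _ _ (by omega) hs), ?_⟩
    omega

theorem gallop_spec {a : ℕ} {ev : Prog} {Inv : Store → Prop} {lo mx ans K lam : ℕ}
    (hInv : ∀ s r v, a ≤ r → Inv s → Inv (s.setNat r v))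
    (hev : IsProbe B a ev Inv lo mx ans K) (hla : lo ≤ ans) (ha : ans ≤ mx)
    (hB : 2 * ans + 2 ≤ B) (hmB : mx ≤ B) (hlam : ans - lo < 2 ^ lam) {s : Store} (hs : Inv s)
    (hlo : s.natReg a = lo) (hmx : s.natReg (a + 4) = mx) :
    WP B (gallop a ev) (fun s' t => Inv s' ∧ s'.natReg a = ans ∧
      t ≤ (K + 30) * (2 * lam + 2)) s := by
  apply WP.seq
  apply WP.setNat
  · simp; omega
  apply WP.seq
  apply WP.setNat
  · simp; omega
  simp only [NExp.eval, NExp.cost]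
  apply WP.seq
  -- the doubling loop
  let Up : ℕ → Store → Prop := fun m s => Inv s ∧ s.natReg a = lo ∧ s.natReg (a + 4) = mx ∧
    ∃ e, s.natReg (a + 1) = 2 ^ e ∧ e ≤ lam ∧ lo + 2 ^ e ≤ 2 * ans + 1 - lo ∧
      ((s.natReg (a + 3) = 1 ∧ m = (K + 30) * (lam + 1 - e) + 5) ∨
        (s.natReg (a + 3) = 0 ∧ ans < lo + 2 ^ e ∧ m = 5))
  have hup := WP.loop (B := B) (b := .natLe (.lit 1) (.reg (a + 3)))
    (p := .seq (probe a ev) (.ite (.natLe (.lit 1) (.reg (a + 3)))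
      (.setNat (a + 1) (.add (.reg (a + 1)) (.reg (a + 1)))) .skip)) Up
    (fun s => Inv s ∧ s.natReg a = lo ∧ s.natReg (a + 4) = mx ∧
      ∃ e, s.natReg (a + 1) = 2 ^ e ∧ e ≤ lam ∧ lo + 2 ^ e ≤ 2 * ans + 1 - lo ∧ ans < lo + 2 ^ e)
    (by
      rintro m s ⟨-, -, -, e, -, -, -, h⟩
      simp
      omega)
    (by
      rintro m s ⟨h1, h2, h3, e, h4, h5, h6, h7⟩ hb
      simp at hb
      rcases h7 with ⟨h7, h8⟩ | ⟨h7, -⟩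
      swap
      · omega
      have hpos : 0 < 2 ^ e := by positivity
      apply WP.seq
      refine (probe_spec hInv hev ha h1 h3 (by omega) (by omega) (by omega) hmB).mono ?_
      rintro s' t ⟨g1, g2, g3, g4, g5, g6, g7⟩
      apply WP.ite
      · simp
        split_ifs at g6 <;> omega
      · intro hb'
        simp at hb'
        have hle : lo + 2 ^ e ≤ ans := by
          by_contra hc
          rw [h2, h4, if_neg hc] at g6
          omega
        have he : e < lam := by
          have : 2 ^ e < 2 ^ lam := by omega
          exact (Nat.pow_lt_pow_iff_right (by norm_num)).1 this
        apply WP.setNat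
        · simp only [NExp.Fits, NExp.eval]
          omega
        refine ⟨(K + 30) * (lam + 1 - (e + 1)) + 5, ⟨hInv _ _ _ (by omega) g1, ?_⟩, ?_⟩
        · refine ⟨by simp; omega, by simp; omega, e + 1, ?_, he, ?_, Or.inl ⟨?_, rfl⟩⟩
          · simp [pow_succ]
            omega
          · rw [pow_succ]
            omega
          · simp [g6, h2, h4, hle]
        · rw [h8, show lam + 1 - e = (lam + 1 - (e + 1)) + 1 by omega, mul_add (K + 30)]
          simp
          omega
      · intro hb'
        simp at hb'
        apply WP.skip
        refine ⟨5, ⟨g1, by omega, g5, e, by omega, h5, h6, Or.inr ⟨hb', ?_, rfl⟩⟩, ?_⟩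
        · by_contra hc
          rw [h2, h4, if_pos (by omega)] at g6
          omega
        · rw [h8, show lam + 1 - e = (lam - e) + 1 by omega, mul_add (K + 30)]
          simp
          omega)
    (by
      rintro m s ⟨h1, h2, h3, e, h4, h5, h6, h7⟩ hb
      simp at hb
      rcases h7 with ⟨h7, h8⟩ | ⟨h7, h8, h9⟩
      · omega
      · refine ⟨⟨h1, h2, h3, e, h4, h5, h6, h8⟩, ?_⟩
        simp
        omega)
    ((K + 30) * (lam + 1) + 5) ((s.setNat (a + 1) 1).setNat (a + 3) 1)
    (by
      refine ⟨hInv _ _ _ (by omega) (hInv _ _ _ (by omega) hs), by simp [hlo], by simp [hmx],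
        0, by simp, by omega, by simp; omega, Or.inl ⟨by simp, by simp⟩⟩)
  refine hup.mono ?_
  rintro s1 t1 ⟨⟨h1, h2, h3, e, h4, h5, h6, h7⟩, ht1⟩
  -- the halving loop
  let Down : ℕ → Store → Prop := fun m s => Inv s ∧ s.natReg (a + 4) = mx ∧
    ∃ e, s.natReg (a + 1) = 2 ^ e ∧ lo ≤ s.natReg a ∧ s.natReg a ≤ ans ∧
      ans < s.natReg a + 2 ^ e ∧ s.natReg a + 2 ^ e + lo ≤ 2 * ans + 1 ∧
      m = (K + 30) * e + 5
  have hdown := WP.loop (B := B) (b := .natLe (.lit 2) (.reg (a + 1)))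
    (p := .seq (.setNat (a + 1) (.div (.reg (a + 1)) (.lit 2))) <|
      .seq (probe a ev) (.ite (.natLe (.lit 1) (.reg (a + 3)))
      (.setNat a (.reg (a + 2))) .skip)) Down
    (fun s => Inv s ∧ s.natReg a = ans)
    (by
      rintro m s ⟨-, -, e, h4, h5, h6, h7, h8, -⟩
      simp
      omega)
    (by
      rintro m s ⟨h1, h2, e, h4, h5, h6, h7, h8, h9⟩ hb
      simp at hb
      obtain ⟨e, rfl⟩ : ∃ e', e = e' + 1 := by
        refine ⟨e - 1, ?_⟩
        rcases Nat.eq_zero_or_pos e with h0 | h0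
        · rw [h0] at h4
          omega
        · omega
      have hpos : 0 < 2 ^ e := by positivity
      rw [pow_succ] at h4 h7 h8
      apply WP.seq
      apply WP.setNat
      · simp
        omega
      apply WP.seq
      have hd : s.natReg (a + 1) / 2 = 2 ^ e := by omega
      refine (probe_spec hInv hev ha (hInv _ _ _ (by omega) h1) (by simp [h2])
        ?_ ?_ (by omega) hmB).mono ?_
      · simp
        omega
      · simp
        omega
      rintro s' t ⟨g1, g2, g3, g4, g5, g6, g7⟩
      simp [hd] at g2 g3 g4 g6
      apply WP.ite
      · simp
        split_ifs at g6 <;> omega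
      · intro hb'
        simp at hb'
        have hle : s.natReg a + 2 ^ e ≤ ans := by
          by_contra hc
          rw [if_neg hc] at g6
          omega
        apply WP.setNat
        · simp
          omega
        refine ⟨(K + 30) * e + 5, ⟨hInv _ _ _ le_rfl g1, by simp [g5], e, ?_⟩, ?_⟩
        · simp
          omega
        · rw [h9, mul_add (K + 30)]
          simp
          omega
      · intro hb'
        simp at hb'
        have hle : ¬ s.natReg a + 2 ^ e ≤ ans := by
          intro hc
          rw [if_pos hc] at g6
          omega
        apply WP.skip
        refine ⟨(K + 30) * e + 5, ⟨g1, g5, e, g3, ?_⟩, ?_⟩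
        · omega
        · rw [h9, mul_add (K + 30)]
          simp
          omega)
    (by
      rintro m s ⟨h1, h2, e, h4, h5, h6, h7, h8, h9⟩ hb
      simp at hb
      refine ⟨⟨h1, by omega⟩, ?_⟩
      simp
      omega)
    ((K + 30) * e + 5) s1 ⟨h1, h3, e, h4, by omega, by omega, by omega, by omega, rfl⟩
  refine hdown.mono ?_
  rintro s2 t2 ⟨⟨g1, g2⟩, ht2⟩
  refine ⟨g1, g2, ?_⟩
  have : (K + 30) * e ≤ (K + 30) * lam := Nat.mul_le_mul_left _ h5
  have h8 : (K + 30) * (2 * lam + 2) = (K + 30) * (lam + 1) + (K + 30) * lam + (K + 30) := by ring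
  omega

/-! ### Programs for the time to reach a vertex -/

theorem Store.setNat_self (s : Store) (r : ℕ) : s.setNat r (s.natReg r) = s := by
  simp [Store.setNat]

theorem Store.setReal_self (s : Store) (r : ℕ) : s.setReal r (s.realReg r) = s := by
  simp [Store.setReal]

/-- Replace a word register by its minimum with `e`. -/
def minNat (r : ℕ) (e : NExp) : Prog := .ite (.natLe (.reg r) e) .skip (.setNat r e)

/-- Replace a real register by its minimum with `e`. -/
def minReal (r : ℕ) (e : RExp) : Prog := .ite (.realLe (.reg r) e) .skip (.setReal r e)

/-- Replace a real register by its maximum with `e`. -/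
def maxReal (r : ℕ) (e : RExp) : Prog := .ite (.realLe e (.reg r)) .skip (.setReal r e)

section

variable {B : ℕ} {Q : Store → ℕ → Prop} {s : Store} {r : ℕ}

theorem WP.minNat {e : NExp} (hr : s.natReg r ≤ B) (hf : e.Fits B s)
    (h : ∀ t, t ≤ 2 * e.cost + 5 → Q (s.setNat r (min (s.natReg r) (e.eval s))) t) :
    WP B (minNat r e) Q s := by
  apply WP.ite
  · simp [hr, hf]
  · intro hb
    simp at hb
    apply WP.skip
    have := h (1 + e.cost + 1 + 1 + 1) (by omega)
    rw [min_eq_left hb, Store.setNat_self] at this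
    exact this
  · intro hb
    simp at hb
    apply WP.setNat hf
    have := h (1 + e.cost + 1 + 1 + (e.cost + 1)) (by omega)
    rw [min_eq_right hb.le] at this
    exact this

theorem WP.minReal {e : RExp} (hf : e.Fits B s)
    (h : ∀ t, t ≤ 2 * e.cost + 5 → Q (s.setReal r (min (s.realReg r) (e.eval s))) t) :
    WP B (minReal r e) Q s := by
  apply WP.ite
  · simp [hf]
  · intro hb
    simp at hb
    apply WP.skip
    have := h (1 + e.cost + 1 + 1 + 1) (by omega)
    rw [min_eq_left hb, Store.setReal_self] at this
    exact this
  · intro hb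
    simp at hb
    apply WP.setReal hf
    have := h (1 + e.cost + 1 + 1 + (e.cost + 1)) (by omega)
    rw [min_eq_right hb.le] at this
    exact this

theorem WP.maxReal {e : RExp} (hf : e.Fits B s)
    (h : ∀ t, t ≤ 2 * e.cost + 5 → Q (s.setReal r (max (s.realReg r) (e.eval s))) t) :
    WP B (maxReal r e) Q s := by
  apply WP.ite
  · simp [hf]
  · intro hb
    simp at hb
    apply WP.skip
    have := h (e.cost + 1 + 1 + 1 + 1) (by omega)
    rw [max_eq_left hb, Store.setReal_self] at this
    exact this
  · intro hb
    simp at hb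
    apply WP.setReal hf
    have := h (e.cost + 1 + 1 + 1 + (e.cost + 1)) (by omega)
    rw [max_eq_right hb.le] at this
    exact this

end

/-- The memory holds the data of `P`, with the prefix sums of the weights in word array `3`,
and words up to `B` are large enough for them. -/
structure DynamicPath.Env (P : DynamicPath) (B : ℕ) (s : Store) : Prop where
  size_le : 4 * P.n + 10 ≤ B
  sum_le : ∑ l ∈ Finset.range (P.n + 1), P.w l ≤ B
  n : s.natReg 0 = P.n
  τ : s.realReg 0 = P.τ
  x : ∀ i, i ≤ P.n → s.realArr 0 i = P.x i
  c : ∀ e, 1 ≤ e → e ≤ P.n → s.natArr 1 e = P.c e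
  c_le : ∀ e, s.natArr 1 e ≤ B
  sums : ∀ v, v ≤ P.n + 1 → s.natArr 3 v = ∑ l ∈ Finset.range v, P.w l

namespace DynamicPath

variable {P : DynamicPath} {B : ℕ}

theorem Env.of_weakAgree {b : ℕ} {s s' : Store} (h : P.Env B s) (h' : Store.WeakAgree b s s')
    (hb : 0 < b) : P.Env B s' where
  size_le := h.size_le
  sum_le := h.sum_le
  n := (h'.natReg 0 hb).trans h.n
  τ := (h'.realReg 0 hb).trans h.τ
  x i hi := by rw [h'.realArr 0 (by norm_num), h.x i hi]
  c e h1 h2 := by rw [h'.natArr 1 (by norm_num), h.c e h1 h2]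
  c_le e := by rw [h'.natArr 1 (by norm_num)]; exact h.c_le e
  sums v hv := by rw [h'.natArr 3 (by norm_num), h.sums v hv]

theorem Env.of_agree {b : ℕ} {s s' : Store} (h : P.Env B s) (h' : Store.Agree b s s')
    (hb : 0 < b) : P.Env B s' :=
  h.of_weakAgree h'.weak hb

theorem Env.sums_le {s : Store} (h : P.Env B s) {v : ℕ} (hv : v ≤ P.n + 1) :
    s.natArr 3 v ≤ B := by
  rw [h.sums v hv]
  exact (Finset.sum_le_sum_of_subset (Finset.range_mono hv)).trans h.sum_le

theorem Env.people_eq {s : Store} (h : P.Env B s) {a b : ℕ} (hab : a ≤ b + 1) (hb : b ≤ P.n) :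
    s.natArr 3 (b + 1) - s.natArr 3 a = P.people a b := by
  rw [h.sums _ (by omega), h.sums _ (by omega), people, ← Finset.sum_range_add_sum_Ico _ hab,
    Nat.add_sub_cancel_left]
  rfl

/-- A bound for all edges is a bound for the edge with the least capacity. -/
theorem add_div_le_iff {lo hi cm N : ℕ} {d S : ℝ} (hhi : hi ≤ P.n)
    (hmin : ∀ e, lo < e → e ≤ hi → cm ≤ P.c e) (hmem : ∃ e, lo < e ∧ e ≤ hi ∧ cm = P.c e) :
    (∀ e, lo < e → e ≤ hi → d + (N / P.c e : ℕ) ≤ S) ↔ d + (N / cm : ℕ) ≤ S := by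
  obtain ⟨e, he1, he2, rfl⟩ := hmem
  refine ⟨fun h => h e he1 he2, fun h e' h1 h2 => ?_⟩
  have : ((N / P.c e' : ℕ) : ℝ) ≤ (N / P.c e : ℕ) := by
    exact_mod_cast Nat.div_le_div_left (hmin e' h1 h2) (P.c_pos e (by omega) (by omega))
  linarith

variable (P) in
/-- The part of the condition `LeftOK i (x u) S` about the groups whose last vertex is at least
`v`. -/
def LeftFrom (i u v : ℕ) (S : ℝ) : Prop :=
  ∀ v' e, v ≤ v' → v' < e → e ≤ u → 0 < P.people i v' →
    (P.x u - P.x v') * P.τ + ((P.people i v' - 1) / P.c e : ℕ) ≤ S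

theorem leftFrom_start {i u : ℕ} {S : ℝ} (hu : u ≤ P.n) :
    P.LeftFrom i u i S ↔ P.LeftOK i (P.x u) S := by
  constructor
  · intro h v e hv hve he hx hW
    have := (P.x_lt_x_iff (by omega) hu).1 hx
    exact h v e hv hve (by omega) hW
  · intro h v e hv hve he hW
    exact h v e hv hve (by omega) (P.x_lt_x (by omega) hu) hW

theorem leftFrom_end {i u : ℕ} {S : ℝ} : P.LeftFrom i u u S := by
  intro v' e h1 h2 h3
  omega

theorem leftFrom_step {i u v cm : ℕ} {S : ℝ} (hu : u ≤ P.n)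
    (hmin : ∀ e, v < e → e ≤ u → cm ≤ P.c e) (hmem : ∃ e, v < e ∧ e ≤ u ∧ cm = P.c e) :
    P.LeftFrom i u v S ↔ P.LeftFrom i u (v + 1) S ∧ (0 < P.people i v →
      (P.x u - P.x v) * P.τ + ((P.people i v - 1) / cm : ℕ) ≤ S) := by
  constructor
  · intro h
    exact ⟨fun v' e h1 h2 h3 h4 => h v' e (by omega) h2 h3 h4, fun hW =>
      (add_div_le_iff hu hmin hmem).1 fun e h1 h2 => h v e le_rfl h1 h2 hW⟩
  · rintro ⟨h, h'⟩ v' e h1 h2 h3 h4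
    rcases h1.eq_or_lt with rfl | h1
    · exact (add_div_le_iff hu hmin hmem).2 (h' h4) e h2 h3
    · exact h v' e h1 h2 h3 h4

variable (P) in
/-- The part of the condition `RightOK j (x u) S` about the groups whose first vertex is at most
`v`. -/
def RightUpTo (u j v : ℕ) (S : ℝ) : Prop :=
  ∀ v' e, u < e → e ≤ v' → v' ≤ v → 0 < P.people v' j →
    (P.x v' - P.x u) * P.τ + ((P.people v' j - 1) / P.c e : ℕ) ≤ S

theorem rightUpTo_end {u j : ℕ} {S : ℝ} (hu : u ≤ j) (hj : j ≤ P.n) :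
    P.RightUpTo u j j S ↔ P.RightOK j (P.x u) S := by
  constructor
  · intro h v e he hve hv hx hW
    have := (P.x_lt_x_iff (by omega) (by omega)).1 hx
    exact h v e this hve (by omega) hW
  · intro h v e he hve hv hW
    exact h v e (by omega) hve (by omega) (P.x_lt_x (by omega) (by omega)) hW

theorem rightUpTo_start {u j : ℕ} {S : ℝ} : P.RightUpTo u j u S := by
  intro v' e h1 h2 h3
  omega

theorem rightUpTo_step {u j v cm : ℕ} {S : ℝ} (hv : v + 1 ≤ P.n)
    (hmin : ∀ e, u < e → e ≤ v + 1 → cm ≤ P.c e) (hmem : ∃ e, u < e ∧ e ≤ v + 1 ∧ cm = P.c e) :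
    P.RightUpTo u j (v + 1) S ↔ P.RightUpTo u j v S ∧ (0 < P.people (v + 1) j →
      (P.x (v + 1) - P.x u) * P.τ + ((P.people (v + 1) j - 1) / cm : ℕ) ≤ S) := by
  constructor
  · intro h
    exact ⟨fun v' e h1 h2 h3 h4 => h v' e h1 h2 (by omega) h4, fun hW =>
      (add_div_le_iff hv hmin hmem).1 fun e h1 h2 => h (v + 1) e h1 h2 le_rfl hW⟩
  · rintro ⟨h, h'⟩ v' e h1 h2 h3 h4
    rcases h3.eq_or_lt with rfl | h3
    · exact (add_div_le_iff hv hmin hmem).2 (h' h4) e h1 h2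
    · exact h v' e h1 h2 (by omega) h4

end DynamicPath

/-- For `i` and `u` in the word registers `40` and `41`, compute `leftTime i u` in real register
`40`. Register `42` runs through the vertices, from right to left, register `43` holds the least
capacity on the way to `x u`, and register `44` the number of people of `x i, …, x v`. -/
def leftProg : Prog :=
  .seq (.setNat 42 (.reg 41)) <|
  -- for `u = 0` this reads an entry that is no capacity, but then the loop is not entered
  .seq (.setNat 43 (.get 1 (.reg 41))) <|
  .seq (.setReal 40 (.ofNat (.lit 0))) <|
  .loop (.not (.natLe (.reg 42) (.reg 40))) <|
    .seq (minNat 43 (.get 1 (.reg 42))) <|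
    .seq (.setNat 42 (.sub (.reg 42) (.lit 1))) <|
    .seq (.setNat 44 (.sub (.get 3 (.add (.reg 42) (.lit 1))) (.get 3 (.reg 40)))) <|
    .ite (.natLe (.lit 1) (.reg 44))
      (maxReal 40 (.add (.mul (.sub (.get 0 (.reg 41)) (.get 0 (.reg 42))) (.reg 0))
        (.ofNat (.div (.sub (.reg 44) (.lit 1)) (.reg 43)))))
      .skip

/-- For `u` and `j` in the word registers `40` and `41`, compute `rightTime u j` in real register
`40`. Register `42` runs through the vertices, from left to right, register `43` holds the least
capacity on the way from `x u`, and register `44` the number of people of `x v, …, x j`. -/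
def rightProg : Prog :=
  .seq (.setNat 42 (.reg 40)) <|
  -- for `u = n` this reads an entry that is no capacity, but then the loop is not entered
  .seq (.setNat 43 (.get 1 (.add (.reg 40) (.lit 1)))) <|
  .seq (.setReal 40 (.ofNat (.lit 0))) <|
  .loop (.not (.natLe (.reg 41) (.reg 42))) <|
    .seq (.setNat 42 (.add (.reg 42) (.lit 1))) <|
    .seq (minNat 43 (.get 1 (.reg 42))) <|
    .seq (.setNat 44 (.sub (.get 3 (.add (.reg 41) (.lit 1))) (.get 3 (.reg 42)))) <|
    .ite (.natLe (.lit 1) (.reg 44))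
      (maxReal 40 (.add (.mul (.sub (.get 0 (.reg 42)) (.get 0 (.reg 40))) (.reg 0))
        (.ofNat (.div (.sub (.reg 44) (.lit 1)) (.reg 43)))))
      .skip

open DynamicPath

theorem leftProg_spec {P : DynamicPath} {B i u : ℕ} {s : Store} (hE : P.Env B s)
    (hi : s.natReg 40 = i) (hu : s.natReg 41 = u) (hiu : i ≤ u) (hun : u ≤ P.n) :
    WP B leftProg (fun s' t => Store.Agree 40 s s' ∧ s'.realReg 40 = P.leftTime i u ∧
      t ≤ 100 * (u - i) + 20) s := by
  have hB := hE.size_le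
  apply WP.seq
  apply WP.setNat
  · simp [hu]; omega
  apply WP.seq
  apply WP.setNat
  · simp [hu, hE.c_le]; omega
  apply WP.seq
  apply WP.setReal
  · simp
  let Inv : ℕ → Store → Prop := fun m s' => Store.Agree 40 s s' ∧ s'.natReg 40 = i ∧
    s'.natReg 41 = u ∧ ∃ v, s'.natReg 42 = v ∧ i ≤ v ∧ v ≤ u ∧
      (∀ e, v < e → e ≤ u → s'.natReg 43 ≤ s'.natArr 1 e) ∧
      (∃ e, v ≤ e ∧ e ≤ u ∧ s'.natReg 43 = s'.natArr 1 e) ∧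
      (∀ S, s'.realReg 40 ≤ S ↔ 0 ≤ S ∧ P.LeftFrom i u v S) ∧ m = 100 * (v - i) + 5
  refine (WP.loop Inv (fun s' => Store.Agree 40 s s' ∧ s'.realReg 40 = P.leftTime i u)
    ?_ ?_ ?_ (100 * (u - i) + 5) _ ?_).mono ?_
  · rintro m s' ⟨-, h1, h2, v, h3, h4, h5, -⟩
    simp
    omega
  · rintro m s' ⟨hA, h1, h2, v, h3, h4, h5, h6, ⟨e0, h7, h7', h7''⟩, h8, h9⟩ hb
    simp at hb
    have hE' := hE.of_agree hA (by norm_num)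
    obtain ⟨v, rfl⟩ : ∃ v', v = v' + 1 := ⟨v - 1, by omega⟩
    apply WP.seq
    apply WP.minNat
    · rw [h7'']
      exact hE'.c_le _
    · simp [hE'.c_le]
      omega
    intro t1 ht1
    apply WP.seq
    apply WP.setNat
    · simp
      omega
    apply WP.seq
    apply WP.setNat
    · have := hE'.sums_le (show v + 1 ≤ P.n + 1 by omega)
      have := hE'.sums_le (show i ≤ P.n + 1 by omega)
      simp [*]
      omega
    have hpe := hE'.people_eq (show i ≤ v + 1 by omega) (show v ≤ P.n by omega)
    have hmin : ∀ e, v < e → e ≤ u → min (s'.natReg 43) (s'.natArr 1 (v + 1)) ≤ s'.natArr 1 e := by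
      intro e he1 he2
      rcases Nat.lt_or_ge (v + 1) e with h | h
      · exact (min_le_left _ _).trans (h6 e h he2)
      · obtain rfl : e = v + 1 := by omega
        exact min_le_right _ _
    have hmem : ∃ e, v < e ∧ e ≤ u ∧ min (s'.natReg 43) (s'.natArr 1 (v + 1)) = s'.natArr 1 e := by
      rcases min_choice (s'.natReg 43) (s'.natArr 1 (v + 1)) with h | h
      · exact ⟨e0, by omega, h7', by rw [h, h7'']⟩
      · exact ⟨v + 1, by omega, by omega, h⟩
    have hcm : min (s'.natReg 43) (s'.natArr 1 (v + 1)) ≤ B := (min_le_right _ _).trans (hE'.c_le _)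
    have hstep := fun S => leftFrom_step (P := P) (i := i) (u := u) (v := v) (S := S)
      (cm := min (s'.natReg 43) (s'.natArr 1 (v + 1))) hun
      (fun e he1 he2 => by rw [← hE'.c e (by omega) (by omega)]; exact hmin e he1 he2)
      (by
        obtain ⟨e, he1, he2, he3⟩ := hmem
        exact ⟨e, he1, he2, by rw [he3, hE'.c e (by omega) (by omega)]⟩)
    have hW : s'.natArr 3 (v + 1) - s'.natArr 3 i ≤ B :=
      (Nat.sub_le _ _).trans (hE'.sums_le (by omega))
    apply WP.ite
    · simp [h1, h3] at hW ⊢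
      omega
    · intro hb'
      simp [h1, h3, hpe] at hb'
      apply WP.maxReal
      · simp only [RExp.Fits, NExp.Fits, NExp.eval]
        simp [h1, h2, h3] at hW ⊢
        omega
      intro t2 ht2
      simp at ht1 ht2
      refine ⟨100 * (v - i) + 5, ⟨?_, by simp [h1], by simp [h2], v, by simp [h3], by omega,
        by omega, ?_, ?_, ?_, rfl⟩, ?_⟩
      · exact (((hA.setNat _ (by norm_num)).setNat _ (by norm_num)).setNat _
          (by norm_num)).setReal _ (by norm_num)
      · simp [h3] at hmin ⊢
        exact hmin
      · obtain ⟨e, he1, he2, he3⟩ := hmem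
        refine ⟨e, he1.le, he2, ?_⟩
        simp [h3, he3]
      · intro S
        simp [h1, h2, h3, hpe, h8, hstep, hE'.x u hun, hE'.x v (by omega), hE'.τ, and_assoc]
        intro _ _
        exact Or.inl hb'
      · simp
        omega
    · intro hb'
      simp [h1, h3, hpe] at hb'
      apply WP.skip
      simp at ht1
      refine ⟨100 * (v - i) + 5, ⟨?_, by simp [h1], by simp [h2], v, by simp [h3], by omega,
        by omega, ?_, ?_, ?_, rfl⟩, ?_⟩
      · exact ((hA.setNat _ (by norm_num)).setNat _ (by norm_num)).setNat _ (by norm_num)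
      · simp [h3] at hmin ⊢
        exact hmin
      · obtain ⟨e, he1, he2, he3⟩ := hmem
        refine ⟨e, he1.le, he2, ?_⟩
        simp [h3, he3]
      · intro S
        simp [h8, hstep, hb']
      · simp
        omega
  · rintro m s' ⟨hA, h1, h2, v, h3, h4, h5, -, -, h8, h9⟩ hb
    simp at hb
    obtain rfl : v = i := by omega
    refine ⟨⟨hA, eq_of_forall_ge_iff fun S => ?_⟩, ?_⟩
    · rw [h8, leftFrom_start hun, leftTime_le_iff hiu hun]
    · simp
      omega
  · refine ⟨?_, by simp [hi], by simp [hu], u, by simp [hu], hiu, le_rfl, ?_, ?_, ?_, rfl⟩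
    · exact (((Store.Agree.refl _ _).setNat _ (by norm_num)).setNat _ (by norm_num)).setReal _
        (by norm_num)
    · intro e _ _
      omega
    · exact ⟨u, le_rfl, le_rfl, by simp [hu]⟩
    · intro S
      simp [leftFrom_end]
  · rintro s' t ⟨⟨h1, h2⟩, h3⟩
    refine ⟨h1, h2, ?_⟩
    simp
    omega

theorem rightProg_spec {P : DynamicPath} {B u j : ℕ} {s : Store} (hE : P.Env B s)
    (hu : s.natReg 40 = u) (hj : s.natReg 41 = j) (huj : u ≤ j) (hjn : j ≤ P.n) :
    WP B rightProg (fun s' t => Store.Agree 40 s s' ∧ s'.realReg 40 = P.rightTime u j ∧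
      t ≤ 100 * (j - u) + 20) s := by
  have hB := hE.size_le
  apply WP.seq
  apply WP.setNat
  · simp [hu]; omega
  apply WP.seq
  apply WP.setNat
  · simp [hu, hE.c_le]; omega
  apply WP.seq
  apply WP.setReal
  · simp
  let Inv : ℕ → Store → Prop := fun m s' => Store.Agree 40 s s' ∧ s'.natReg 40 = u ∧
    s'.natReg 41 = j ∧ ∃ v, s'.natReg 42 = v ∧ u ≤ v ∧ v ≤ j ∧
      (∀ e, u < e → e ≤ v → s'.natReg 43 ≤ s'.natArr 1 e) ∧
      (∃ e, u < e ∧ e ≤ v + 1 ∧ s'.natReg 43 = s'.natArr 1 e) ∧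
      (∀ S, s'.realReg 40 ≤ S ↔ 0 ≤ S ∧ P.RightUpTo u j v S) ∧ m = 100 * (j - v) + 5
  refine (WP.loop Inv (fun s' => Store.Agree 40 s s' ∧ s'.realReg 40 = P.rightTime u j)
    ?_ ?_ ?_ (100 * (j - u) + 5) _ ?_).mono ?_
  · rintro m s' ⟨-, h1, h2, v, h3, h4, h5, -⟩
    simp
    omega
  · rintro m s' ⟨hA, h1, h2, v, h3, h4, h5, h6, ⟨e0, h7, h7', h7''⟩, h8, h9⟩ hb
    simp at hb
    have hE' := hE.of_agree hA (by norm_num)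
    apply WP.seq
    apply WP.setNat
    · simp
      omega
    apply WP.seq
    apply WP.minNat
    · simp [h7'', hE'.c_le]
    · simp [hE'.c_le]
      omega
    intro t1 ht1
    apply WP.seq
    apply WP.setNat
    · have := hE'.sums_le (show j + 1 ≤ P.n + 1 by omega)
      have := hE'.sums_le (show v + 1 ≤ P.n + 1 by omega)
      simp [*]
      omega
    have hpe := hE'.people_eq (show v + 1 ≤ j + 1 by omega) hjn
    have hmin : ∀ e, u < e → e ≤ v + 1 →
        min (s'.natReg 43) (s'.natArr 1 (v + 1)) ≤ s'.natArr 1 e := by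
      intro e he1 he2
      rcases Nat.lt_or_ge v e with h | h
      · obtain rfl : e = v + 1 := by omega
        exact min_le_right _ _
      · exact (min_le_left _ _).trans (h6 e he1 h)
    have hmem : ∃ e, u < e ∧ e ≤ v + 1 ∧
        min (s'.natReg 43) (s'.natArr 1 (v + 1)) = s'.natArr 1 e := by
      rcases min_choice (s'.natReg 43) (s'.natArr 1 (v + 1)) with h | h
      · exact ⟨e0, h7, h7', by rw [h, h7'']⟩
      · exact ⟨v + 1, by omega, by omega, h⟩
    have hcm : min (s'.natReg 43) (s'.natArr 1 (v + 1)) ≤ B := (min_le_right _ _).trans (hE'.c_le _)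
    have hstep := fun S => rightUpTo_step (P := P) (u := u) (j := j) (v := v) (S := S)
      (cm := min (s'.natReg 43) (s'.natArr 1 (v + 1))) (by omega)
      (fun e he1 he2 => by rw [← hE'.c e (by omega) (by omega)]; exact hmin e he1 he2)
      (by
        obtain ⟨e, he1, he2, he3⟩ := hmem
        exact ⟨e, he1, he2, by rw [he3, hE'.c e (by omega) (by omega)]⟩)
    have hW : s'.natArr 3 (j + 1) - s'.natArr 3 (v + 1) ≤ B :=
      (Nat.sub_le _ _).trans (hE'.sums_le (by omega))
    apply WP.ite
    · simp [h2, h3] at hW ⊢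
      omega
    · intro hb'
      simp [h2, h3, hpe] at hb'
      apply WP.maxReal
      · simp only [RExp.Fits, NExp.Fits, NExp.eval]
        simp [h1, h2, h3] at hW ⊢
        omega
      intro t2 ht2
      simp at ht1 ht2
      refine ⟨100 * (j - (v + 1)) + 5, ⟨?_, by simp [h1], by simp [h2], v + 1, by simp [h3],
        by omega, by omega, ?_, ?_, ?_, rfl⟩, ?_⟩
      · exact (((hA.setNat _ (by norm_num)).setNat _ (by norm_num)).setNat _
          (by norm_num)).setReal _ (by norm_num)
      · simp [h3] at hmin ⊢
        exact hmin
      · obtain ⟨e, he1, he2, he3⟩ := hmem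
        refine ⟨e, he1, by omega, ?_⟩
        simp [h3, he3]
      · intro S
        simp [h1, h2, h3, hpe, h8, hstep, hE'.x u (by omega), hE'.x (v + 1) (by omega), hE'.τ,
          and_assoc]
        intro _ _
        exact Or.inl hb'
      · simp
        omega
    · intro hb'
      simp [h2, h3, hpe] at hb'
      apply WP.skip
      simp at ht1
      refine ⟨100 * (j - (v + 1)) + 5, ⟨?_, by simp [h1], by simp [h2], v + 1, by simp [h3],
        by omega, by omega, ?_, ?_, ?_, rfl⟩, ?_⟩
      · exact ((hA.setNat _ (by norm_num)).setNat _ (by norm_num)).setNat _ (by norm_num)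
      · simp [h3] at hmin ⊢
        exact hmin
      · obtain ⟨e, he1, he2, he3⟩ := hmem
        refine ⟨e, he1, by omega, ?_⟩
        simp [h3, he3]
      · intro S
        simp [h8, hstep, hb']
      · simp
        omega
  · rintro m s' ⟨hA, h1, h2, v, h3, h4, h5, -, -, h8, h9⟩ hb
    simp at hb
    obtain rfl : v = j := by omega
    refine ⟨⟨hA, eq_of_forall_ge_iff fun S => ?_⟩, ?_⟩
    · rw [h8, rightUpTo_end huj hjn, rightTime_le_iff huj hjn]
    · simp
      omega
  · refine ⟨?_, by simp [hu], by simp [hj], u, by simp [hu], le_rfl, huj, ?_, ?_, ?_, rfl⟩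
    · exact (((Store.Agree.refl _ _).setNat _ (by norm_num)).setNat _ (by norm_num)).setReal _
        (by norm_num)
    · intro e _ _
      omega
    · exact ⟨u + 1, by omega, le_rfl, by simp [hu]⟩
    · intro S
      simp [rightUpTo_start]
  · rintro s' t ⟨⟨h1, h2⟩, h3⟩
    refine ⟨h1, h2, ?_⟩
    simp
    omega

/-! ### Program for the optimal sink of one subpath -/

/-- Test of the search for the crossing point of `leftTime` and `rightTime`. -/
def crossTest : Prog :=
  .seq (.setNat 40 (.reg 20)) <| .seq (.setNat 41 (.reg 32)) <| .seq leftProg <|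
  .seq (.setReal 30 (.reg 40)) <|
  .seq (.setNat 40 (.reg 32)) <| .seq (.setNat 41 (.reg 21)) <| .seq rightProg <|
  .ite (.realLe (.reg 30) (.reg 40)) (.setNat 33 (.lit 1)) (.setNat 33 (.lit 0))

/-- For `i` and `j` in the word registers `20` and `21`, compute `sinkTime i j` in real
register `20`. -/
def sinkProg : Prog :=
  .seq (.setNat 30 (.reg 20)) <| .seq (.setNat 34 (.reg 21)) <| .seq (gallop 30 crossTest) <|
  .ite (.natLe (.reg 21) (.reg 30)) (.setReal 20 (.ofNat (.lit 0))) <|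
    .seq (.setNat 40 (.reg 20)) <| .seq (.setNat 41 (.add (.reg 30) (.lit 1))) <| .seq leftProg <|
    .seq (.setReal 21 (.reg 40)) <|
    .seq (.setNat 40 (.reg 30)) <| .seq (.setNat 41 (.reg 21)) <| .seq rightProg <|
    .seq (.setReal 20 (.div (.sub (.add (.reg 21) (.reg 40))
      (.mul (.sub (.get 0 (.add (.reg 30) (.lit 1))) (.get 0 (.reg 30))) (.reg 0)))
      (.ofNat (.lit 2)))) <|
    .seq (minReal 20 (.reg 40)) (minReal 20 (.reg 21))

theorem crossTest_isProbe {P : DynamicPath} {B i j u : ℕ} {s : Store} (hE : P.Env B s)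
    (hi : s.natReg 20 = i) (hj : s.natReg 21 = j) (hjn : j ≤ P.n)
    (hu : ∀ q, i ≤ q → q ≤ j → (P.leftTime i q ≤ P.rightTime q j ↔ q ≤ u)) :
    IsProbe B 30 crossTest (Store.Agree 30 s) i j u (200 * (j - i) + 70) := by
  intro s1 hA hmx hlo hhi _
  have hB := hE.size_le
  have hE1 := hE.of_agree hA (by norm_num)
  have h20 : s1.natReg 20 = i := (hA.natReg 20 (by norm_num)).trans hi
  have h21 : s1.natReg 21 = j := (hA.natReg 21 (by norm_num)).trans hj
  obtain ⟨q, hq⟩ : ∃ q, s1.natReg 32 = q := ⟨_, rfl⟩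
  norm_num at hlo hhi hmx
  rw [hq] at hlo hhi
  apply WP.seq
  apply WP.setNat
  · simp [h20]
    omega
  apply WP.seq
  apply WP.setNat
  · simp [hq]
    omega
  simp [h20, hq]
  apply WP.seq
  refine (leftProg_spec (P := P) (i := i) (u := q) (hE1.of_agree (((Store.Agree.refl 40 s1).setNat _
    (by norm_num)).setNat _ (by norm_num)) (by norm_num)) (by simp) (by simp) hlo.le
    (by omega)).mono ?_
  rintro s2 t2 ⟨hA2, hr2, ht2⟩
  have hA2' : Store.Agree 40 s1 s2 :=
    ((((Store.Agree.refl 40 s1).setNat _ (by norm_num)).setNat _ (by norm_num))).trans hA2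
  have h32 : s2.natReg 32 = q := (hA2'.natReg 32 (by norm_num)).trans hq
  have h21' : s2.natReg 21 = j := (hA2'.natReg 21 (by norm_num)).trans h21
  apply WP.seq
  apply WP.setReal
  · simp
  apply WP.seq
  apply WP.setNat
  · simp [h32]
    omega
  apply WP.seq
  apply WP.setNat
  · simp [h21']
    omega
  simp [h32, h21', hr2]
  apply WP.seq
  have hA3 : Store.Agree 30 s2 (((s2.setReal 30 (P.leftTime i q)).setNat 40 q).setNat 41 j) :=
    (((Store.Agree.refl 30 s2).setReal _ (by norm_num)).setNat _ (by norm_num)).setNat _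
      (by norm_num)
  refine (rightProg_spec (P := P) (u := q) (j := j) (((hE1.of_agree hA2' (by norm_num))).of_agree
    hA3 (by norm_num)) (by simp) (by simp) hhi hjn).mono ?_
  rintro s4 t4 ⟨hA4, hr4, ht4⟩
  have h30 : s4.realReg 30 = P.leftTime i q := (hA4.realReg 30 (by norm_num)).trans (by simp)
  have hA' : Store.Agree 30 s1 s4 := ((hA2'.of_le (by norm_num)).trans hA3).trans
    (hA4.of_le (by norm_num))
  have hn : ∀ r, r < 40 → s4.natReg r = s1.natReg r := by
    intro r hr
    rw [hA4.natReg r hr]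
    simp
    rw [if_neg (by omega), if_neg (by omega), hA2'.natReg r hr]
  have hq' := hu q hlo.le hhi
  apply WP.ite
  · simp
  · intro hb
    simp [h30, hr4] at hb
    apply WP.setNat
    · simp
      omega
    refine ⟨(hA.trans hA').setNat _ (by norm_num), ?_⟩
    simp [hn, hmx, hq, hq'.1 hb]
    omega
  · intro hb
    simp [h30, hr4] at hb
    apply WP.setNat
    · simp
    refine ⟨(hA.trans hA').setNat _ (by norm_num), ?_⟩
    have : ¬ q ≤ u := fun h => absurd (hq'.2 h) (not_le.2 hb)
    simp [hn, hmx, hq, this]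
    omega

theorem sinkProg_spec {P : DynamicPath} {B i j lam : ℕ} {s : Store} (hE : P.Env B s)
    (hi : s.natReg 20 = i) (hj : s.natReg 21 = j) (hij : i ≤ j) (hjn : j ≤ P.n)
    (hlam : P.n < 2 ^ lam) :
    WP B sinkProg (fun s' t => Store.Agree 20 s s' ∧ s'.realReg 20 = P.sinkTime i j ∧
      t ≤ (300 * (j - i) + 200) * (2 * lam + 2)) s := by
  have hB := hE.size_le
  obtain ⟨u, hu1, hu2, hu3⟩ := P.exists_cross hij hjn
  apply WP.seq
  apply WP.setNat
  · simp [hi]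
    omega
  apply WP.seq
  apply WP.setNat
  · simp [hj]
    omega
  simp [hi, hj]
  apply WP.seq
  have hA1 : Store.Agree 30 s ((s.setNat 30 i).setNat 34 j) :=
    ((Store.Agree.refl 30 s).setNat _ (by norm_num)).setNat _ (by norm_num)
  refine (gallop_spec (a := 30) (Inv := Store.Agree 30 s) (fun s' r v hr h => h.setNat v hr)
    (crossTest_isProbe hE hi hj hjn hu3) hu1 hu2 (by omega) (by omega)
    (show u - i < 2 ^ lam by omega) hA1 (by simp) (by simp)).mono ?_
  rintro s2 t2 ⟨hA2, h30, ht2⟩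
  have hE2 := hE.of_agree hA2 (by norm_num)
  have h20 : s2.natReg 20 = i := (hA2.natReg 20 (by norm_num)).trans hi
  have h21 : s2.natReg 21 = j := (hA2.natReg 21 (by norm_num)).trans hj
  have hcost : (300 * (j - i) + 200) * (2 * lam + 2) =
      (200 * (j - i) + 70 + 30) * (2 * lam + 2) + 100 * ((j - i) * (2 * lam + 2)) +
        100 * (2 * lam + 2) := by ring
  have hprod : 2 * (j - i) ≤ (j - i) * (2 * lam + 2) := by nlinarith
  apply WP.ite
  · simp [h21, h30]
    omega
  · intro hb
    simp [h21, h30] at hb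
    obtain rfl : u = j := by omega
    apply WP.setReal
    · simp
    refine ⟨(hA2.of_le (by norm_num)).setReal _ (by norm_num), ?_, ?_⟩
    · rw [sinkTime_eq (served_iff_of_last hij hjn ((hu3 u hij le_rfl).2 le_rfl))]
      simp
    · simp
      omega
  · intro hb
    simp [h21, h30] at hb
    apply WP.seq
    apply WP.setNat
    · simp [h20]
      omega
    apply WP.seq
    apply WP.setNat
    · simp [h30]
      omega
    simp [h20, h30]
    apply WP.seq
    have hA3 : Store.Agree 40 s2 ((s2.setNat 40 i).setNat 41 (u + 1)) :=
      ((Store.Agree.refl 40 s2).setNat _ (by norm_num)).setNat _ (by norm_num)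
    refine (leftProg_spec (P := P) (i := i) (u := u + 1) (hE2.of_agree hA3 (by norm_num)) (by simp)
      (by simp) (by omega) (by omega)).mono ?_
    rintro s4 t4 ⟨hA4, hr4, ht4⟩
    have hA5 := hA3.trans hA4
    have h30' : s4.natReg 30 = u := (hA5.natReg 30 (by norm_num)).trans h30
    have h21' : s4.natReg 21 = j := (hA5.natReg 21 (by norm_num)).trans h21
    apply WP.seq
    apply WP.setReal
    · simp
    apply WP.seq
    apply WP.setNat
    · simp [h30']
      omega
    apply WP.seq
    apply WP.setNat
    · simp [h21']
      omega
    simp [h30', h21', hr4]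
    apply WP.seq
    have hA6 : Store.Agree 20 s4
        (((s4.setReal 21 (P.leftTime i (u + 1))).setNat 40 u).setNat 41 j) :=
      (((Store.Agree.refl 20 s4).setReal _ (by norm_num)).setNat _ (by norm_num)).setNat _
        (by norm_num)
    refine (rightProg_spec (P := P) (u := u) (j := j)
      ((hE2.of_agree hA5 (by norm_num)).of_agree hA6 (by norm_num)) (by simp) (by simp) hu2
      hjn).mono ?_
    rintro s7 t7 ⟨hA7, hr7, ht7⟩
    have hA8 : Store.Agree 20 s s7 := (((hA2.of_le (by norm_num)).trans
      (hA5.of_le (by norm_num))).trans hA6).trans (hA7.of_le (by norm_num))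
    have hE7 := hE.of_agree hA8 (by norm_num)
    have hr21 : s7.realReg 21 = P.leftTime i (u + 1) := (hA7.realReg 21 (by norm_num)).trans
      (by simp)
    have h30'' : s7.natReg 30 = u := (hA7.natReg 30 (by norm_num)).trans (by simp [h30'])
    apply WP.seq
    apply WP.setReal
    · simp [h30'']
      omega
    apply WP.seq
    apply WP.minReal
    · simp
    intro t8 ht8
    apply WP.minReal
    · simp
    intro t9 ht9
    simp at ht8 ht9
    refine ⟨((hA8.setReal _ (by norm_num)).setReal _ (by norm_num)).setReal _ (by norm_num), ?_, ?_⟩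
    · rw [sinkTime_eq (served_iff_of_cross hu1 hb hjn ((hu3 u hu1 hu2).2 le_rfl)
        (not_le.1 fun h => absurd ((hu3 (u + 1) (by omega) (by omega)).1 h) (by omega)))]
      simp [hr21, hr7, h30'', hE7.x u (by omega), hE7.x (u + 1) (by omega), hE7.τ, edgeTime]
      rw [min_comm, min_comm (P.rightTime u j)]
    · simp
      omega

/-! ### Program for the greedy protocol -/

/-- Test of the search for the last vertex that the people from the left reach in time. -/
def leftTest : Prog :=
  .seq (.setNat 40 (.reg 20)) <| .seq (.setNat 41 (.reg 32)) <| .seq leftProg <|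
  .ite (.realLe (.reg 40) (.reg 21)) (.setNat 33 (.lit 1)) (.setNat 33 (.lit 0))

/-- Test of the search for the last vertex from which the people reach the sink in time. -/
def rightTest : Prog :=
  .seq (.setNat 40 (.reg 24)) <| .seq (.setNat 41 (.reg 32)) <| .seq rightProg <|
  .ite (.realLe (.reg 40) (.reg 24)) (.setNat 33 (.lit 1)) (.setNat 33 (.lit 0))

/-- The choice of the sink in the greedy step, for the subpath that starts at the vertex in word register `20`
and is the first of as many subpaths as word register `21` says, for the deadline in real
register `21`: the last possible vertex for the sink goes to word register `24`, the time by which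
the sink can be moved beyond it to real register `23`. -/
def placeSink : Prog :=
  .seq (.setNat 23 (.sub (.add (.reg 0) (.lit 1)) (.reg 21))) <|
  .seq (.setNat 30 (.reg 20)) <| .seq (.setNat 34 (.reg 23)) <| .seq (gallop 30 leftTest) <|
  .seq (.setNat 24 (.reg 30)) <| .seq (.setReal 23 (.ofNat (.lit 0))) <|
  .ite (.natLe (.reg 23) (.reg 24)) .skip <|
    .seq (.setNat 40 (.reg 20)) <| .seq (.setNat 41 (.add (.reg 24) (.lit 1))) <| .seq leftProg <|
    maxReal 23 (.sub (.mul (.sub (.get 0 (.add (.reg 24) (.lit 1))) (.get 0 (.reg 24))) (.reg 0))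
      (.sub (.reg 40) (.reg 21)))

/-- The choice of the last vertex of the subpath in the greedy step; it goes to word register
`30`. -/
def extendRight : Prog :=
  .seq (.setReal 24 (.add (.reg 21) (.reg 23))) <|
  .seq (.setNat 30 (.reg 24)) <| .seq (.setNat 34 (.reg 23)) <| gallop 30 rightTest

/-- The sink chosen by the greedy step and the end of the subpath become entries of the
protocol, at the place given by word register `22`. -/
def storeSink : Prog :=
  .seq (.ite (.natLe (.reg 30) (.reg 24)) (.putReal 1 (.reg 22) (.get 0 (.reg 24)))
    (.putReal 1 (.reg 22) (.add (.get 0 (.reg 24)) (.div (.reg 23) (.reg 0))))) <|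
  .seq (.putNat 2 (.add (.reg 22) (.lit 1)) (.add (.reg 30) (.lit 1))) <|
  .seq (.setNat 22 (.add (.reg 22) (.lit 1))) <|
  .seq (.setNat 20 (.add (.reg 30) (.lit 1))) (.setNat 21 (.sub (.reg 21) (.lit 1)))

/-- Starting from the vertex in word register `20`, cut off as many subpaths as word register `21`
says greedily, for the deadline in real register `21`. Word register `20` finally holds the first
vertex that is left. -/
def greedyProg : Prog :=
  .seq (.setNat 22 (.lit 0)) <| .seq (.putNat 2 (.lit 0) (.reg 20)) <|
  .loop (.natLe (.lit 1) (.reg 21)) <| .seq placeSink <| .seq extendRight storeSink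

theorem leftTest_isProbe {P : DynamicPath} {B i jm U : ℕ} {T : ℝ} {s : Store} (hE : P.Env B s)
    (hi : s.natReg 20 = i) (hT : s.realReg 21 = T) (hjn : jm ≤ P.n)
    (hU : ∀ u, i ≤ u → u ≤ jm → (P.leftTime i u ≤ T ↔ u ≤ U)) :
    IsProbe B 30 leftTest (Store.Agree 30 s) i jm U (200 * (U - i) + 150) := by
  intro s1 hA hmx hlo hhi hq2
  have hB := hE.size_le
  have hE1 := hE.of_agree hA (by norm_num)
  have h20 : s1.natReg 20 = i := (hA.natReg 20 (by norm_num)).trans hi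
  obtain ⟨q, hq⟩ : ∃ q, s1.natReg 32 = q := ⟨_, rfl⟩
  norm_num at hlo hhi hmx hq2
  rw [hq] at hlo hhi hq2
  apply WP.seq
  apply WP.setNat
  · simp [h20]
    omega
  apply WP.seq
  apply WP.setNat
  · simp [hq]
    omega
  simp [h20, hq]
  apply WP.seq
  have hA1 : Store.Agree 40 s1 ((s1.setNat 40 i).setNat 41 q) :=
    ((Store.Agree.refl 40 s1).setNat _ (by norm_num)).setNat _ (by norm_num)
  refine (leftProg_spec (P := P) (i := i) (u := q) (hE1.of_agree hA1 (by norm_num)) (by simp)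
    (by simp) hlo.le (by omega)).mono ?_
  rintro s2 t2 ⟨hA2, hr2, ht2⟩
  have hA2' := hA1.trans hA2
  have hA' := hA.trans (hA2'.of_le (show 30 ≤ 40 by norm_num))
  have h21 : s2.realReg 21 = T := (hA'.realReg 21 (by norm_num)).trans hT
  have hn : ∀ r, r < 40 → s2.natReg r = s1.natReg r := fun r hr => hA2'.natReg r hr
  have hq' := hU q hlo.le hhi
  apply WP.ite
  · simp
  · intro hb
    simp [h21, hr2] at hb
    apply WP.setNat
    · simp
      omega
    refine ⟨hA'.setNat _ (by norm_num), ?_⟩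
    simp [hn, hmx, hq, hq'.1 hb]
    omega
  · intro hb
    simp [h21, hr2] at hb
    apply WP.setNat
    · simp
    refine ⟨hA'.setNat _ (by norm_num), ?_⟩
    have : ¬ q ≤ U := fun h => absurd (hq'.2 h) (not_le.2 hb)
    simp [hn, hmx, hq, this]
    omega

theorem rightTest_isProbe {P : DynamicPath} {B U jm g : ℕ} {T : ℝ} {s : Store} (hE : P.Env B s)
    (hU : s.natReg 24 = U) (hT : s.realReg 24 = T) (hjn : jm ≤ P.n)
    (hg : ∀ j, U ≤ j → j ≤ jm → (P.rightTime U j ≤ T ↔ j ≤ g)) :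
    IsProbe B 30 rightTest (Store.Agree 30 s) U jm g (200 * (g - U) + 150) := by
  intro s1 hA hmx hlo hhi hq2
  have hB := hE.size_le
  have hE1 := hE.of_agree hA (by norm_num)
  have h24 : s1.natReg 24 = U := (hA.natReg 24 (by norm_num)).trans hU
  obtain ⟨q, hq⟩ : ∃ q, s1.natReg 32 = q := ⟨_, rfl⟩
  norm_num at hlo hhi hmx hq2
  rw [hq] at hlo hhi hq2
  apply WP.seq
  apply WP.setNat
  · simp [h24]
    omega
  apply WP.seq
  apply WP.setNat
  · simp [hq]
    omega
  simp [h24, hq]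
  apply WP.seq
  have hA1 : Store.Agree 40 s1 ((s1.setNat 40 U).setNat 41 q) :=
    ((Store.Agree.refl 40 s1).setNat _ (by norm_num)).setNat _ (by norm_num)
  refine (rightProg_spec (P := P) (u := U) (j := q) (hE1.of_agree hA1 (by norm_num)) (by simp)
    (by simp) hlo.le (by omega)).mono ?_
  rintro s2 t2 ⟨hA2, hr2, ht2⟩
  have hA2' := hA1.trans hA2
  have hA' := hA.trans (hA2'.of_le (show 30 ≤ 40 by norm_num))
  have h24' : s2.realReg 24 = T := (hA'.realReg 24 (by norm_num)).trans hT
  have hn : ∀ r, r < 40 → s2.natReg r = s1.natReg r := fun r hr => hA2'.natReg r hr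
  have hq' := hg q hlo.le hhi
  apply WP.ite
  · simp
  · intro hb
    simp [h24', hr2] at hb
    apply WP.setNat
    · simp
      omega
    refine ⟨hA'.setNat _ (by norm_num), ?_⟩
    simp [hn, hmx, hq, hq'.1 hb]
    omega
  · intro hb
    simp [h24', hr2] at hb
    apply WP.setNat
    · simp
    refine ⟨hA'.setNat _ (by norm_num), ?_⟩
    have : ¬ q ≤ g := fun h => absurd (hq'.2 h) (not_le.2 hb)
    simp [hn, hmx, hq, this]
    omega

theorem placeSink_spec {P : DynamicPath} {B i r jm U lam : ℕ} {T : ℝ} {s : Store} (hE : P.Env B s)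
    (hi : s.natReg 20 = i) (hr : s.natReg 21 = r) (hT : s.realReg 21 = T) (hr1 : 1 ≤ r)
    (hjm : jm + r = P.n + 1) (hiU : i ≤ U) (hUj : U ≤ jm)
    (hU : ∀ u, i ≤ u → u ≤ jm → (P.leftTime i u ≤ T ↔ u ≤ U)) (hlam : P.n < 2 ^ lam) :
    WP B placeSink (fun s' t => Store.Agree 23 s s' ∧ s'.natReg 23 = jm ∧ s'.natReg 24 = U ∧
      s'.realReg 23 =
        (if U < jm then max 0 (P.edgeTime U - (P.leftTime i (U + 1) - T)) else 0) ∧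
      t ≤ (300 * (U - i) + 400) * (2 * lam + 2)) s := by
  have hB := hE.size_le
  apply WP.seq
  apply WP.setNat
  · simp [hE.n, hr]
    omega
  apply WP.seq
  apply WP.setNat
  · simp [hi]
    omega
  apply WP.seq
  apply WP.setNat
  · simp [hE.n, hr]
    omega
  simp [hi, hE.n, hr, show P.n + 1 - r = jm by omega]
  apply WP.seq
  set s1 := ((s.setNat 23 jm).setNat 30 i).setNat 34 jm with hs1
  have hA1 : Store.Agree 23 s s1 :=
    (((Store.Agree.refl 23 s).setNat _ (by norm_num)).setNat _ (by norm_num)).setNat _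
      (by norm_num)
  refine (gallop_spec (a := 30) (Inv := Store.Agree 30 s1) (fun s' r v hr h => h.setNat v hr)
    (leftTest_isProbe (hE.of_agree hA1 (by norm_num)) (by simp [hs1, hi]) (by simp [hs1, hT])
      (show jm ≤ P.n by omega) hU) hiU hUj (by omega) (by omega)
    (show U - i < 2 ^ lam by omega) (Store.Agree.refl _ _) (by simp [hs1])
    (by simp [hs1])).mono ?_
  rintro s2 t2 ⟨hA2, h30, ht2⟩
  apply WP.seq
  apply WP.setNat
  · simp [h30]
    omega
  apply WP.seq
  apply WP.setReal
  · simp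
  simp [h30]
  set s3 := (s2.setNat 24 U).setReal 23 0 with hs3
  have hA3 : Store.Agree 23 s s3 :=
    ((hA1.trans (hA2.of_le (by norm_num))).setNat _ (by norm_num)).setReal _ (by norm_num)
  have hE3 := hE.of_agree hA3 (by norm_num)
  have h23 : s3.natReg 23 = jm := by
    rw [show s3.natReg 23 = s2.natReg 23 by simp [hs3], hA2.natReg 23 (by norm_num)]
    simp [hs1]
  have h24 : s3.natReg 24 = U := by simp [hs3]
  have h20 : s3.natReg 20 = i := (hA3.natReg 20 (by norm_num)).trans hi
  have hcost : (300 * (U - i) + 400) * (2 * lam + 2) =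
      (200 * (U - i) + 150 + 30) * (2 * lam + 2) + 100 * ((U - i) * (2 * lam + 2)) +
        220 * (2 * lam + 2) := by ring
  have hprod : 2 * (U - i) ≤ (U - i) * (2 * lam + 2) := by nlinarith
  apply WP.ite
  · simp [h23, h24]
    omega
  · intro hb
    simp [h23, h24] at hb
    apply WP.skip
    refine ⟨hA3, h23, h24, ?_, ?_⟩
    · rw [if_neg (by omega)]
      simp [hs3]
    · simp
      omega
  · intro hb
    simp [h23, h24] at hb
    apply WP.seq
    apply WP.setNat
    · simp [h20]
      omega
    apply WP.seq
    apply WP.setNat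
    · simp [h24]
      omega
    simp [h20, h24]
    apply WP.seq
    have hA4 : Store.Agree 40 s3 ((s3.setNat 40 i).setNat 41 (U + 1)) :=
      ((Store.Agree.refl 40 s3).setNat _ (by norm_num)).setNat _ (by norm_num)
    refine (leftProg_spec (P := P) (i := i) (u := U + 1) (hE3.of_agree hA4 (by norm_num)) (by simp)
      (by simp) (by omega) (by omega)).mono ?_
    rintro s5 t5 ⟨hA5, hr5, ht5⟩
    have hA6 := hA4.trans hA5
    have hA7 := hA3.trans (hA6.of_le (show 23 ≤ 40 by norm_num))
    have hE5 := hE.of_agree hA7 (by norm_num)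
    have h24' : s5.natReg 24 = U := (hA6.natReg 24 (by norm_num)).trans h24
    apply WP.maxReal
    · simp [h24']
      omega
    intro t6 ht6
    simp at ht6
    refine ⟨hA7.setReal _ (by norm_num), ?_, ?_, ?_, ?_⟩
    · simp [hA6.natReg 23 (by norm_num), h23]
    · simp [h24']
    · rw [if_pos hb]
      simp [hA6.realReg 23 (by norm_num), hs3, h24', hr5, hA7.realReg 21 (by norm_num), hT,
        hE5.τ, hE5.x U (by omega), hE5.x (U + 1) (by omega), edgeTime]
    · omega

theorem extendRight_spec {P : DynamicPath} {B U jm g lam : ℕ} {T z : ℝ} {s : Store}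
    (hE : P.Env B s) (hU : s.natReg 24 = U) (hjm : s.natReg 23 = jm) (hT : s.realReg 21 = T)
    (hz : s.realReg 23 = z) (hjn : jm ≤ P.n) (hUg : U ≤ g) (hgj : g ≤ jm)
    (hg : ∀ j, U ≤ j → j ≤ jm → (P.rightTime U j ≤ T + z ↔ j ≤ g)) (hlam : P.n < 2 ^ lam) :
    WP B extendRight (fun s' t => Store.Agree 23 s s' ∧ s'.natReg 24 = U ∧ s'.realReg 23 = z ∧
      s'.natReg 30 = g ∧ t ≤ (200 * (g - U) + 200) * (2 * lam + 2)) s := by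
  have hB := hE.size_le
  apply WP.seq
  apply WP.setReal
  · simp
  apply WP.seq
  apply WP.setNat
  · simp [hU]
    omega
  apply WP.seq
  apply WP.setNat
  · simp [hjm]
    omega
  simp [hU, hjm, hT, hz]
  set s1 := ((s.setReal 24 (T + z)).setNat 30 U).setNat 34 jm with hs1
  have hA1 : Store.Agree 24 s s1 :=
    (((Store.Agree.refl 24 s).setReal _ (by norm_num)).setNat _ (by norm_num)).setNat _
      (by norm_num)
  refine (gallop_spec (a := 30) (Inv := Store.Agree 30 s1) (fun s' r v hr h => h.setNat v hr)
    (rightTest_isProbe (hE.of_agree hA1 (by norm_num)) (by simp [hs1, hU]) (by simp [hs1])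
      hjn hg) hUg hgj (by omega) (by omega)
    (show g - U < 2 ^ lam by omega) (Store.Agree.refl _ _) (by simp [hs1])
    (by simp [hs1])).mono ?_
  rintro s2 t2 ⟨hA2, h30, ht2⟩
  refine ⟨(hA1.trans (hA2.of_le (by norm_num))).of_le (by norm_num), ?_, ?_, h30, ?_⟩
  · rw [hA2.natReg 24 (by norm_num)]
    simp [hs1, hU]
  · rw [hA2.realReg 23 (by norm_num)]
    simp [hs1, hz]
  · have hcost : (200 * (g - U) + 200) * (2 * lam + 2) =
      (200 * (g - U) + 150 + 30) * (2 * lam + 2) + 20 * (2 * lam + 2) := by ring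
    omega

theorem storeSink_spec {P : DynamicPath} {B U g m r : ℕ} {z : ℝ} {s : Store}
    (hE : P.Env B s) (hU : s.natReg 24 = U) (hm : s.natReg 22 = m) (hr : s.natReg 21 = r)
    (hz : s.realReg 23 = z) (hg : s.natReg 30 = g) (hUg : U ≤ g) (hgn : g ≤ P.n)
    (hmr : m + r ≤ P.n + 1) :
    WP B storeSink (fun s' t => Store.WeakAgree 20 s s' ∧ s'.realReg 21 = s.realReg 21 ∧
      s'.natReg 20 = g + 1 ∧ s'.natReg 21 = r - 1 ∧ s'.natReg 22 = m + 1 ∧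
      (∀ l, s'.natArr 2 l = if l = m + 1 then g + 1 else s.natArr 2 l) ∧
      (∀ l, s'.realArr 1 l =
        if l = m then (if g ≤ U then P.x U else P.x U + z / P.τ) else s.realArr 1 l) ∧
      t ≤ 60) s := by
  have hB := hE.size_le
  have hstep : ∀ (Y : ℝ) (t0 : ℕ), t0 ≤ 20 →
      Y = (if g ≤ U then P.x U else P.x U + z / P.τ) →
      WP B (.seq (.putNat 2 (.add (.reg 22) (.lit 1)) (.add (.reg 30) (.lit 1))) <|
        .seq (.setNat 22 (.add (.reg 22) (.lit 1))) <|
        .seq (.setNat 20 (.add (.reg 30) (.lit 1))) (.setNat 21 (.sub (.reg 21) (.lit 1))))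
      (fun s' t => Store.WeakAgree 20 s s' ∧ s'.realReg 21 = s.realReg 21 ∧
      s'.natReg 20 = g + 1 ∧ s'.natReg 21 = r - 1 ∧ s'.natReg 22 = m + 1 ∧
      (∀ l, s'.natArr 2 l = if l = m + 1 then g + 1 else s.natArr 2 l) ∧
      (∀ l, s'.realArr 1 l =
        if l = m then (if g ≤ U then P.x U else P.x U + z / P.τ) else s.realArr 1 l) ∧
      t0 + t ≤ 60) (s.putReal 1 m Y) := by
    intro Y t0 ht0 hY
    apply WP.seq
    apply WP.putNat
    · simp [hm]
      omega
    · simp [hg]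
      omega
    apply WP.seq
    apply WP.setNat
    · simp [hm]
      omega
    apply WP.seq
    apply WP.setNat
    · simp [hg]
      omega
    apply WP.setNat
    · simp [hr]
      omega
    refine ⟨?_, by simp, by simp [hg], by simp [hr], by simp [hm], by simp [hm, hg],
      by simp [hY], ?_⟩
    · exact (((((Store.WeakAgree.refl 20 s).putReal _ _).putNat _ _).setNat _
        (by norm_num)).setNat _ (by norm_num)).setNat _ (by norm_num)
    · simp
      omega
  apply WP.seq
  apply WP.ite
  · simp [hg, hU]
    omega
  · intro hb
    simp [hg, hU] at hb
    apply WP.putReal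
    · simp [hm]
      omega
    · simp [hU]
      omega
    simp only [NExp.eval, hm]
    apply hstep
    · simp
    · simp [hb, hU, hE.x U (by omega)]
  · intro hb
    simp [hg, hU] at hb
    apply WP.putReal
    · simp [hm]
      omega
    · simp [hU]
      omega
    simp only [NExp.eval, hm]
    apply hstep
    · simp
    · simp [hU, hE.x U (by omega), hz, hE.τ, show ¬ g ≤ U by omega]

theorem greedyProg_spec {P : DynamicPath} {B i r lam : ℕ} {T : ℝ} {s : Store} (hE : P.Env B s)
    (hi : s.natReg 20 = i) (hr : s.natReg 21 = r) (hT : s.realReg 21 = T) (hT0 : 0 ≤ T)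
    (hir : i + r ≤ P.n + 1) (hlam : P.n < 2 ^ lam) :
    WP B greedyProg (fun s' t => Store.WeakAgree 20 s s' ∧ s'.natReg 20 ≤ P.n + 1 ∧
      (P.Feasible r i T ↔ s'.natReg 20 = P.n + 1) ∧ s'.natArr 2 0 = i ∧
      s'.natArr 2 r = s'.natReg 20 ∧ P.IsChain r (s'.natArr 2) (s'.realArr 1) T ∧
      t ≤ 400 * (P.n + 1 - i + r) * (2 * lam + 2) + 20) s := by
  have hB := hE.size_le
  apply WP.seq
  apply WP.setNat
  · simp
  apply WP.seq
  apply WP.putNat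
  · simp
  · simp [hi]
    omega
  let Inv : ℕ → Store → Prop := fun c s' => Store.WeakAgree 20 s s' ∧ s'.realReg 21 = T ∧
    ∃ i' r' m, s'.natReg 20 = i' ∧ s'.natReg 21 = r' ∧ s'.natReg 22 = m ∧ m + r' = r ∧
      i ≤ i' ∧ i' + r' ≤ P.n + 1 ∧ (P.Feasible r i T ↔ P.Feasible r' i' T) ∧ s'.natArr 2 0 = i ∧
      s'.natArr 2 m = i' ∧ P.IsChain m (s'.natArr 2) (s'.realArr 1) T ∧
      c = 400 * (P.n + 1 - i' + r') * (2 * lam + 2) + 5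
  refine (WP.loop Inv (fun s' => Store.WeakAgree 20 s s' ∧ s'.natReg 20 ≤ P.n + 1 ∧
      (P.Feasible r i T ↔ s'.natReg 20 = P.n + 1) ∧ s'.natArr 2 0 = i ∧
      s'.natArr 2 r = s'.natReg 20 ∧ P.IsChain r (s'.natArr 2) (s'.realArr 1) T)
    ?_ ?_ ?_ (400 * (P.n + 1 - i + r) * (2 * lam + 2) + 5) _ ?_).mono ?_
  · rintro c s' ⟨-, -, i', r', m, h1, h2, h3, h4, h5, h6, -⟩
    simp
    omega
  · rintro c s' ⟨hA, hT', i', r', m, h1, h2, h3, h4, h5, h6, h7, h8, h9, h10, h11⟩ hb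
    simp [h2] at hb
    have hE' := hE.of_weakAgree hA (by norm_num)
    obtain ⟨r', rfl⟩ : ∃ r'', r' = r'' + 1 := ⟨r' - 1, by omega⟩
    obtain ⟨U, hU1, hU2, hU3⟩ := exists_threshold (fun u => P.leftTime i' u ≤ T)
      (show i' ≤ P.n - r' by omega) (by rw [leftTime_self (by omega)]; exact hT0)
      (fun q q' g1 g2 g3 g4 => (leftTime_mono g1 g2 (by omega)).trans g4)
    obtain ⟨z, hz⟩ : ∃ z, z = if U < P.n - r' then
      max 0 (P.edgeTime U - (P.leftTime i' (U + 1) - T)) else 0 := ⟨_, rfl⟩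
    have hz0 : 0 ≤ z := by
      rw [hz]
      split_ifs
      · exact le_max_left _ _
      · exact le_rfl
    obtain ⟨g, hg1, hg2, hg3⟩ := exists_threshold (fun j => P.rightTime U j ≤ T + z)
      hU2 (by rw [rightTime_self (by omega)]; linarith)
      (fun q q' g1 g2 g3 g4 => (rightTime_mono le_rfl g1 g2 (by omega)).trans g4)
    have hgreedy := greedy_step hU1 hU2 (show P.n - r' ≤ P.n by omega) hT0 hU3 hz hg1 hg2 hg3 rfl
    apply WP.seq
    refine (placeSink_spec hE' h1 h2 hT' (by omega) (show P.n - r' + (r' + 1) = P.n + 1 by omega)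
      hU1 hU2 hU3 hlam).mono ?_
    rintro s2 t2 ⟨hA2, a1, a2, a3, ht2⟩
    rw [← hz] at a3
    apply WP.seq
    refine (extendRight_spec (hE'.of_agree hA2 (by norm_num)) a2 a1
      ((hA2.realReg 21 (by norm_num)).trans hT') a3 (by omega) hg1 hg2 hg3 hlam).mono ?_
    rintro s3 t3 ⟨hA3, b1, b2, b3, ht3⟩
    have hA4 := hA2.trans hA3
    refine (storeSink_spec (hE'.of_agree hA4 (by norm_num)) b1
      ((hA4.natReg 22 (by norm_num)).trans h3) ((hA4.natReg 21 (by norm_num)).trans h2) b2 b3 hg1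
      (by omega) (by omega)).mono ?_
    rintro s4 t4 ⟨hA5, c1, c2, c3, c4, c5, c6, ht4⟩
    rw [hA4.natArr] at c5
    rw [hA4.realArr] at c6
    refine ⟨400 * (P.n + 1 - (g + 1) + r') * (2 * lam + 2) + 5,
      ⟨(hA.trans (hA4.of_le (show 20 ≤ 23 by norm_num)).weak).trans hA5, ?_, g + 1, r', m + 1, c2,
        c3, c4, by omega, by omega, by omega, ?_, ?_, ?_, ?_, rfl⟩, ?_⟩
    · rw [c1, hA4.realReg 21 (by norm_num), hT']
    · rw [h7]
      exact feasible_succ_iff (by omega) (by omega) ⟨_, hgreedy.1⟩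
        (fun j g1 g2 => hgreedy.2 j g1 (by omega))
    · rw [c5, if_neg (by omega), h8]
    · rw [c5, if_pos rfl]
    · intro l hl
      rw [c5, c5, c6]
      rcases Nat.lt_or_ge l m with hlm | hlm
      · rw [if_neg (by omega), if_neg (by omega), if_neg (by omega)]
        exact h10 l hlm
      · obtain rfl : l = m := by omega
        rw [if_neg (by omega), if_pos rfl, if_pos rfl, h9]
        exact ⟨by omega, hgreedy.1⟩
    · rw [h11, show P.n + 1 - i' + (r' + 1) = (P.n + 1 - (g + 1) + r') + (U - i') + (g - U) + 2
        by omega]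
      have : 400 * (P.n + 1 - (g + 1) + r' + (U - i') + (g - U) + 2) * (2 * lam + 2) =
        400 * (P.n + 1 - (g + 1) + r') * (2 * lam + 2) +
        (300 * (U - i') + 400) * (2 * lam + 2) + (200 * (g - U) + 200) * (2 * lam + 2) +
        100 * ((U - i') * (2 * lam + 2)) + 200 * ((g - U) * (2 * lam + 2)) +
        200 * (2 * lam + 2) := by ring
      simp only [Test.cost, NExp.cost]
      omega
  · rintro c s' ⟨hA, hT', i', r', m, h1, h2, h3, h4, h5, h6, h7, h8, h9, h10, h11⟩ hb
    simp [h2] at hb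
    subst hb
    obtain rfl : m = r := by omega
    refine ⟨⟨hA, by omega, ?_, h8, by rw [h9, h1], h10⟩, ?_⟩
    · rw [h7, h1]
      exact Iff.rfl
    · simp
      omega
  · refine ⟨((Store.WeakAgree.refl 20 s).setNat _ (by norm_num)).putNat _ _, by simp [hT], i, r, 0,
      by simp [hi], by simp [hr], by simp, by omega, le_rfl, hir, Iff.rfl, by simp [hi],
      by simp [hi], ?_, rfl⟩
    intro l hl
    omega
  · rintro s' t ⟨⟨h1, h2, h3, h4, h5, h6⟩, h7⟩
    refine ⟨h1, h2, h3, h4, h5, h6, ?_⟩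
    simp
    omega

/-! ### Parametric search -/

/-- Test of the search for the end of the first subpath: the candidate `q` in word register `6`
for the start of the second subpath is too early if the vertices from `x q` on are infeasible for the
time that the vertices before `x q` need. -/
def splitTest : Prog :=
  .seq (.setNat 20 (.reg 2)) <| .seq (.setNat 21 (.sub (.reg 6) (.lit 1))) <| .seq sinkProg <|
  .seq (.setReal 21 (.reg 20)) <|
  .seq (.setNat 20 (.reg 6)) <| .seq (.setNat 21 (.sub (.reg 3) (.lit 1))) <| .seq greedyProg <|
  .ite (.natLe (.add (.reg 0) (.lit 1)) (.reg 20)) (.setNat 7 (.lit 0)) (.setNat 7 (.lit 1))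

/-- One step of the parametric search: word register `2` holds the first vertex, word register `3`
the number of remaining sinks, real register `2` the best deadline found. -/
def splitProg : Prog :=
  .seq (.setNat 4 (.reg 2)) <| .seq (.setNat 8 (.sub (.add (.reg 0) (.lit 1)) (.reg 3))) <|
  .seq (gallop 4 splitTest) <|
  .seq (.setNat 20 (.reg 2)) <| .seq (.setNat 21 (.reg 4)) <| .seq sinkProg <|
  .seq (minReal 2 (.reg 20)) <|
  .seq (.setNat 2 (.reg 4)) (.setNat 3 (.sub (.reg 3) (.lit 1)))

/-- The optimal evacuation time is put into real register `2`. The start value of the search is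
the time of the protocol in which every subpath except the first one is a single vertex. -/
def searchProg : Prog :=
  .seq (.setNat 20 (.lit 0)) <| .seq (.setNat 21 (.sub (.add (.reg 0) (.lit 1)) (.reg 1))) <|
  .seq sinkProg <| .seq (.setReal 2 (.reg 20)) <|
  .seq (.setNat 2 (.lit 0)) <| .seq (.setNat 3 (.reg 1)) <|
  .loop (.natLe (.lit 1) (.reg 3)) splitProg

/-- Prefix sums of the weights. -/
def prefixProg : Prog :=
  .seq (.setNat 2 (.lit 0)) <|
  .loop (.natLe (.reg 2) (.reg 0)) <|
    .seq (.putNat 3 (.add (.reg 2) (.lit 1)) (.add (.get 3 (.reg 2)) (.get 0 (.reg 2))))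
      (.setNat 2 (.add (.reg 2) (.lit 1)))

/-- The algorithm: the optimal time is found by parametric search, then the greedy protocol for this
deadline is an optimal protocol. -/
def evacProg : Prog :=
  .seq prefixProg <| .seq searchProg <|
  .seq (.setNat 20 (.lit 0)) <| .seq (.setNat 21 (.reg 1)) <| .seq (.setReal 21 (.reg 2)) <|
  .seq greedyProg (.setReal 0 (.reg 2))

theorem splitTest_isProbe {P : DynamicPath} {B i r a lam : ℕ} {s : Store} (hE : P.Env B s)
    (hi : s.natReg 2 = i) (hr : s.natReg 3 = r + 1) (hir : i + r ≤ P.n)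
    (ha : ∀ q, i < q → q ≤ P.n - r →
      (¬ P.Feasible r q (P.sinkTime i (q - 1)) ↔ q ≤ a)) (hlam : P.n < 2 ^ lam) :
    IsProbe B 4 splitTest (Store.WeakAgree 4 s) i (P.n - r) a
      (1200 * ((P.n + 1) * (2 * lam + 2))) := by
  intro s1 hA hmx hlo hhi _
  have hB := hE.size_le
  have hE1 := hE.of_weakAgree hA (by norm_num)
  have h2 : s1.natReg 2 = i := (hA.natReg 2 (by norm_num)).trans hi
  have h3 : s1.natReg 3 = r + 1 := (hA.natReg 3 (by norm_num)).trans hr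
  obtain ⟨q, hq⟩ : ∃ q, s1.natReg 6 = q := ⟨_, rfl⟩
  norm_num at hlo hhi hmx
  rw [hq] at hlo hhi
  apply WP.seq
  apply WP.setNat
  · simp [h2]
    omega
  apply WP.seq
  apply WP.setNat
  · simp [hq]
    omega
  simp [h2, hq]
  apply WP.seq
  have hA1 : Store.Agree 20 s1 ((s1.setNat 20 i).setNat 21 (q - 1)) :=
    ((Store.Agree.refl 20 s1).setNat _ (by norm_num)).setNat _ (by norm_num)
  refine (sinkProg_spec (P := P) (i := i) (j := q - 1) (hE1.of_agree hA1 (by norm_num)) (by simp)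
    (by simp) (by omega) (by omega) hlam).mono ?_
  rintro s2 t2 ⟨hA2, hr2, ht2⟩
  have hA2' := hA1.trans hA2
  have h6 : s2.natReg 6 = q := (hA2'.natReg 6 (by norm_num)).trans hq
  have h3' : s2.natReg 3 = r + 1 := (hA2'.natReg 3 (by norm_num)).trans h3
  apply WP.seq
  apply WP.setReal
  · simp
  apply WP.seq
  apply WP.setNat
  · simp [h6]
    omega
  apply WP.seq
  apply WP.setNat
  · simp [h3']
    omega
  simp [h6, h3', hr2]
  apply WP.seq
  set s3 := ((s2.setReal 21 (P.sinkTime i (q - 1))).setNat 20 q).setNat 21 r with hs3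
  have hA3 : Store.Agree 20 s1 s3 :=
    ((hA2'.setReal _ (by norm_num)).setNat _ (by norm_num)).setNat _ (by norm_num)
  refine (greedyProg_spec (P := P) (i := q) (r := r) (T := P.sinkTime i (q - 1))
    (hE1.of_agree hA3 (by norm_num)) (by simp [hs3]) (by simp [hs3]) (by simp [hs3])
    (sinkTime_nonneg (by omega) (by omega)) (by omega) hlam).mono ?_
  rintro s4 t4 ⟨hA4, hle, hF, -, -, -, ht4⟩
  have hA' : Store.WeakAgree 20 s1 s4 := hA3.weak.trans hA4
  have hE4 := hE1.of_weakAgree hA' (by norm_num)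
  have hn : ∀ x, x < 20 → s4.natReg x = s1.natReg x := fun x hx => hA'.natReg x hx
  have hW : Store.WeakAgree 4 s s4 := hA.trans (hA'.of_le (by norm_num))
  have hq' := ha q hlo hhi
  have hcost1 : (300 * (q - 1 - i) + 200) * (2 * lam + 2) ≤
      300 * ((P.n + 1) * (2 * lam + 2)) := by
    rw [← mul_assoc]
    exact Nat.mul_le_mul_right _ (by omega)
  have hcost2 : 400 * (P.n + 1 - q + r) * (2 * lam + 2) ≤
      800 * ((P.n + 1) * (2 * lam + 2)) := by
    rw [← mul_assoc]
    exact Nat.mul_le_mul_right _ (by omega)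
  have hpos : 1 * 2 ≤ (P.n + 1) * (2 * lam + 2) := Nat.mul_le_mul (by omega) (by omega)
  apply WP.ite
  · simp [hE4.n]
    omega
  · intro hb
    simp [hE4.n] at hb
    apply WP.setNat
    · simp
    refine ⟨hW.setNat _ (by norm_num), ?_⟩
    have hnot : ¬ q ≤ a := fun h => (hq'.2 h) (hF.2 (by omega))
    simp [hn, hmx, hq, hnot]
    omega
  · intro hb
    simp [hE4.n] at hb
    apply WP.setNat
    · simp
      omega
    refine ⟨hW.setNat _ (by norm_num), ?_⟩
    have hyes : q ≤ a := hq'.1 fun h => by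
      have := hF.1 h
      omega
    simp [hn, hmx, hq, hyes]
    omega

theorem splitProg_spec {P : DynamicPath} {B i r a lam : ℕ} {best : ℝ} {s : Store} (hE : P.Env B s)
    (hi : s.natReg 2 = i) (hr : s.natReg 3 = r + 1) (hbest : s.realReg 2 = best)
    (hir : i + r ≤ P.n) (ha1 : i ≤ a) (ha2 : a ≤ P.n - r)
    (ha : ∀ q, i < q → q ≤ P.n - r →
      (¬ P.Feasible r q (P.sinkTime i (q - 1)) ↔ q ≤ a)) (hlam : P.n < 2 ^ lam) :
    WP B splitProg (fun s' t => Store.WeakAgree 2 s s' ∧ s'.natReg 2 = a ∧ s'.natReg 3 = r ∧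
      s'.realReg 2 = min best (P.sinkTime i a) ∧
      t ≤ 1600 * ((P.n + 1) * (2 * lam + 2) ^ 2)) s := by
  have hB := hE.size_le
  apply WP.seq
  apply WP.setNat
  · simp [hi]
    omega
  apply WP.seq
  apply WP.setNat
  · simp [hr, hE.n]
    omega
  simp [hi, hr, hE.n]
  apply WP.seq
  set s1 := (s.setNat 4 i).setNat 8 (P.n - r) with hs1
  have hA1 : Store.Agree 4 s s1 :=
    ((Store.Agree.refl 4 s).setNat _ (by norm_num)).setNat _ (by norm_num)
  refine (gallop_spec (a := 4) (Inv := Store.WeakAgree 4 s1) (fun s' r v hr h => h.setNat v hr)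
    (splitTest_isProbe (hE.of_agree hA1 (by norm_num)) (by simp [hs1, hi]) (by simp [hs1, hr])
      hir ha hlam) ha1 ha2 (by omega) (by omega) (show a - i < 2 ^ lam by omega)
    (Store.WeakAgree.refl _ _) (by simp [hs1]) (by simp [hs1])).mono ?_
  rintro s2 t2 ⟨hA2, h4, ht2⟩
  have hA3 := hA1.weak.trans hA2
  have hE2 := hE.of_weakAgree hA3 (by norm_num)
  have h2 : s2.natReg 2 = i := (hA3.natReg 2 (by norm_num)).trans hi
  apply WP.seq
  apply WP.setNat
  · simp [h2]
    omega
  apply WP.seq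
  apply WP.setNat
  · simp [h4]
    omega
  simp [h2, h4]
  apply WP.seq
  have hA4 : Store.Agree 20 s2 ((s2.setNat 20 i).setNat 21 a) :=
    ((Store.Agree.refl 20 s2).setNat _ (by norm_num)).setNat _ (by norm_num)
  refine (sinkProg_spec (P := P) (i := i) (j := a) (hE2.of_agree hA4 (by norm_num)) (by simp)
    (by simp) ha1 (by omega) hlam).mono ?_
  rintro s5 t5 ⟨hA5, hr5, ht5⟩
  have hA6 := hA4.trans hA5
  have hA7 := hA3.trans (hA6.of_le (show 4 ≤ 20 by norm_num)).weak
  have h4' : s5.natReg 4 = a := (hA6.natReg 4 (by norm_num)).trans h4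
  have h3' : s5.natReg 3 = r + 1 := (hA7.natReg 3 (by norm_num)).trans hr
  have hbest' : s5.realReg 2 = best := (hA7.realReg 2 (by norm_num)).trans hbest
  apply WP.seq
  apply WP.minReal
  · simp
  intro t6 ht6
  simp at ht6
  apply WP.seq
  apply WP.setNat
  · simp [h4']
    omega
  apply WP.setNat
  · simp [h3']
    omega
  refine ⟨?_, by simp [h4'], by simp [h3'], by simp [hbest', hr5], ?_⟩
  · exact (((hA7.of_le (by norm_num)).setReal _ (by norm_num)).setNat _ (by norm_num)).setNat _
      (by norm_num)
  · have hcost1 : (300 * (a - i) + 200) * (2 * lam + 2) ≤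
        300 * ((P.n + 1) * (2 * lam + 2)) := by
      rw [← mul_assoc]
      exact Nat.mul_le_mul_right _ (by omega)
    have hcost2 : (1200 * ((P.n + 1) * (2 * lam + 2)) + 30) * (2 * lam + 2) =
        1200 * ((P.n + 1) * (2 * lam + 2) ^ 2) + 30 * (2 * lam + 2) := by ring
    have hcost3 : 2 * ((P.n + 1) * (2 * lam + 2)) ≤ (P.n + 1) * (2 * lam + 2) ^ 2 := by
      rw [pow_two, ← mul_assoc (P.n + 1), mul_comm 2]
      exact Nat.mul_le_mul_left _ (by omega)
    have hcost4 : 2 * lam + 2 ≤ (P.n + 1) * (2 * lam + 2) := Nat.le_mul_of_pos_left _ (by omega)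
    simp
    omega

theorem searchProg_spec {P : DynamicPath} {B k lam : ℕ} {s : Store} (hE : P.Env B s)
    (hk : s.natReg 1 = k) (hk1 : 1 ≤ k) (hkn : k ≤ P.n + 1) (hlam : P.n < 2 ^ lam) :
    WP B searchProg (fun s' t => Store.WeakAgree 2 s s' ∧ 0 ≤ s'.realReg 2 ∧
      (∀ T, 0 ≤ T → (P.Feasible k 0 T ↔ s'.realReg 2 ≤ T)) ∧
      t ≤ 2000 * (k * ((P.n + 1) * (2 * lam + 2) ^ 2))) s := by
  have hB := hE.size_le
  apply WP.seq
  apply WP.setNat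
  · simp
  apply WP.seq
  apply WP.setNat
  · simp [hE.n, hk]
    omega
  simp [hE.n, hk]
  apply WP.seq
  have hA1 : Store.Agree 20 s ((s.setNat 20 0).setNat 21 (P.n + 1 - k)) :=
    ((Store.Agree.refl 20 s).setNat _ (by norm_num)).setNat _ (by norm_num)
  refine (sinkProg_spec (P := P) (i := 0) (j := P.n + 1 - k) (hE.of_agree hA1 (by norm_num))
    (by simp) (by simp) (by omega) (by omega) hlam).mono ?_
  rintro s2 t2 ⟨hA2, hr2, ht2⟩
  have hA3 := hA1.trans hA2
  have hk' : s2.natReg 1 = k := (hA3.natReg 1 (by norm_num)).trans hk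
  apply WP.seq
  apply WP.setReal
  · simp
  apply WP.seq
  apply WP.setNat
  · simp
  apply WP.seq
  apply WP.setNat
  · simp [hk']
    omega
  simp [hk', hr2]
  set D := (P.n + 1) * (2 * lam + 2) ^ 2 with hD
  have hD1 : (2 * lam + 2) * (P.n + 1) ≤ D := by
    rw [hD, pow_two, ← mul_assoc, mul_comm (2 * lam + 2)]
    exact Nat.le_mul_of_pos_right _ (by omega)
  have hD2 : 1 ≤ D := by
    rw [hD]
    exact Nat.mul_pos (by omega) (by positivity)
  let Inv : ℕ → Store → Prop := fun c s' => Store.WeakAgree 2 s s' ∧ 0 ≤ s'.realReg 2 ∧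
    ∃ i r, s'.natReg 2 = i ∧ s'.natReg 3 = r ∧ i ≤ P.n ∧ i + r ≤ P.n + 1 ∧
      (∀ T, 0 ≤ T → (P.Feasible k 0 T ↔ s'.realReg 2 ≤ T ∨ P.Feasible r i T)) ∧
      c = 1620 * (r * D) + 5
  refine (WP.loop Inv (fun s' => Store.WeakAgree 2 s s' ∧ 0 ≤ s'.realReg 2 ∧
    (∀ T, 0 ≤ T → (P.Feasible k 0 T ↔ s'.realReg 2 ≤ T))) ?_ ?_ ?_ (1620 * (k * D) + 5) _ ?_).mono ?_
  · rintro c s' ⟨-, -, i, r, h1, h2, h3, h4, -⟩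
    simp
    omega
  · rintro c s' ⟨hA, hpos, i, r, h1, h2, h3, h4, h5, h6⟩ hb
    simp [h2] at hb
    obtain ⟨r, rfl⟩ : ∃ r', r = r' + 1 := ⟨r - 1, by omega⟩
    obtain ⟨a, ha1, ha2, ha3⟩ := P.exists_split (show i + r ≤ P.n by omega)
    refine (splitProg_spec (hE.of_weakAgree hA (by norm_num)) h1 h2 rfl (by omega) ha1 ha2 ha3
      hlam).mono ?_
    rintro s4 t4 ⟨hA4, g1, g2, g3, ht4⟩
    refine ⟨1620 * (r * D) + 5, ⟨hA.trans hA4, ?_, a, r, g1, g2, by omega, by omega, ?_, rfl⟩, ?_⟩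
    · rw [g3]
      exact le_min hpos (sinkTime_nonneg ha1 (by omega))
    · intro T hT
      rw [h5 T hT, feasible_succ_iff_of_split (by omega) ha1 ha2 ha3 hT, g3, min_le_iff, or_assoc]
    · rw [h6, add_mul r]
      simp
      omega
  · rintro c s' ⟨hA, hpos, i, r, h1, h2, h3, h4, h5, h6⟩ hb
    simp [h2] at hb
    subst hb
    refine ⟨⟨hA, hpos, fun T hT => ?_⟩, ?_⟩
    · rw [h5 T hT, or_iff_left]
      intro h
      have : i = P.n + 1 := h
      omega
    · simp
      omega
  · refine ⟨?_, ?_, 0, k, by simp, by simp, by omega, by omega, ?_, rfl⟩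
    · exact ((((hA3.weak.of_le (by norm_num)).setReal _ (by norm_num)).setNat _
        (by norm_num)).setNat _ (by norm_num))
    · simp
      exact sinkTime_nonneg (by omega) (by omega)
    · intro T hT
      simp
      intro h
      obtain ⟨r, rfl⟩ : ∃ r', k = r' + 1 := ⟨k - 1, by omega⟩
      rw [Nat.add_sub_add_right] at h
      exact feasible_of_sinkTime_le (by omega) h
  · rintro s4 t4 ⟨⟨h1, h2, h3⟩, h4⟩
    refine ⟨h1, h2, h3, ?_⟩
    have hcost1 : (300 * (P.n + 1 - k - 0) + 200) * (2 * lam + 2) ≤ 300 * D := by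
      calc (300 * (P.n + 1 - k - 0) + 200) * (2 * lam + 2)
          ≤ 300 * (P.n + 1) * (2 * lam + 2) := Nat.mul_le_mul_right _ (by omega)
        _ = 300 * ((2 * lam + 2) * (P.n + 1)) := by ring
        _ ≤ 300 * D := Nat.mul_le_mul_left _ hD1
    have hcost2 : D ≤ k * D := Nat.le_mul_of_pos_left _ (by omega)
    omega

theorem prefixProg_spec {P : DynamicPath} {B k : ℕ} (hB : 4 * P.n + 10 ≤ B)
    (hw : ∑ l ∈ Finset.range (P.n + 1), P.w l ≤ B) (hc : ∀ e, 1 ≤ e → e ≤ P.n → P.c e ≤ B) :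
    WP B prefixProg (fun s' t => P.Env B s' ∧ s'.natReg 1 = k ∧ t ≤ 20 * (P.n + 1) + 10)
      (P.input k) := by
  apply WP.seq
  apply WP.setNat
  · simp
  let Inv : ℕ → Store → Prop := fun c s' => s'.natReg 0 = P.n ∧ s'.natReg 1 = k ∧
    s'.realReg = (P.input k).realReg ∧ s'.realArr = (P.input k).realArr ∧
    s'.natArr 0 = (P.input k).natArr 0 ∧ s'.natArr 1 = (P.input k).natArr 1 ∧
    ∃ v, s'.natReg 2 = v ∧ v ≤ P.n + 1 ∧
      (∀ l, l ≤ v → s'.natArr 3 l = ∑ l ∈ Finset.range l, P.w l) ∧ c = 20 * (P.n + 1 - v) + 4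
  have hsum : ∀ v, v ≤ P.n + 1 → ∑ l ∈ Finset.range v, P.w l ≤ B := fun v hv =>
    (Finset.sum_le_sum_of_subset (Finset.range_mono hv)).trans hw
  refine (WP.loop Inv (fun s' => P.Env B s' ∧ s'.natReg 1 = k) ?_ ?_ ?_ (20 * (P.n + 1) + 4) _
    ?_).mono ?_
  · rintro c s' ⟨h0, -, -, -, -, -, v, h1, h2, -⟩
    simp
    omega
  · rintro c s' ⟨h0, h1, h2, h3, h4, h5, v, h6, h7, h8, h9⟩ hb
    simp [h0, h6] at hb
    have hwv : s'.natArr 0 v = P.w v := by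
      rw [h4]
      simp [DynamicPath.input, hb]
    have hv1 := hsum (v + 1) (by omega)
    rw [Finset.sum_range_succ] at hv1
    have h8' := h8 v le_rfl
    apply WP.seq
    apply WP.putNat
    · simp [h6]
      omega
    · simp [h6, hwv, h8']
      omega
    apply WP.setNat
    · simp [h6]
      omega
    refine ⟨20 * (P.n + 1 - (v + 1)) + 4, ⟨by simp [h0], by simp [h1], by simp [h2], by simp [h3],
      ?_, ?_, v + 1, by simp [h6], by omega, ?_, rfl⟩, ?_⟩
    · ext l
      simp [h4]
    · ext l
      simp [h5]
    · intro l hl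
      rcases Nat.lt_or_ge v l with hlt | hge
      · obtain rfl : l = v + 1 := by omega
        simp [h6, hwv, h8', Finset.sum_range_succ]
      · simp [h6, show l ≠ v + 1 by omega, h8 l hge]
    · simp only [NExp.cost, Test.cost]
      omega
  · rintro c s' ⟨h0, h1, h2, h3, h4, h5, v, h6, h7, h8, h9⟩ hb
    simp [h0, h6] at hb
    refine ⟨⟨⟨hB, hw, h0, ?_, ?_, ?_, ?_, fun v hv => h8 v (by omega)⟩, h1⟩, ?_⟩
    · rw [h2]
      simp [DynamicPath.input]
    · intro i hi
      rw [h3]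
      simp [DynamicPath.input, hi]
    · intro e he1 he2
      rw [h5]
      simp [DynamicPath.input, he1, he2]
    · intro e
      rw [h5]
      by_cases he : 1 ≤ e ∧ e ≤ P.n
      · simpa [DynamicPath.input, he] using hc e he.1 he.2
      · simp [DynamicPath.input, he]
    · simp
      omega
  · refine ⟨by simp [DynamicPath.input], by simp [DynamicPath.input], rfl, rfl, rfl, rfl, 0,
      by simp, by omega, ?_, rfl⟩
    intro l hl
    obtain rfl : l = 0 := by omega
    simp [DynamicPath.input]
  · rintro s' t ⟨⟨h1, h2⟩, h3⟩
    refine ⟨h1, h2, ?_⟩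
    simp
    omega

theorem evacProg_spec {P : DynamicPath} {B k lam : ℕ} (hk : 1 ≤ k) (hkn : k ≤ P.n + 1)
    (hB : 4 * P.n + 10 ≤ B) (hw : ∑ l ∈ Finset.range (P.n + 1), P.w l ≤ B)
    (hc : ∀ e, 1 ≤ e → e ≤ P.n → P.c e ≤ B) (hlam : P.n < 2 ^ lam) :
    WP B evacProg (fun s t => s.realReg 0 = P.optTime k ∧
      P.IsProtocol k (fun j => s.natArr 2 j) (fun j => s.realArr 1 j) ∧
      P.protocolTime k (fun j => s.natArr 2 j) (fun j => s.realArr 1 j) = P.optTime k ∧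
      t ≤ 3000 * (k * ((P.n + 1) * (2 * lam + 2) ^ 2))) (P.input k) := by
  apply WP.seq
  refine (prefixProg_spec hB hw hc).mono ?_
  rintro s1 t1 ⟨hE, hk1, ht1⟩
  apply WP.seq
  refine (searchProg_spec hE hk1 hk hkn hlam).mono ?_
  rintro s2 t2 ⟨hA2, hpos, hF, ht2⟩
  have hE2 := hE.of_weakAgree hA2 (by norm_num)
  have hk2 : s2.natReg 1 = k := (hA2.natReg 1 (by norm_num)).trans hk1
  apply WP.seq
  apply WP.setNat
  · simp
  apply WP.seq
  apply WP.setNat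
  · simp [hk2]
    omega
  apply WP.seq
  apply WP.setReal
  · simp
  simp [hk2]
  apply WP.seq
  set s3 := ((s2.setNat 20 0).setNat 21 k).setReal 21 (s2.realReg 2) with hs3
  have hA3 : Store.Agree 20 s2 s3 :=
    (((Store.Agree.refl 20 s2).setNat _ (by norm_num)).setNat _ (by norm_num)).setReal _
      (by norm_num)
  refine (greedyProg_spec (P := P) (i := 0) (r := k) (T := s2.realReg 2)
    (hE2.of_agree hA3 (by norm_num)) (by simp [hs3]) (by simp [hs3]) (by simp [hs3]) hpos
    (by omega) hlam).mono ?_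
  rintro s4 t4 ⟨hA4, -, hFeas, hA0, hAk, hchain, ht4⟩
  have hend := hFeas.1 ((hF _ hpos).2 le_rfl)
  have hr2 : s4.realReg 2 = s2.realReg 2 := (hA3.weak.trans hA4).realReg 2 (by norm_num)
  obtain ⟨h1, h2, h3⟩ := optTime_eq_of_isChain hk hpos (fun S hS h => (hF S hS).1 h) hchain hA0
    (hAk.trans hend)
  apply WP.setReal
  · simp
  refine ⟨by simp [hr2, ← h1], h2, h3, ?_⟩
  set D := (P.n + 1) * (2 * lam + 2) ^ 2 with hD
  have hcost1 : D ≤ k * D := Nat.le_mul_of_pos_left _ (by omega)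
  have hcost2 : 400 * (P.n + 1 - 0 + k) * (2 * lam + 2) ≤ 400 * D := by
    rw [hD, pow_two, mul_assoc]
    refine Nat.mul_le_mul_left _ ?_
    rw [← mul_assoc]
    refine Nat.mul_le_mul_right _ ?_
    have := Nat.mul_le_mul_left (P.n + 1) (show 2 ≤ 2 * lam + 2 by omega)
    omega
  have hcost3 : P.n + 1 ≤ D := by
    rw [hD]
    exact Nat.le_mul_of_pos_right _ (by positivity)
  have hcost4 : 4 ≤ D := by
    rw [hD]
    nlinarith
  simp
  omega

/-- The factor `2 * lam + 2` of the running time is logarithmic for `lam = Nat.log 2 n + 1`. -/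
theorem two_mul_log_add_four_le {n : ℕ} (hn : 1 ≤ n) :
    ((2 * (Nat.log 2 n + 1) + 2 : ℕ) : ℝ) ≤ 10 * Real.log (n + 1 : ℕ) := by
  have h2 : (0.6931471803 : ℝ) < Real.log 2 := Real.log_two_gt_d9
  have h1 : (Nat.log 2 n : ℝ) * Real.log 2 ≤ Real.log (n + 1 : ℕ) := by
    rw [← Real.log_pow]
    apply Real.log_le_log (by positivity)
    have : 2 ^ Nat.log 2 n ≤ n := Nat.pow_log_le_self 2 (by omega)
    exact_mod_cast this.trans (Nat.le_succ n)
  have h3 : Real.log 2 ≤ Real.log (n + 1 : ℕ) := by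
    apply Real.log_le_log (by norm_num)
    exact_mod_cast (show 2 ≤ n + 1 by omega)
  have h4 : (0 : ℝ) ≤ Nat.log 2 n := Nat.cast_nonneg _
  push_cast at *
  nlinarith

end Evac

/-- One program and one constant `C` work for all dynamic paths `P` and all `k` for which `P` has a
partition into `k` subpaths. On halting, real register `0` holds the optimal `k`-sink evacuation
time, and word array `2` and real array `1` hold an optimal protocol. The words used have
`O(log (magnitude))` bits. For a path with a single vertex, where `log |P| = 0`, the number of
steps is bounded by a constant. -/
theorem theorem4 :
    ∃ (prog : Evac.Prog) (C : ℕ), ∀ (P : Evac.DynamicPath) (k : ℕ), 1 ≤ k → k ≤ P.size →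
      ∃ (t : ℕ) (s : Evac.Store),
        Evac.Exec (P.magnitude k ^ C) prog (P.input k) t s ∧
        (2 ≤ P.size → (t : ℝ) ≤ C * (k * P.size * Real.log P.size ^ 2)) ∧
        (P.size = 1 → t ≤ C) ∧
        s.realReg 0 = P.optTime k ∧
        P.IsProtocol k (fun j => s.natArr 2 j) (fun j => s.realArr 1 j) ∧
        P.protocolTime k (fun j => s.natArr 2 j) (fun j => s.realArr 1 j) = P.optTime k := by
  -- the steps number at most `3000 * k * |P| * L ^ 2` with `L ≤ 10 * log |P|`; the same constant is
  -- used as exponent of the word bound, so it is kept opaque to the evaluation of powers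
  obtain ⟨C, hC⟩ : ∃ C : ℕ, C = 300000 := ⟨_, rfl⟩
  refine ⟨Evac.evacProg, C, fun P k hk hkn => ?_⟩
  have hM : 2 ≤ P.magnitude k := by
    rw [Evac.DynamicPath.magnitude]
    omega
  have hMB : 16 * P.magnitude k ≤ P.magnitude k ^ C := by
    calc 16 * P.magnitude k = 2 ^ 4 * P.magnitude k := by norm_num
      _ ≤ P.magnitude k ^ 4 * P.magnitude k := Nat.mul_le_mul_right _ (Nat.pow_le_pow_left hM 4)
      _ = P.magnitude k ^ 5 := (pow_succ _ _).symm
      _ ≤ P.magnitude k ^ C := Nat.pow_le_pow_right (by omega) (by omega)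
  generalize P.magnitude k ^ C = B at hMB ⊢
  have hw : ∑ l ∈ Finset.range (P.n + 1), P.w l ≤ B := by
    rw [Evac.DynamicPath.magnitude, ← Nat.range_succ_eq_Icc_zero] at hMB
    omega
  have hc : ∀ e, 1 ≤ e → e ≤ P.n → P.c e ≤ B := by
    intro e h1 h2
    have := Finset.single_le_sum (f := P.c) (fun _ _ => Nat.zero_le _)
      (Finset.mem_Icc.2 ⟨h1, h2⟩)
    rw [Evac.DynamicPath.magnitude] at hMB
    omega
  have hn : 4 * P.n + 10 ≤ B := by
    rw [Evac.DynamicPath.magnitude] at hMB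
    omega
  obtain ⟨t, s, h1, h2, h3, h4, h5⟩ := Evac.evacProg_spec (P := P) (k := k) hk hkn hn hw hc
    (Nat.lt_pow_succ_log_self (by norm_num : 1 < 2) P.n)
  refine ⟨t, s, h1, fun hsize => ?_, fun hsize => ?_, h2, h3, h4⟩
  · have hlog := Evac.two_mul_log_add_four_le (n := P.n) (by
      rw [Evac.DynamicPath.size] at hsize
      omega)
    have h5' : (t : ℝ) ≤ 3000 * (k * ((P.n + 1 : ℕ) *
        ((2 * (Nat.log 2 P.n + 1) + 2 : ℕ) : ℝ) ^ 2)) := by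
      exact_mod_cast h5
    rw [Evac.DynamicPath.size]
    calc (t : ℝ) ≤ 3000 * (k * ((P.n + 1 : ℕ) *
          ((2 * (Nat.log 2 P.n + 1) + 2 : ℕ) : ℝ) ^ 2)) := h5'
      _ ≤ 3000 * (k * ((P.n + 1 : ℕ) * (10 * Real.log (P.n + 1 : ℕ)) ^ 2)) := by gcongr
      _ = C * (k * (P.n + 1 : ℕ) * Real.log (P.n + 1 : ℕ) ^ 2) := by
        rw [hC]
        push_cast
        ring
  · rw [Evac.DynamicPath.size] at hsize hkn
    have hn0 : P.n = 0 := by omega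
    have hk1 : k = 1 := by omega
    rw [hn0, hk1] at h5
    norm_num at h5
    omega
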